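/- Let $d\ge 1$ be an integer, $0<\beta<d$ and $q=\frac{d}{d-\beta}$. Let $\sigma$ be the surface measure on the unit sphere $\mathbb{S}^d\subset\mathbb{R}^{d+1}$, let $\mathcal{B}(\xi,r)$ and $\overline{\mathcal{B}(\xi,r)}$ be the open and closed balls for the geodesic distance, and let $\mathbf{e}=(1,0,\dots,0)$. A function $f:\mathbb{S}^d\to\mathbb{C}$ is polar if $f(\xi)$ depends only on $\xi\cdot\mathbf{e}$; $W^{1,1}_{\rm pol}(\mathbb{S}^d)$ is the subspace of polar functions in $W^{1,1}(\mathbb{S}^d)$, with the norm $\|f\|_{1}+\|\nabla f\|_{1}$, where $\nabla$ is the weak gradient on the sphere. For $f\in L^1(\mathbb{S}^d)$ the centered fractional maximal function is $$\mathcal{M}_\beta f(\xi)=\sup_{0<r\le\pi}\frac{r^\beta}{\sigma(\mathcal{B}(\xi,r))}\int_{\mathcal{B}(\xi,r)}|f|\,d\sigma .$$ Assume the following local boundedness property: there is a constant $C$, depending only on $d$ and $\beta$, such that for every $f\in W^{1,1}_{\rm pol}(\mathbb{S}^d)$, every $0<\gamma\le\pi/4$ and every measurable $A\subset\mathbb{S}^d$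 with the property that for each $\xi\in A$ there is $r\in(0,\pi]$ with $\overline{\mathcal{B}(\xi,r)}\subset\mathcal{B}(\mathbf{e},\gamma)$ and $\mathcal{M}_\beta f(\xi)=\frac{r^\beta}{\sigma(\mathcal{B}(\xi,r))}\int_{\mathcal{B}(\xi,r)}|f|\,d\sigma$, one has $$\int_A|\nabla\mathcal{M}_\beta f|^q\,d\sigma\le C\left(\int_{\mathcal{B}(\mathbf{e},2\gamma)}|\nabla f|\,d\sigma\right)^q ,$$ where $\nabla\mathcal{M}_\beta f$ is the weak gradient on $\mathbb{S}^d\setminus\{\mathbf{e},-\mathbf{e}\}$. Then for every $f\in W^{1,1}_{\rm pol}(\mathbb{S}^d)$ the function $\mathcal{M}_\beta f$ is finite almost everywhere and weakly differentiable on $\mathbb{S}^d$ with $|\nabla\mathcal{M}_\beta f|\in L^q(\mathbb{S}^d)$, and the map $f\mapsto|\nabla\mathcal{M}_\beta f|$ is continuous from $W^{1,1}_{\rm pol}(\mathbb{S}^d)$ to $L^q(\mathbb{S}^d)$. -/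

import Mathlib

open MeasureTheory Set Filter Topology
open scoped ENNReal NNReal ContDiff

noncomputable section

namespace PolarSphere

/-- The ambient Euclidean space `ℝ^{d+1}`. -/
abbrev Ambient (d : ℕ) : Type := EuclideanSpace ℝ (Fin (d + 1))

/-- The unit sphere `S^d` in `ℝ^{d+1}`. -/
abbrev Sph (d : ℕ) : Type := Metric.sphere (0 : Ambient d) 1

/-- The usual surface measure on `S^d`. -/
abbrev surf (d : ℕ) : Measure (Sph d) := (volume : Measure (Ambient d)).toSphere

/-- The north pole `e = (1, 0, …, 0)`. -/
def northPole (d : ℕ) : Sph d :=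
  ⟨EuclideanSpace.single 0 1, by simp⟩

/-- Geodesic distance on the sphere: the angle between the two unit vectors. -/
def geoDist {d : ℕ} (ξ η : Sph d) : ℝ :=
  InnerProductGeometry.angle (ξ : Ambient d) (η : Ambient d)

/-- Open geodesic ball. -/
def geoBall {d : ℕ} (ζ : Sph d) (r : ℝ) : Set (Sph d) := {η | geoDist ζ η < r}

/-- Closed geodesic ball. -/
def geoClosedBall {d : ℕ} (ζ : Sph d) (r : ℝ) : Set (Sph d) := {η | geoDist ζ η ≤ r}

/-- A function on the sphere is polar if its value at `ξ` depends only on `ξ · e`. -/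
def IsPolar {d : ℕ} {α : Type*} (f : Sph d → α) : Prop :=
  ∀ ξ η : Sph d, inner ℝ (ξ : Ambient d) (northPole d : Ambient d) =
    inner ℝ (η : Ambient d) (northPole d : Ambient d) → f ξ = f η

/-- The angular derivative `D_{i,j} φ = x_i ∂_j φ - x_j ∂_i φ` at a point of the sphere. It
differentiates along the tangential field `x_i e_j - x_j e_i`, which generates rotations in the
`(i, j)`-plane; so it only depends on the restriction of `φ` to the sphere. -/
def angularDeriv {d : ℕ} (i j : Fin (d + 1)) (φ : Ambient d → ℝ) (ξ : Sph d) : ℝ :=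
  fderiv ℝ φ (ξ : Ambient d)
    ((ξ : Ambient d) i • EuclideanSpace.single j (1 : ℝ) -
      (ξ : Ambient d) j • EuclideanSpace.single i (1 : ℝ))

/-- `G` is the weak gradient of `g` on the open set `U ⊆ S^d`: both are locally integrable in `U`,
`G` is tangential, and for every test function `φ`, smooth and supported in `U`, one has the
integration by parts `∫ g D_{i,j} φ dσ = - ∫ φ D_{i,j} g dσ`, where
`D_{i,j} g = x_i G_j - x_j G_i`. The fields `x_i e_j - x_j e_i` are divergence free and span the
tangent space at every point, so this is the usual notion. Smooth functions on the sphere are the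
restrictions of smooth functions on the ambient space. -/
structure IsWeakGradientOn {𝕜 : Type*} [RCLike 𝕜] {d : ℕ} (U : Set (Sph d))
    (g : Sph d → 𝕜) (G : Sph d → EuclideanSpace 𝕜 (Fin (d + 1))) : Prop where
  locallyIntegrable_fun : LocallyIntegrableOn g U (surf d)
  locallyIntegrable_grad : LocallyIntegrableOn G U (surf d)
  tangential : ∀ᵐ ξ ∂(surf d), ξ ∈ U → ∑ i, (ξ : Ambient d) i • G ξ i = 0
  integral_eq : ∀ φ : Ambient d → ℝ, ContDiff ℝ ∞ φ →
    tsupport (fun ξ : Sph d => φ ξ) ⊆ U → ∀ i j : Fin (d + 1),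
      ∫ ξ, angularDeriv i j φ ξ • g ξ ∂(surf d) =
        - ∫ ξ, φ ξ • ((ξ : Ambient d) i • G ξ j - (ξ : Ambient d) j • G ξ i) ∂(surf d)

/-- The space `W^{1,1}_pol(S^d)` of polar complex-valued Sobolev functions. An element is the pair
of `f ∈ L^1` and its weak gradient `∇f ∈ L^1`, which `f` determines; hence the subspace topology
from `L^1 × L^1` is the topology of the norm `‖f‖_1 + ‖∇f‖_1`. As elements of `L^1` are classes
of functions, polarity asks for a polar representative. -/
def W11pol (d : ℕ) : Type :=
  {p : Lp ℂ 1 (surf d) × Lp (EuclideanSpace ℂ (Fin (d + 1))) 1 (surf d) //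
    IsWeakGradientOn univ (p.1 : Sph d → ℂ) (p.2 : Sph d → EuclideanSpace ℂ (Fin (d + 1))) ∧
      ∃ f₀ : Sph d → ℂ, IsPolar f₀ ∧ p.1 =ᵐ[surf d] f₀}

instance (d : ℕ) : TopologicalSpace (W11pol d) := instTopologicalSpaceSubtype

/-- The function underlying an element of `W^{1,1}_pol(S^d)`. -/
def W11pol.toFun {d : ℕ} (f : W11pol d) : Sph d → ℂ := f.1.1

/-- The weak gradient of an element of `W^{1,1}_pol(S^d)`. -/
def W11pol.grad {d : ℕ} (f : W11pol d) : Sph d → EuclideanSpace ℂ (Fin (d + 1)) := f.1.2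

/-- `r^β` times the average of `|f|` over the geodesic ball of center `ξ` and radius `r`. -/
def fracAverage {d : ℕ} (β : ℝ) (f : Sph d → ℂ) (ξ : Sph d) (r : ℝ) : ℝ≥0∞ :=
  ENNReal.ofReal (r ^ β) / surf d (geoBall ξ r) * ∫⁻ η in geoBall ξ r, ‖f η‖ₑ ∂(surf d)

/-- The centered fractional maximal function
`M_β f(ξ) = sup_{0 < r ≤ π} r^β ⨍_{B(ξ,r)} |f| dσ`, with values in `[0, ∞]`. -/
def fracMaximal {d : ℕ} (β : ℝ) (f : Sph d → ℂ) (ξ : Sph d) : ℝ≥0∞ :=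
  ⨆ r ∈ Ioc (0 : ℝ) Real.pi, fracAverage β f ξ r

/-- The sphere without the two poles. -/
def offPoles (d : ℕ) : Set (Sph d) := {northPole d, -northPole d}ᶜ

/-- The exponent `q = d / (d - β)`. -/
def endpointExponent (d : ℕ) (β : ℝ) : ℝ := d / (d - β)

theorem one_le_endpointExponent {d : ℕ} {β : ℝ} (hβ : 0 < β) (hβd : β < d) :
    1 ≤ ENNReal.ofReal (endpointExponent d β) := by
  rw [ENNReal.one_le_ofReal, endpointExponent, le_div_iff₀ (by linarith)]
  linarith

/-- The local boundedness property of the centered fractional maximal operator: with a constant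
`C` depending only on `d` and `β`, for every `f ∈ W^{1,1}_pol(S^d)`, every `0 < γ ≤ π / 4` and
every measurable `A` such that each `ξ ∈ A` is the center of a closed ball contained in `B(e, γ)`
at which the supremum defining `M_β f(ξ)` is attained, one has
`∫_A |∇ M_β f|^q ≤ C (∫_{B(e, 2γ)} |∇ f|)^q`.
The gradient of `M_β f` is taken on the sphere without the poles, a null set: that `M_β f` is
weakly differentiable across the poles is not part of this property. -/
def CenteredLocalBoundedness (d : ℕ) (β : ℝ) : Prop :=
  ∃ C : ℝ≥0, ∀ (f : W11pol d) (H : Sph d → EuclideanSpace ℝ (Fin (d + 1))),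
    IsWeakGradientOn (offPoles d) (fun ξ => (fracMaximal β f.toFun ξ).toReal) H →
    ∀ (A : Set (Sph d)) (γ : ℝ), MeasurableSet A → 0 < γ → γ ≤ Real.pi / 4 →
      (∀ ξ ∈ A, ∃ r ∈ Ioc (0 : ℝ) Real.pi,
        fracMaximal β f.toFun ξ = fracAverage β f.toFun ξ r ∧
          geoClosedBall ξ r ⊆ geoBall (northPole d) γ) →
      ∫⁻ ξ in A, ‖H ξ‖ₑ ^ endpointExponent d β ∂(surf d) ≤
        C * (∫⁻ ξ in geoBall (northPole d) (2 * γ), ‖f.grad ξ‖ₑ ∂(surf d)) ^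
          endpointExponent d β

end PolarSphere

end

/-! ### Isometries of the sphere, geodesic distance and colatitude. -/

noncomputable section

namespace PolarSphere

variable {d : ℕ}

/-- The action of a linear isometry on the sphere. -/
def sphMap (R : Ambient d ≃ₗᵢ[ℝ] Ambient d) (ξ : Sph d) : Sph d :=
  ⟨R ξ, by simp⟩

@[simp]
theorem coe_sphMap (R : Ambient d ≃ₗᵢ[ℝ] Ambient d) (ξ : Sph d) :
    ((sphMap R ξ : Sph d) : Ambient d) = R ξ := rfl

theorem continuous_sphMap (R : Ambient d ≃ₗᵢ[ℝ] Ambient d) : Continuous (sphMap R) := by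
  unfold sphMap
  fun_prop

theorem sphMap_symm_sphMap (R : Ambient d ≃ₗᵢ[ℝ] Ambient d) (ξ : Sph d) :
    sphMap R.symm (sphMap R ξ) = ξ := by
  ext1; simp

theorem sphMap_sphMap_symm (R : Ambient d ≃ₗᵢ[ℝ] Ambient d) (ξ : Sph d) :
    sphMap R (sphMap R.symm ξ) = ξ := by
  ext1; simp

/-- The action of a linear isometry on the sphere, as a measurable equivalence. -/
def sphEquiv (R : Ambient d ≃ₗᵢ[ℝ] Ambient d) : Sph d ≃ᵐ Sph d where
  toFun := sphMap R
  invFun := sphMap R.symm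
  left_inv := sphMap_symm_sphMap R
  right_inv := sphMap_sphMap_symm R
  measurable_toFun := (continuous_sphMap R).measurable
  measurable_invFun := (continuous_sphMap R.symm).measurable

-- `toSphere` measures a set by the volume of the cone over it, and forming cones commutes with
-- linear isometries, which preserve volume.
open scoped Pointwise in
theorem measurePreserving_sphMap (R : Ambient d ≃ₗᵢ[ℝ] Ambient d) :
    MeasurePreserving (sphMap R) (surf d) (surf d) := by
  refine ⟨(continuous_sphMap R).measurable, ?_⟩
  ext s hs
  have hm := (continuous_sphMap R).measurable
  rw [Measure.map_apply hm hs, Measure.toSphere_apply' _ (hm hs), Measure.toSphere_apply' _ hs]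
  congr 1
  have : Ioo (0 : ℝ) 1 • (((↑) : Sph d → Ambient d) '' (sphMap R ⁻¹' s)) =
      R ⁻¹' (Ioo (0 : ℝ) 1 • (((↑) : Sph d → Ambient d) '' s)) := by
    ext x
    simp only [Set.mem_smul, mem_image, mem_preimage]
    constructor
    · rintro ⟨a, ha, _, ⟨ξ, hξ, rfl⟩, rfl⟩
      exact ⟨a, ha, _, ⟨sphMap R ξ, hξ, rfl⟩, by simp⟩
    · rintro ⟨a, ha, _, ⟨ξ, hξ, rfl⟩, h⟩
      refine ⟨a, ha, _, ⟨sphMap R.symm ξ, by simpa [sphMap_sphMap_symm] using hξ, rfl⟩, ?_⟩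
      apply R.injective
      simp [← h]
  rw [this]
  exact R.measurePreserving.measure_preimage_equiv (f := R.toHomeomorph.toMeasurableEquiv) _

theorem geoDist_eq_arccos (ξ η : Sph d) :
    geoDist ξ η = Real.arccos (inner ℝ (ξ : Ambient d) (η : Ambient d)) := by
  simp [geoDist, InnerProductGeometry.angle]

theorem geoDist_comm (ξ η : Sph d) : geoDist ξ η = geoDist η ξ :=
  InnerProductGeometry.angle_comm _ _

theorem geoDist_nonneg (ξ η : Sph d) : 0 ≤ geoDist ξ η :=
  InnerProductGeometry.angle_nonneg _ _

theorem geoDist_le_pi (ξ η : Sph d) : geoDist ξ η ≤ Real.pi :=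
  InnerProductGeometry.angle_le_pi _ _

theorem geoDist_triangle (ξ η ζ : Sph d) : geoDist ξ ζ ≤ geoDist ξ η + geoDist η ζ :=
  InnerProductGeometry.angle_le_angle_add_angle _ _ _

theorem geoDist_sphMap (R : Ambient d ≃ₗᵢ[ℝ] Ambient d) (ξ η : Sph d) :
    geoDist (sphMap R ξ) (sphMap R η) = geoDist ξ η :=
  R.toLinearIsometry.angle_map _ _

theorem geoDist_neg (ξ η : Sph d) : geoDist (-ξ) η = Real.pi - geoDist ξ η :=
  InnerProductGeometry.angle_neg_left _ _

theorem continuous_geoDist_right (ξ : Sph d) : Continuous fun η : Sph d => geoDist ξ η := by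
  simp only [geoDist_eq_arccos]
  fun_prop

theorem isOpen_geoBall (ξ : Sph d) (r : ℝ) : IsOpen (geoBall ξ r) :=
  isOpen_lt (continuous_geoDist_right ξ) continuous_const

theorem measurableSet_geoBall (ξ : Sph d) (r : ℝ) : MeasurableSet (geoBall ξ r) :=
  (isOpen_geoBall ξ r).measurableSet

theorem sphMap_preimage_geoBall (R : Ambient d ≃ₗᵢ[ℝ] Ambient d) (ξ : Sph d) (r : ℝ) :
    sphMap R ⁻¹' geoBall (sphMap R ξ) r = geoBall ξ r := by
  ext η
  simp [geoBall, geoDist_sphMap]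

/-- The colatitude: the geodesic distance to the north pole. -/
def colat (ξ : Sph d) : ℝ := geoDist (northPole d) ξ

theorem continuous_colat : Continuous (colat : Sph d → ℝ) :=
  continuous_geoDist_right _

theorem measurable_colat : Measurable (colat : Sph d → ℝ) := continuous_colat.measurable

theorem inner_northPole (ξ : Sph d) :
    inner ℝ (ξ : Ambient d) (northPole d : Ambient d) = (ξ : Ambient d) 0 := by
  simp [northPole, EuclideanSpace.inner_single_right]

theorem coord_abs_le_one (ξ : Sph d) (i : Fin (d + 1)) : |(ξ : Ambient d) i| ≤ 1 := by
  have := PiLp.norm_apply_le (ξ : Ambient d) i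
  simpa using this

theorem colat_eq_arccos (ξ : Sph d) : colat ξ = Real.arccos ((ξ : Ambient d) 0) := by
  rw [colat, geoDist_eq_arccos, real_inner_comm, inner_northPole]

theorem cos_colat (ξ : Sph d) : Real.cos (colat ξ) = (ξ : Ambient d) 0 := by
  have := abs_le.1 (coord_abs_le_one ξ 0)
  rw [colat_eq_arccos, Real.cos_arccos this.1 this.2]

theorem colat_nonneg (ξ : Sph d) : 0 ≤ colat ξ := geoDist_nonneg _ _

theorem colat_le_pi (ξ : Sph d) : colat ξ ≤ Real.pi := geoDist_le_pi _ _

theorem sin_colat (ξ : Sph d) : Real.sin (colat ξ) = √(1 - (ξ : Ambient d) 0 ^ 2) := by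
  rw [colat_eq_arccos, Real.sin_arccos]

theorem sin_colat_nonneg (ξ : Sph d) : 0 ≤ Real.sin (colat ξ) := by
  rw [sin_colat]; positivity

theorem abs_colat_sub_le (ξ η : Sph d) : |colat ξ - colat η| ≤ geoDist ξ η := by
  rw [abs_le]
  have h1 := geoDist_triangle (northPole d) ξ η
  have h2 := geoDist_triangle (northPole d) η ξ
  rw [geoDist_comm η ξ] at h2
  unfold colat
  constructor <;> linarith

/-- The reflection in the hyperplane orthogonal to ξ - η exchanges ξ and η. If the colatitudes
agree, ξ - η is orthogonal to the pole, which therefore lies in the hyperplane and is fixed. -/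
theorem exists_sphMap_eq (ξ η : Sph d) : ∃ R : Ambient d ≃ₗᵢ[ℝ] Ambient d, sphMap R ξ = η ∧
    (colat ξ = colat η → sphMap R (northPole d) = northPole d) := by
  refine ⟨(ℝ ∙ ((ξ : Ambient d) - η))ᗮ.reflection, ?_, fun h => ?_⟩
  · ext1
    exact Submodule.reflection_sub (by simp)
  · ext1
    apply Submodule.reflection_mem_subspace_eq_self
    rw [Submodule.mem_orthogonal_singleton_iff_inner_right, inner_sub_left, inner_northPole,
      inner_northPole, ← cos_colat, ← cos_colat, h, sub_self]

theorem colat_sphMap (R : Ambient d ≃ₗᵢ[ℝ] Ambient d)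
    (hR : sphMap R (northPole d) = northPole d) (ξ : Sph d) : colat (sphMap R ξ) = colat ξ := by
  unfold colat
  nth_rw 1 [← hR]
  exact geoDist_sphMap _ _ _

theorem isPolar_iff_colat {α : Type*} {f : Sph d → α} :
    IsPolar f ↔ ∀ ξ η, colat ξ = colat η → f ξ = f η := by
  simp only [IsPolar, inner_northPole, ← cos_colat]
  refine forall₂_congr fun ξ η => ⟨fun h h' => h (by rw [h']), fun h h' => h ?_⟩
  exact Real.injOn_cos ⟨colat_nonneg _, colat_le_pi _⟩ ⟨colat_nonneg _, colat_le_pi _⟩ h'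

/-- The linear map rotating the `(i, j)`-plane by the angle `t`. -/
def rotLin (i j : Fin (d + 1)) (t : ℝ) : Ambient d →ₗ[ℝ] Ambient d where
  toFun x := x + (Real.cos t - 1) • (x i • EuclideanSpace.single i (1 : ℝ) +
    x j • EuclideanSpace.single j (1 : ℝ)) +
    Real.sin t • (x i • EuclideanSpace.single j (1 : ℝ) -
      x j • EuclideanSpace.single i (1 : ℝ))
  map_add' x y := by
    ext k
    simp only [PiLp.add_apply, PiLp.smul_apply, PiLp.sub_apply, smul_eq_mul]; ring
  map_smul' c x := by
    ext k
    simp only [PiLp.add_apply, PiLp.smul_apply, PiLp.sub_apply, smul_eq_mul, RingHom.id_apply]; ring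

theorem norm_rotLin {i j : Fin (d + 1)} (hij : i ≠ j) (t : ℝ) (x : Ambient d) :
    ‖rotLin i j t x‖ = ‖x‖ := by
  rw [← sq_eq_sq₀ (norm_nonneg _) (norm_nonneg _), ← real_inner_self_eq_norm_sq,
    ← real_inner_self_eq_norm_sq]
  simp only [rotLin, LinearMap.coe_mk, AddHom.coe_mk, inner_add_left, inner_add_right,
    inner_sub_left, inner_sub_right, real_inner_smul_left, real_inner_smul_right,
    EuclideanSpace.inner_single_left, EuclideanSpace.inner_single_right]
  simp [hij, hij.symm]
  have := Real.sin_sq_add_cos_sq t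
  linear_combination (x.ofLp i ^ 2 + x.ofLp j ^ 2) * this

/-- The rotation of the `(i, j)`-plane by the angle `t`. -/
def rot {i j : Fin (d + 1)} (hij : i ≠ j) (t : ℝ) : Ambient d ≃ₗᵢ[ℝ] Ambient d :=
  LinearIsometry.toLinearIsometryEquiv ⟨rotLin i j t, norm_rotLin hij t⟩ rfl

theorem rot_apply {i j : Fin (d + 1)} (hij : i ≠ j) (t : ℝ) (x : Ambient d) :
    rot hij t x = x + (Real.cos t - 1) • (x i • EuclideanSpace.single i (1 : ℝ) +
    x j • EuclideanSpace.single j (1 : ℝ)) +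
    Real.sin t • (x i • EuclideanSpace.single j (1 : ℝ) -
      x j • EuclideanSpace.single i (1 : ℝ)) := rfl

theorem rot_rot {i j : Fin (d + 1)} (hij : i ≠ j) (s t : ℝ) (x : Ambient d) :
    rot hij s (rot hij t x) = rot hij (s + t) x := by
  ext k
  rcases eq_or_ne k i with rfl | hki
  · simp [rot_apply, hij, hij.symm, Real.cos_add, Real.sin_add]; ring
  · rcases eq_or_ne k j with rfl | hkj
    · simp [rot_apply, hij, hij.symm, Real.cos_add, Real.sin_add]; ring
    · simp [rot_apply, hki, hkj]

theorem rot_zero {i j : Fin (d + 1)} (hij : i ≠ j) (x : Ambient d) : rot hij 0 x = x := by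
  simp [rot_apply]

theorem sphMap_rot_rot {i j : Fin (d + 1)} (hij : i ≠ j) (s t : ℝ) (ξ : Sph d) :
    sphMap (rot hij s) (sphMap (rot hij t) ξ) = sphMap (rot hij (s + t)) ξ := by
  ext1; simp [rot_rot]

theorem sphMap_rot_zero {i j : Fin (d + 1)} (hij : i ≠ j) (ξ : Sph d) :
    sphMap (rot hij 0) ξ = ξ := by
  ext1; simp [rot_zero]

/-- The velocity of the rotation is the field used in `angularDeriv`; this turns integration by
parts on the sphere into differentiation of rotated integrals. -/
theorem hasDerivAt_rot {i j : Fin (d + 1)} (hij : i ≠ j) (t : ℝ) (x : Ambient d) :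
    HasDerivAt (fun s => rot hij s x) ((rot hij t x) i • EuclideanSpace.single j (1 : ℝ) -
      (rot hij t x) j • EuclideanSpace.single i (1 : ℝ)) t := by
  have h := (((Real.hasDerivAt_cos t).sub_const 1).smul_const
    (x i • EuclideanSpace.single i (1 : ℝ) + x j • EuclideanSpace.single j (1 : ℝ))).const_add x
    |>.add ((Real.hasDerivAt_sin t).smul_const
      (x i • EuclideanSpace.single j (1 : ℝ) - x j • EuclideanSpace.single i (1 : ℝ)))
  refine h.congr_deriv ?_
  simp only [rot_apply]
  ext k
  by_cases hki : k = i
  · subst hki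
    simp [hij, hij.symm]; ring
  · by_cases hkj : k = j
    · subst hkj
      simp [hij, hij.symm]; ring
    · simp [hki, hkj]

theorem continuous_sphMap_rot {i j : Fin (d + 1)} (hij : i ≠ j) :
    Continuous fun p : ℝ × Sph d => sphMap (rot hij p.1) p.2 := by
  unfold sphMap
  simp only [rot_apply]
  fun_prop

end PolarSphere

end

/-! ### The law of the colatitude. -/

noncomputable section

namespace PolarSphere

variable {d : ℕ}

/-- The constant in the density of the law of the colatitude. -/
def latConst (d : ℕ) : ℝ := d * (volume : Measure (EuclideanSpace ℝ (Fin d))).real (Metric.ball 0 1)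

/-- Gluing the first coordinate and the remaining ones. -/
def consMap (d : ℕ) (p : ℝ × EuclideanSpace ℝ (Fin d)) : Ambient d :=
  WithLp.toLp 2 (Fin.cons p.1 p.2.ofLp : Fin (d + 1) → ℝ)

theorem measurePreserving_consMap (d : ℕ) : MeasurePreserving (consMap d)
    ((volume : Measure ℝ).prod (volume : Measure (EuclideanSpace ℝ (Fin d)))) volume := by
  have h1 := (MeasurePreserving.id (volume : Measure ℝ)).prod
    (EuclideanSpace.volume_preserving_symm_measurableEquiv_toLp (Fin d))
  have h2 := (volume_preserving_piFinSuccAbove (fun _ : Fin (d + 1) => ℝ) 0).symm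
  have h3 := PiLp.volume_preserving_toLp (Fin (d + 1))
  have e : consMap d = WithLp.toLp 2 ∘ (MeasurableEquiv.piFinSuccAbove (fun _ => ℝ) 0).symm ∘
      Prod.map id (MeasurableEquiv.toLp 2 (Fin d → ℝ)).symm := by
    funext p
    ext k
    refine Fin.cases ?_ (fun k => ?_) k <;> simp [consMap, MeasurableEquiv.piFinSuccAbove]
  rw [e]
  exact h3.comp (h2.comp h1)

theorem norm_consMap_sq (p : ℝ × EuclideanSpace ℝ (Fin d)) :
    ‖consMap d p‖ ^ 2 = p.1 ^ 2 + ‖p.2‖ ^ 2 := by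
  simp [EuclideanSpace.norm_sq_eq, consMap, Fin.sum_univ_succ]

theorem norm_consMap (p : ℝ × EuclideanSpace ℝ (Fin d)) :
    ‖consMap d p‖ = √(p.1 ^ 2 + ‖p.2‖ ^ 2) := by
  rw [← norm_consMap_sq, Real.sqrt_sq (norm_nonneg _)]

/-- On a line parallel to the polar axis at distance ρ from it, the point of colatitude τ has height
ρ cot τ and norm ρ / sin τ. The norm determines sin τ, and then the height determines cos τ, so the
substitution is injective. -/
theorem lintegral_cot {ρ : ℝ} (hρ : 0 < ρ) (g : ℝ → ℝ≥0∞) :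
    ∫⁻ a, g a = ∫⁻ τ in Ioo 0 Real.pi,
      ENNReal.ofReal (ρ / Real.sin τ ^ 2) * g (ρ * (Real.cos τ / Real.sin τ)) := by
  have hd : ∀ τ ∈ Ioo 0 Real.pi, HasDerivWithinAt (fun τ => ρ * (Real.cos τ / Real.sin τ))
      (-(ρ / Real.sin τ ^ 2)) (Ioo 0 Real.pi) τ := by
    intro τ hτ
    have hs := (Real.sin_pos_of_mem_Ioo hτ).ne'
    have := (((Real.hasDerivAt_cos τ).div (Real.hasDerivAt_sin τ) hs).const_mul ρ)
    refine (this.congr_deriv ?_).hasDerivWithinAt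
    have := Real.sin_sq_add_cos_sq τ
    field_simp
    linear_combination -this
  have key : ∀ τ ∈ Ioo 0 Real.pi, ∀ a, a = ρ * (Real.cos τ / Real.sin τ) →
      √(a ^ 2 + ρ ^ 2) = ρ / Real.sin τ := by
    intro τ hτ a ha
    have hs := Real.sin_pos_of_mem_Ioo hτ
    rw [Real.sqrt_eq_iff_mul_self_eq (by positivity) (by positivity), ha]
    have := Real.sin_sq_add_cos_sq τ
    field_simp
    linear_combination (1 : ℝ) * this
  have hinj : InjOn (fun τ => ρ * (Real.cos τ / Real.sin τ)) (Ioo 0 Real.pi) := by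
    intro τ hτ τ' hτ' h
    have h1 := key τ hτ _ rfl
    have h2 := key τ' hτ' _ h
    rw [h1] at h2
    have hs := Real.sin_pos_of_mem_Ioo hτ
    have hs' := Real.sin_pos_of_mem_Ioo hτ'
    have h3 : Real.sin τ = Real.sin τ' := by
      field_simp at h2; linarith
    simp only [h3] at h
    have h4 : Real.cos τ = Real.cos τ' := by field_simp at h; exact h
    exact Real.injOn_cos (Ioo_subset_Icc_self hτ) (Ioo_subset_Icc_self hτ') h4
  have himg : (fun τ => ρ * (Real.cos τ / Real.sin τ)) '' (Ioo 0 Real.pi) = univ := by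
    refine eq_univ_of_forall fun a => ?_
    have hS : 0 < √(a ^ 2 + ρ ^ 2) := by positivity
    have hS2 : √(a ^ 2 + ρ ^ 2) ^ 2 = a ^ 2 + ρ ^ 2 := Real.sq_sqrt (by positivity)
    have hlt : |a / √(a ^ 2 + ρ ^ 2)| < 1 := by
      rw [abs_div, abs_of_pos hS, div_lt_one hS]
      apply Real.lt_sqrt_of_sq_lt
      rw [sq_abs]; nlinarith
    rw [abs_lt] at hlt
    refine ⟨Real.arccos (a / √(a ^ 2 + ρ ^ 2)), ⟨Real.arccos_pos.2 hlt.2, ?_⟩, ?_⟩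
    · rw [Real.arccos_lt_pi]; exact hlt.1
    · simp only
      rw [Real.cos_arccos hlt.1.le hlt.2.le, Real.sin_arccos]
      have : √(1 - (a / √(a ^ 2 + ρ ^ 2)) ^ 2) = ρ / √(a ^ 2 + ρ ^ 2) := by
        rw [Real.sqrt_eq_iff_mul_self_eq (by rw [div_pow, hS2, sub_nonneg, div_le_one] <;> nlinarith)
          (by positivity)]
        field_simp
        linarith
      rw [this]
      field_simp
  have := lintegral_image_eq_lintegral_abs_deriv_mul measurableSet_Ioo hd hinj g
  rw [himg, setLIntegral_univ] at this
  rw [this]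
  refine setLIntegral_congr_fun measurableSet_Ioo fun τ hτ => ?_
  simp only [abs_neg]
  rw [abs_of_nonneg (by positivity)]

theorem lintegral_norm_ball [NeZero d] {R : ℝ} (hR : 0 ≤ R) :
    ∫⁻ y : EuclideanSpace ℝ (Fin d), ENNReal.ofReal (‖y‖ * (Iio R).indicator 1 ‖y‖) =
      ENNReal.ofReal (latConst d * (R ^ (d + 1) / (d + 1))) := by
  have : Nontrivial (EuclideanSpace ℝ (Fin d)) := by
    apply Module.nontrivial_of_finrank_pos (R := ℝ)
    simp [NeZero.pos]
  have e : EqOn (fun y : ℝ => y ^ (d - 1) • (y * (Iio R).indicator (1 : ℝ → ℝ) y))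
      ((Iio R).indicator (fun y => y ^ d)) (Ioi 0) := by
    intro y hy
    by_cases h : y < R
    · simp [h, ← pow_succ, Nat.sub_add_cancel (NeZero.one_le : 1 ≤ d)]
    · simp [h]
  have hI : IntegrableOn (fun y : ℝ => y ^ (d - 1) • (y * (Iio R).indicator (1 : ℝ → ℝ) y))
      (Ioi 0) := by
    rw [integrableOn_congr_fun e measurableSet_Ioi, integrableOn_indicator_iff measurableSet_Iio]
    have : IntegrableOn (fun y : ℝ => y ^ d) (Icc 0 R) :=
      (by fun_prop : Continuous fun y : ℝ => y ^ d).continuousOn.integrableOn_Icc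
    exact this.mono_set fun y hy => ⟨le_of_lt hy.2, le_of_lt hy.1⟩
  rw [← ofReal_integral_eq_lintegral_ofReal]
  · rw [integral_fun_norm_addHaar volume (fun y => y * (Iio R).indicator 1 y),
      finrank_euclideanSpace_fin,
      setIntegral_congr_fun measurableSet_Ioi e, setIntegral_indicator measurableSet_Iio,
      Ioi_inter_Iio, ← integral_Ioc_eq_integral_Ioo, ← intervalIntegral.integral_of_le hR,
      integral_pow, latConst]
    congr 1
    simp
    ring
  · rw [integrable_fun_norm_addHaar volume (f := fun y => y * (Iio R).indicator 1 y),
      finrank_euclideanSpace_fin]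
    exact hI
  · exact Eventually.of_forall fun y => mul_nonneg (norm_nonneg _)
      (indicator_nonneg (by simp) _)

theorem latConst_pos [NeZero d] : 0 < latConst d := by
  unfold latConst
  have : (0 : ℝ) < d := by exact_mod_cast NeZero.pos d
  have h2 : 0 < (volume : Measure (EuclideanSpace ℝ (Fin d))).real (Metric.ball 0 1) :=
    ENNReal.toReal_pos (Metric.measure_ball_pos _ _ one_pos).ne' measure_ball_lt_top.ne
  positivity

open scoped Pointwise in
theorem smul_image_colat_preimage (E : Set ℝ) :
    Ioo (0 : ℝ) 1 • (((↑) : Sph d → Ambient d) '' (colat ⁻¹' E)) =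
      {x | 0 < ‖x‖ ∧ ‖x‖ < 1 ∧ Real.arccos (x 0 / ‖x‖) ∈ E} := by
  ext x
  simp only [Set.mem_smul, mem_image, mem_preimage, mem_ofPred_eq]
  constructor
  · rintro ⟨a, ha, _, ⟨ξ, hξ, rfl⟩, rfl⟩
    have : ‖a • (ξ : Ambient d)‖ = a := by simp [norm_smul, abs_of_pos ha.1]
    rw [this]
    refine ⟨ha.1, ha.2, ?_⟩
    rw [colat_eq_arccos] at hξ
    simpa [ha.1.ne'] using hξ
  · rintro ⟨h0, h1, h⟩
    refine ⟨‖x‖, ⟨h0, h1⟩, ‖x‖⁻¹ • x, ⟨⟨‖x‖⁻¹ • x, ?_⟩, ?_, rfl⟩, ?_⟩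
    · simp [norm_smul, h0.ne']
    · rw [colat_eq_arccos]
      simpa [div_eq_inv_mul] using h
    · rw [smul_smul, mul_inv_cancel₀ h0.ne', one_smul]

/-- After the cotangent substitution the condition of lying in the unit ball reads ρ / sin τ < 1,
which is the cutoff ρ < sin τ. The Jacobian ρ / sin² τ is split so that its factor ρ stays with the
cutoff. -/
theorem volume_slice (E : Set ℝ) {ρ : ℝ} (hρ : 0 < ρ) {S : Set ℝ} (hSm : MeasurableSet S)
    (hS : S = {a | √(a ^ 2 + ρ ^ 2) < 1 ∧ Real.arccos (a / √(a ^ 2 + ρ ^ 2)) ∈ E}) :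
    volume S = ∫⁻ τ in Ioo 0 Real.pi, E.indicator (fun τ => ENNReal.ofReal (1 / Real.sin τ ^ 2)) τ *
      ENNReal.ofReal (ρ * (Iio (Real.sin τ)).indicator 1 ρ) := by
  rw [← lintegral_indicator_one hSm, lintegral_cot hρ]
  refine setLIntegral_congr_fun measurableSet_Ioo fun τ hτ => ?_
  have hs := Real.sin_pos_of_mem_Ioo hτ
  have e1 : √((ρ * (Real.cos τ / Real.sin τ)) ^ 2 + ρ ^ 2) = ρ / Real.sin τ := by
    rw [Real.sqrt_eq_iff_mul_self_eq (by positivity) (by positivity)]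
    have := Real.sin_sq_add_cos_sq τ
    field_simp
    linear_combination (1 : ℝ) * this
  have e2 : ρ * (Real.cos τ / Real.sin τ) / (ρ / Real.sin τ) = Real.cos τ := by field_simp
  have e3 : ρ * (Real.cos τ / Real.sin τ) ∈ S ↔ ρ < Real.sin τ ∧ τ ∈ E := by
    rw [hS, mem_ofPred_eq, e1, e2, Real.arccos_cos hτ.1.le hτ.2.le, div_lt_one hs]
  by_cases h1 : ρ < Real.sin τ
  · by_cases h2 : τ ∈ E
    · simp only [indicator, e3, h1, h2, mem_Iio, and_self, if_true, Pi.one_apply, mul_one]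
      rw [← ENNReal.ofReal_mul (by positivity)]
      congr 1; ring
    · simp [indicator, e3, h2]
  · simp [indicator, e3, h1]

/-- The surface measure of a latitude set is d + 1 times the volume of its cone. The cone is sliced
by lines parallel to the axis and the colatitude is introduced on each line; integrating |y| over
the ball of radius sin τ gives sin^(d+1) / (d+1), of which the Jacobian 1 / sin² leaves sin^(d-1).
-/
theorem map_colat [NeZero d] : (surf d).map colat =
    (volume.restrict (Ioo 0 Real.pi)).withDensity
      fun τ => ENNReal.ofReal (latConst d * Real.sin τ ^ (d - 1)) := by
  ext E hE
  have hSm : MeasurableSet {x : Ambient d | 0 < ‖x‖ ∧ ‖x‖ < 1 ∧ Real.arccos (x 0 / ‖x‖) ∈ E} := by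
    have hm : Measurable fun x : Ambient d => Real.arccos (x 0 / ‖x‖) := by fun_prop
    exact (measurableSet_lt measurable_const measurable_norm).inter
      ((measurableSet_lt measurable_norm measurable_const).inter (hm hE))
  have hP := (measurePreserving_consMap d).measure_preimage hSm.nullMeasurableSet
  have hcm := (measurePreserving_consMap d).measurable
  have hsl : ∀ᵐ y : EuclideanSpace ℝ (Fin d), (volume : Measure ℝ)
      ((fun a => (a, y)) ⁻¹' (consMap d ⁻¹'
        {x : Ambient d | 0 < ‖x‖ ∧ ‖x‖ < 1 ∧ Real.arccos (x 0 / ‖x‖) ∈ E})) =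
      ∫⁻ τ in Ioo 0 Real.pi, E.indicator (fun τ => ENNReal.ofReal (1 / Real.sin τ ^ 2)) τ *
        ENNReal.ofReal (‖y‖ * (Iio (Real.sin τ)).indicator 1 ‖y‖) := by
    have : Nontrivial (EuclideanSpace ℝ (Fin d)) := by
      apply Module.nontrivial_of_finrank_pos (R := ℝ)
      simp [NeZero.pos]
    have h0 : ∀ᵐ y : EuclideanSpace ℝ (Fin d), y ≠ 0 := Measure.ae_ne volume 0
    filter_upwards [h0] with y hy
    refine volume_slice E (norm_pos_iff.2 hy) ?_ ?_
    · exact (hcm.comp measurable_prodMk_right) hSm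
    · ext a
      have hp : 0 < √(a ^ 2 + ‖y‖ ^ 2) := by
        have := norm_pos_iff.2 hy
        positivity
      have : (consMap d (a, y)) 0 = a := by simp [consMap]
      simp only [mem_preimage, mem_ofPred_eq, this, norm_consMap, hp, true_and]
  have hmE : Measurable (E.indicator fun τ => ENNReal.ofReal (1 / Real.sin τ ^ 2)) :=
    Measurable.indicator (by fun_prop) hE
  rw [Measure.map_apply measurable_colat hE, Measure.toSphere_apply' _ (measurable_colat hE),
    smul_image_colat_preimage, ← hP, Measure.prod_apply_symm (hcm hSm), lintegral_congr_ae hsl,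
    lintegral_lintegral_swap]
  · have hin : ∀ τ ∈ Ioo 0 Real.pi, ∫⁻ y : EuclideanSpace ℝ (Fin d),
        E.indicator (fun τ => ENNReal.ofReal (1 / Real.sin τ ^ 2)) τ *
          ENNReal.ofReal (‖y‖ * (Iio (Real.sin τ)).indicator 1 ‖y‖) =
        E.indicator (fun τ => ENNReal.ofReal (1 / (d + 1)) *
          ENNReal.ofReal (latConst d * Real.sin τ ^ (d - 1))) τ := by
      intro τ hτ
      have hs := Real.sin_pos_of_mem_Ioo hτ
      rw [lintegral_const_mul' _ _ (by by_cases h : τ ∈ E <;> simp [h]),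
        lintegral_norm_ball hs.le]
      by_cases h : τ ∈ E
      · simp only [h, indicator_of_mem]
        rw [← ENNReal.ofReal_mul (by positivity), ← ENNReal.ofReal_mul (by positivity)]
        congr 1
        have : Real.sin τ ^ (d + 1) = Real.sin τ ^ (d - 1) * Real.sin τ ^ 2 := by
          rw [← pow_add]; congr 1; have := NeZero.one_le (n := d); omega
        rw [this]
        field_simp
      · simp [h]
    rw [setLIntegral_congr_fun measurableSet_Ioo hin, lintegral_indicator hE,
      lintegral_const_mul' _ _ (by simp), withDensity_apply _ hE, ← mul_assoc]
    have : ((Module.finrank ℝ (Ambient d) : ℕ) : ℝ≥0∞) * ENNReal.ofReal (1 / (d + 1)) = 1 := by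
      rw [finrank_euclideanSpace_fin, ← ENNReal.ofReal_natCast, ← ENNReal.ofReal_mul (by positivity)]
      push_cast
      rw [mul_one_div_cancel (by positivity), ENNReal.ofReal_one]
    rw [this, one_mul]
  · refine Measurable.aemeasurable (Measurable.mul (hmE.comp measurable_snd) ?_)
    have : (fun p : EuclideanSpace ℝ (Fin d) × ℝ =>
        ‖p.1‖ * (Iio (Real.sin p.2)).indicator (1 : ℝ → ℝ) ‖p.1‖) =
        {p : EuclideanSpace ℝ (Fin d) × ℝ | ‖p.1‖ < Real.sin p.2}.indicator fun p => ‖p.1‖ := by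
      ext p
      by_cases h : ‖p.1‖ < Real.sin p.2 <;> simp [h]
    refine Measurable.ennreal_ofReal ?_
    change Measurable (fun p : EuclideanSpace ℝ (Fin d) × ℝ =>
        ‖p.1‖ * (Iio (Real.sin p.2)).indicator (1 : ℝ → ℝ) ‖p.1‖)
    rw [this]
    exact Measurable.indicator (by fun_prop) (measurableSet_lt (by fun_prop) (by fun_prop))

theorem lintegral_colat [NeZero d] {g : ℝ → ℝ≥0∞} (hg : Measurable g) :
    ∫⁻ ξ, g (colat ξ) ∂(surf d) =
      ∫⁻ τ in Ioo 0 Real.pi, ENNReal.ofReal (latConst d * Real.sin τ ^ (d - 1)) * g τ := by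
  rw [← lintegral_map hg measurable_colat, map_colat, lintegral_withDensity_eq_lintegral_mul]
  · rfl
  · fun_prop
  · exact hg

theorem ae_colat_of_ae [NeZero d] {p : ℝ → Prop} (h : ∀ᵐ τ, τ ∈ Ioo 0 Real.pi → p τ) :
    ∀ᵐ ξ ∂(surf d), colat ξ ∈ Ioo 0 Real.pi ∧ p (colat ξ) := by
  refine ae_of_ae_map measurable_colat.aemeasurable (p := fun τ => τ ∈ Ioo 0 Real.pi ∧ p τ) ?_
  rw [map_colat]
  refine (withDensity_absolutelyContinuous _ _).ae_le ?_
  change ∀ᵐ τ ∂volume.restrict (Ioo 0 Real.pi), τ ∈ Ioo 0 Real.pi ∧ p τ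
  rw [ae_restrict_iff' measurableSet_Ioo]
  filter_upwards [h] with τ h1 h2 using ⟨h2, h1 h2⟩

theorem integral_colat [NeZero d] {E : Type*} [NormedAddCommGroup E] [NormedSpace ℝ E] {g : ℝ → E}
    (hg : StronglyMeasurable g) :
    ∫ ξ, g (colat ξ) ∂(surf d) =
      ∫ τ in Ioo 0 Real.pi, (latConst d * Real.sin τ ^ (d - 1)) • g τ := by
  rw [← integral_map measurable_colat.aemeasurable hg.aestronglyMeasurable, map_colat,
    integral_withDensity_eq_integral_toReal_smul (by fun_prop) (by simp)]
  refine setIntegral_congr_fun measurableSet_Ioo fun τ hτ => ?_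
  have := Real.sin_pos_of_mem_Ioo hτ
  have := latConst_pos (d := d)
  rw [ENNReal.toReal_ofReal (by positivity)]

theorem integrable_colat_iff [NeZero d] {E : Type*} [NormedAddCommGroup E] [NormedSpace ℝ E]
    {g : ℝ → E} (hg : StronglyMeasurable g) :
    Integrable (fun ξ => g (colat ξ)) (surf d) ↔
      IntegrableOn (fun τ => Real.sin τ ^ (d - 1) • g τ) (Ioo 0 Real.pi) := by
  have h1 : Integrable (fun ξ => g (colat ξ)) (surf d) ↔ Integrable g ((surf d).map colat) :=
    (integrable_map_measure hg.aestronglyMeasurable measurable_colat.aemeasurable).symm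
  rw [h1, map_colat, integrable_withDensity_iff_integrable_smul' (by fun_prop) (by simp)]
  have hc := latConst_pos (d := d)
  have h2 : EqOn (fun τ => (ENNReal.ofReal (latConst d * Real.sin τ ^ (d - 1))).toReal • g τ)
      (fun τ => latConst d • (Real.sin τ ^ (d - 1) • g τ)) (Ioo 0 Real.pi) := by
    intro τ hτ
    have := Real.sin_pos_of_mem_Ioo hτ
    simp only
    rw [ENNReal.toReal_ofReal (by positivity), mul_smul]
  change IntegrableOn _ _ _ ↔ _
  rw [integrableOn_congr_fun h2 measurableSet_Ioo]
  exact integrable_smul_iff hc.ne' _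

end PolarSphere

end

/-! ### Meridians, radial vector fields, differentiation along rotations, and profiles. -/

noncomputable section

namespace PolarSphere

variable {d : ℕ}

theorem zero_ne_one_fin [NeZero d] : (0 : Fin (d + 1)) ≠ 1 := by
  have := NeZero.one_le (n := d)
  intro h
  have := congrArg Fin.val h
  rw [Fin.val_one'] at this
  simp at this
  omega

/-- The point with colatitude `θ` on a fixed meridian. -/
def mer [NeZero d] (θ : ℝ) : Sph d := sphMap (rot zero_ne_one_fin θ) (northPole d)

theorem mer_coord [NeZero d] (θ : ℝ) : ((mer θ : Sph d) : Ambient d) =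
    Real.cos θ • EuclideanSpace.single 0 1 + Real.sin θ • EuclideanSpace.single 1 1 := by
  have h := zero_ne_one_fin (d := d)
  ext k
  by_cases hk : k = 0
  · subst hk
    simp [mer, rot_apply, northPole, h, h.symm]
  · simp [mer, rot_apply, northPole, hk, h.symm]

theorem sphMap_rot_mer [NeZero d] (s t : ℝ) :
    sphMap (rot zero_ne_one_fin s) (mer t : Sph d) = mer (s + t) := by
  rw [mer, sphMap_rot_rot, mer]

theorem inner_mer [NeZero d] (s t : ℝ) :
    inner ℝ ((mer s : Sph d) : Ambient d) (mer t : Sph d) = Real.cos (s - t) := by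
  have h := zero_ne_one_fin (d := d)
  rw [mer_coord, mer_coord, Real.cos_sub]
  simp only [inner_add_left, inner_add_right, real_inner_smul_left, real_inner_smul_right,
    EuclideanSpace.inner_single_left]
  simp [h, h.symm, mul_comm]

theorem geoDist_mer [NeZero d] {s t : ℝ} (h : |s - t| ≤ Real.pi) :
    geoDist (mer s : Sph d) (mer t) = |s - t| := by
  rw [geoDist_eq_arccos, inner_mer, ← Real.cos_abs, Real.arccos_cos (abs_nonneg _) h]

theorem mer_zero [NeZero d] : (mer 0 : Sph d) = northPole d := sphMap_rot_zero _ _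

theorem colat_mer [NeZero d] {t : ℝ} (h : t ∈ Icc 0 Real.pi) : colat (mer t : Sph d) = t := by
  rw [colat, ← mer_zero, geoDist_mer] <;> rw [zero_sub, abs_neg, abs_of_nonneg h.1]
  exact h.2

/-- The coordinates of the unit vector field which is the gradient of the colatitude. -/
def tanCoord (ξ : Sph d) (i : Fin (d + 1)) : ℝ :=
  -((EuclideanSpace.single 0 1 : Ambient d) i - (ξ : Ambient d) 0 * (ξ : Ambient d) i) /
    Real.sin (colat ξ)

/-- The gradient of `F ∘ colat`, where `w` is the derivative of `F`. -/
def radGrad {𝕜 : Type*} [RCLike 𝕜] (w : ℝ → 𝕜) (ξ : Sph d) : EuclideanSpace 𝕜 (Fin (d + 1)) :=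
  WithLp.toLp 2 fun i => tanCoord ξ i • w (colat ξ)

theorem sum_coord_sq (ξ : Sph d) : ∑ i, (ξ : Ambient d) i ^ 2 = 1 := by
  have := EuclideanSpace.real_norm_sq_eq (ξ : Ambient d)
  rw [← this]; simp

theorem sin_colat_sq (ξ : Sph d) : Real.sin (colat ξ) ^ 2 = 1 - (ξ : Ambient d) 0 ^ 2 := by
  rw [← cos_colat, Real.sin_sq]

theorem sum_tanCoord_sq {ξ : Sph d} (h : Real.sin (colat ξ) ≠ 0) :
    ∑ i, tanCoord ξ i ^ 2 = 1 := by
  have h1 : ∑ i, ((EuclideanSpace.single 0 1 : Ambient d) i -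
      (ξ : Ambient d) 0 * (ξ : Ambient d) i) ^ 2 = 1 - (ξ : Ambient d) 0 ^ 2 := by
    have : ∀ i, ((EuclideanSpace.single 0 1 : Ambient d) i -
      (ξ : Ambient d) 0 * (ξ : Ambient d) i) ^ 2 =
      (1 - 2 * (ξ : Ambient d) 0 * (ξ : Ambient d) i) * (EuclideanSpace.single 0 1 : Ambient d) i +
      (ξ : Ambient d) 0 ^ 2 * (ξ : Ambient d) i ^ 2 := by
      intro i
      by_cases hi : i = 0
      · subst hi; simp; ring
      · simp [hi]; ring
    rw [Finset.sum_congr rfl fun i _ => this i, Finset.sum_add_distrib, ← Finset.mul_sum,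
      sum_coord_sq]
    simp
    ring
  simp only [tanCoord, div_pow, neg_sq]
  rw [← Finset.sum_div, h1, ← sin_colat_sq, div_self (pow_ne_zero _ h)]

theorem sum_coord_mul_tanCoord (ξ : Sph d) : ∑ i, (ξ : Ambient d) i * tanCoord ξ i = 0 := by
  have : ∀ i, (ξ : Ambient d) i * tanCoord ξ i =
    -((ξ : Ambient d) i * (EuclideanSpace.single 0 1 : Ambient d) i -
      (ξ : Ambient d) 0 * (ξ : Ambient d) i ^ 2) / Real.sin (colat ξ) := by
    intro i; rw [tanCoord]; ring
  rw [Finset.sum_congr rfl fun i _ => this i, ← Finset.sum_div, Finset.sum_neg_distrib,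
    Finset.sum_sub_distrib, ← Finset.mul_sum, sum_coord_sq]
  simp

theorem norm_radGrad {𝕜 : Type*} [RCLike 𝕜] (w : ℝ → 𝕜) {ξ : Sph d}
    (h : colat ξ ∈ Ioo 0 Real.pi) : ‖radGrad w ξ‖ = ‖w (colat ξ)‖ := by
  have hs := (Real.sin_pos_of_mem_Ioo h).ne'
  rw [EuclideanSpace.norm_eq]
  simp only [radGrad, norm_smul, mul_pow, Real.norm_eq_abs, sq_abs]
  rw [← Finset.sum_mul, sum_tanCoord_sq hs, one_mul, Real.sqrt_sq (norm_nonneg _)]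

/-- The angular derivatives of the colatitude. -/
def angColat (i j : Fin (d + 1)) (ξ : Sph d) : ℝ :=
  (ξ : Ambient d) i * tanCoord ξ j - (ξ : Ambient d) j * tanCoord ξ i

theorem angColat_eq (i j : Fin (d + 1)) (ξ : Sph d) : angColat i j ξ =
    -((ξ : Ambient d) i * (EuclideanSpace.single 0 1 : Ambient d) j -
      (ξ : Ambient d) j * (EuclideanSpace.single 0 1 : Ambient d) i) / Real.sin (colat ξ) := by
  unfold angColat tanCoord; ring

theorem coord_sq_le {ξ : Sph d} {i : Fin (d + 1)} (hi : i ≠ 0) :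
    (ξ : Ambient d) i ^ 2 ≤ Real.sin (colat ξ) ^ 2 := by
  have h := sum_coord_sq ξ
  rw [← Finset.add_sum_erase _ _ (Finset.mem_univ 0)] at h
  rw [sin_colat_sq, ← eq_sub_of_add_eq' h]
  exact Finset.single_le_sum (f := fun i => (ξ : Ambient d) i ^ 2) (fun _ _ => sq_nonneg _)
    (by simp [hi])

/-- The colatitude is 1-Lipschitz and the rotation fields have length at most 1. In coordinates,
only the case that one index is 0 matters, and a coordinate other than the zeroth is at most sin
`colat` on the unit sphere; at the poles division by zero gives 0. -/
theorem abs_angColat_le {i j : Fin (d + 1)} (hij : i ≠ j) (ξ : Sph d) : |angColat i j ξ| ≤ 1 := by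
  rw [angColat_eq, abs_div, abs_neg, abs_of_nonneg (sin_colat_nonneg ξ)]
  refine div_le_one_of_le₀ ?_ (sin_colat_nonneg ξ)
  apply abs_le_of_sq_le_sq _ (sin_colat_nonneg ξ)
  by_cases hi : i = 0
  · subst hi
    simpa [hij.symm] using coord_sq_le hij.symm
  · by_cases hj : j = 0
    · subst hj
      simpa [hi] using coord_sq_le hi
    · simp [hi, hj]; positivity

theorem continuous_coord (i : Fin (d + 1)) : Continuous fun ξ : Sph d => (ξ : Ambient d) i := by
  fun_prop

theorem measurable_tanCoord (i : Fin (d + 1)) : Measurable fun ξ : Sph d => tanCoord ξ i := by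
  unfold tanCoord
  have h1 := (continuous_coord (d := d) i).measurable
  have h2 := (continuous_coord (d := d) 0).measurable
  have h3 := Real.measurable_sin.comp (measurable_colat (d := d))
  exact ((measurable_const.sub (h2.mul h1)).neg).div h3

theorem measurable_angColat (i j : Fin (d + 1)) : Measurable fun ξ : Sph d => angColat i j ξ := by
  unfold angColat
  exact ((continuous_coord i).measurable.mul (measurable_tanCoord j)).sub
    ((continuous_coord j).measurable.mul (measurable_tanCoord i))

theorem continuous_orbit {i j : Fin (d + 1)} (hij : i ≠ j) (ξ : Sph d) :
    Continuous fun τ => sphMap (rot hij τ) ξ := by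
  unfold sphMap
  simp only [rot_apply]
  fun_prop

section Flow

variable {E : Type*} [NormedAddCommGroup E] [NormedSpace ℝ E]
  {i j : Fin (d + 1)} (hij : i ≠ j)

theorem integral_rot_comp (Ψ : Sph d → ℝ) (g : Sph d → E) (τ : ℝ) :
    ∫ ξ, Ψ (sphMap (rot hij (-τ)) ξ) • g ξ ∂(surf d) =
      ∫ ξ, Ψ ξ • g (sphMap (rot hij τ) ξ) ∂(surf d) := by
  have h := (measurePreserving_sphMap (rot hij τ)).integral_comp
    (sphEquiv (rot hij τ)).measurableEmbedding (fun ξ => Ψ (sphMap (rot hij (-τ)) ξ) • g ξ)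
  rw [← h]
  simp [sphMap_rot_rot, sphMap_rot_zero]

theorem integrable_bdd_smul {Ψ : Sph d → ℝ} (hΨ : Measurable Ψ) {C : ℝ} (hC : ∀ ξ, |Ψ ξ| ≤ C)
    {g : Sph d → E} (hg : Integrable g (surf d)) : Integrable (fun ξ => Ψ ξ • g ξ) (surf d) :=
  hg.bdd_smul C hΨ.aestronglyMeasurable (Eventually.of_forall hC)

theorem norm_integral_bdd_smul_sub_le {Ψ : Sph d → ℝ} (hΨ : Measurable Ψ) {C : ℝ}
    (hC : ∀ ξ, |Ψ ξ| ≤ C) {g g' : Sph d → E} (hg : Integrable g (surf d))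
    (hg' : Integrable g' (surf d)) :
    ‖∫ ξ, Ψ ξ • g ξ ∂(surf d) - ∫ ξ, Ψ ξ • g' ξ ∂(surf d)‖ ≤ C * ∫ ξ, ‖g ξ - g' ξ‖ ∂(surf d) := by
  rw [← integral_sub (integrable_bdd_smul hΨ hC hg) (integrable_bdd_smul hΨ hC hg'),
    ← integral_const_mul]
  refine norm_integral_le_of_norm_le ((hg.sub hg').norm.const_mul C) (Eventually.of_forall ?_)
  intro ξ
  rw [← smul_sub, norm_smul]
  exact mul_le_mul_of_nonneg_right (hC ξ) (norm_nonneg _)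

theorem measurable_comp_rot {Ψ : Sph d → ℝ} (hΨ : Measurable Ψ) (τ : ℝ) :
    Measurable fun ξ => Ψ (sphMap (rot hij τ) ξ) :=
  hΨ.comp (continuous_sphMap _).measurable

/-- Ψ is only measurable, so the rotation is moved to `g`. For continuous `g` dominated convergence
applies, and L^1 approximation of `g` is uniform in the angle because rotations preserve the
measure. -/
theorem continuous_integral_rot {Ψ : Sph d → ℝ} (hΨ : Measurable Ψ) {C : ℝ}
    (hC : ∀ ξ, |Ψ ξ| ≤ C) {g : Sph d → E} (hg : Integrable g (surf d)) :
    Continuous fun τ => ∫ ξ, Ψ (sphMap (rot hij (-τ)) ξ) • g ξ ∂(surf d) := by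
  have hC0 : 0 ≤ C := (abs_nonneg _).trans (hC (northPole d))
  refine continuous_of_uniform_approx_of_continuous fun u hu => ?_
  obtain ⟨ε, hε, hεu⟩ := Metric.mem_uniformity_dist.1 hu
  obtain ⟨g', -, h1, h2, h3⟩ := hg.exists_hasCompactSupport_integral_sub_le
    (show 0 < ε / (2 * (C + 1)) by positivity)
  refine ⟨fun τ => ∫ ξ, Ψ (sphMap (rot hij (-τ)) ξ) • g' ξ ∂(surf d), ?_, fun τ => hεu ?_⟩
  · simp only [integral_rot_comp]
    obtain ⟨B, hB⟩ := isCompact_univ.exists_bound_of_continuousOn h2.continuousOn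
    refine continuous_of_dominated (bound := fun _ => C * B) ?_ ?_ (integrable_const _) ?_
    · intro τ
      exact hΨ.aestronglyMeasurable.smul
        (h2.comp (continuous_sphMap _)).aestronglyMeasurable
    · intro τ
      refine Eventually.of_forall fun ξ => ?_
      rw [norm_smul]
      exact mul_le_mul (hC ξ) (hB _ (mem_univ _)) (norm_nonneg _) hC0
    · refine Eventually.of_forall fun ξ => ?_
      exact (h2.comp (continuous_orbit hij ξ)).const_smul _
  · rw [dist_eq_norm]
    refine (norm_integral_bdd_smul_sub_le (measurable_comp_rot hij hΨ _) (fun _ => hC _) hg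
      h3).trans_lt ?_
    calc C * ∫ ξ, ‖g ξ - g' ξ‖ ∂(surf d) ≤ C * (ε / (2 * (C + 1))) := by gcongr
      _ < ε := by
        rw [mul_div_assoc', div_lt_iff₀ (by positivity)]
        nlinarith

/-- `g` is the derivative of `v` along the rotations of the `(i, j)`-plane, in integrated form. -/
def FlowDeriv (v g : Sph d → E) : Prop :=
  ∀ Ψ : Sph d → ℝ, Measurable Ψ → (∀ ξ, |Ψ ξ| ≤ 1) → ∀ t : ℝ,
    ∫ ξ, Ψ (sphMap (rot hij (-t)) ξ) • v ξ ∂(surf d) - ∫ ξ, Ψ ξ • v ξ ∂(surf d) =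
      ∫ τ in (0 : ℝ)..t, ∫ ξ, Ψ (sphMap (rot hij (-τ)) ξ) • g ξ ∂(surf d)

/-- For fixed t both sides of the identity are continuous in `v` and `g` for the L^1 norm, uniformly
over the admissible Ψ. -/
theorem FlowDeriv.of_approx {v g : Sph d → E} (hv : Integrable v (surf d))
    (hg : Integrable g (surf d))
    (h : ∀ ε > 0, ∃ v' g' : Sph d → E, Integrable v' (surf d) ∧ Integrable g' (surf d) ∧
      FlowDeriv hij v' g' ∧ ∫ ξ, ‖v ξ - v' ξ‖ ∂(surf d) ≤ ε ∧ ∫ ξ, ‖g ξ - g' ξ‖ ∂(surf d) ≤ ε) :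
    FlowDeriv hij v g := by
  intro Ψ hΨ hC t
  rw [← sub_eq_zero, ← norm_le_zero_iff]
  refine le_of_forall_pos_le_add fun ε hε => ?_
  -- The error in `v` enters twice, and the error in `g` is integrated over an interval of length
  -- |t|.
  obtain ⟨v', g', hv', hg', hf, h1, h2⟩ := h (ε / (2 + |t|)) (by positivity)
  have e := hf Ψ hΨ hC t
  have b1 := norm_integral_bdd_smul_sub_le (measurable_comp_rot hij hΨ (-t)) (fun _ => hC _) hv hv'
  have b2 := norm_integral_bdd_smul_sub_le hΨ hC hv hv'
  have b3 : ‖(∫ τ in (0 : ℝ)..t, ∫ ξ, Ψ (sphMap (rot hij (-τ)) ξ) • g ξ ∂(surf d)) -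
      ∫ τ in (0 : ℝ)..t, ∫ ξ, Ψ (sphMap (rot hij (-τ)) ξ) • g' ξ ∂(surf d)‖ ≤
      (1 * ∫ ξ, ‖g ξ - g' ξ‖ ∂(surf d)) * |t - 0| := by
    rw [← intervalIntegral.integral_sub
      ((continuous_integral_rot hij hΨ hC hg).intervalIntegrable _ _)
      ((continuous_integral_rot hij hΨ hC hg').intervalIntegrable _ _)]
    refine intervalIntegral.norm_integral_le_of_norm_le_const fun τ _ => ?_
    exact norm_integral_bdd_smul_sub_le (measurable_comp_rot hij hΨ (-τ)) (fun _ => hC _) hg hg'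
  rw [sub_zero, one_mul] at b3
  rw [one_mul] at b1 b2
  have : (∫ ξ, Ψ (sphMap (rot hij (-t)) ξ) • v ξ ∂(surf d) - ∫ ξ, Ψ ξ • v ξ ∂(surf d) -
      ∫ τ in (0 : ℝ)..t, ∫ ξ, Ψ (sphMap (rot hij (-τ)) ξ) • g ξ ∂(surf d)) =
      (∫ ξ, Ψ (sphMap (rot hij (-t)) ξ) • v ξ ∂(surf d) -
        ∫ ξ, Ψ (sphMap (rot hij (-t)) ξ) • v' ξ ∂(surf d)) -
      (∫ ξ, Ψ ξ • v ξ ∂(surf d) - ∫ ξ, Ψ ξ • v' ξ ∂(surf d)) -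
      ((∫ τ in (0 : ℝ)..t, ∫ ξ, Ψ (sphMap (rot hij (-τ)) ξ) • g ξ ∂(surf d)) -
      ∫ τ in (0 : ℝ)..t, ∫ ξ, Ψ (sphMap (rot hij (-τ)) ξ) • g' ξ ∂(surf d)) := by
    rw [← e]; abel
  rw [this, zero_add]
  refine (norm_sub_le _ _).trans ((add_le_add (norm_sub_le _ _) le_rfl).trans ?_)
  calc _ ≤ ε / (2 + |t|) + ε / (2 + |t|) + ε / (2 + |t|) * |t| := by
        refine add_le_add (add_le_add (b1.trans h1) (b2.trans h1)) (b3.trans ?_)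
        gcongr
    _ = ε := by field_simp; ring

theorem hasDerivAt_coord_rot (k : Fin (d + 1)) (t : ℝ) (x : Ambient d) :
    HasDerivAt (fun s => (rot hij s x) k) ((rot hij t x) i *
      (EuclideanSpace.single k 1 : Ambient d) j -
      (rot hij t x) j * (EuclideanSpace.single k 1 : Ambient d) i) t := by
  have h := (hasDerivAt_rot hij t x)
  have h2 := ((EuclideanSpace.proj k : Ambient d →L[ℝ] ℝ).hasFDerivAt.comp_hasDerivAt t h)
  refine h2.congr_deriv ?_
  simp [EuclideanSpace.single, eq_comm]

/-- The fundamental theorem of calculus along each orbit, followed by Fubini. -/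
theorem flowDeriv_of_hasDerivAt [CompleteSpace E] {v g : Sph d → E} (hvc : Continuous v)
    (hgc : Continuous g) (h : ∀ ξ τ, HasDerivAt (fun s => v (sphMap (rot hij s) ξ))
      (g (sphMap (rot hij τ) ξ)) τ) : FlowDeriv hij v g := by
  intro Ψ hΨ hC t
  have hftc : ∀ ξ, v (sphMap (rot hij t) ξ) - v ξ = ∫ τ in (0 : ℝ)..t, g (sphMap (rot hij τ) ξ) := by
    intro ξ
    have hc : Continuous (g ∘ fun τ => sphMap (rot hij τ) ξ) :=
      Continuous.comp hgc (continuous_orbit hij ξ)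
    rw [intervalIntegral.integral_eq_sub_of_hasDerivAt (fun τ _ => h ξ τ)
      (hc.intervalIntegrable _ _), sphMap_rot_zero]
  obtain ⟨B, hB⟩ := isCompact_univ.exists_bound_of_continuousOn hvc.continuousOn
  obtain ⟨B', hB'⟩ := isCompact_univ.exists_bound_of_continuousOn hgc.continuousOn
  have hiv : Integrable v (surf d) := Integrable.of_bound hvc.aestronglyMeasurable B
    (Eventually.of_forall fun ξ => hB ξ (mem_univ _))
  have hiv' : Integrable (fun ξ => v (sphMap (rot hij t) ξ)) (surf d) :=
    Integrable.of_bound (hvc.comp (continuous_sphMap _)).aestronglyMeasurable B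
    (Eventually.of_forall fun ξ => hB _ (mem_univ _))
  simp only [integral_rot_comp]
  rw [← integral_sub (integrable_bdd_smul hΨ hC hiv') (integrable_bdd_smul hΨ hC hiv)]
  simp only [← smul_sub, hftc, ← intervalIntegral.integral_smul]
  symm
  have : IsFiniteMeasure (volume.restrict (uIoc 0 t)) := ⟨by simp [uIoc]⟩
  refine MeasureTheory.intervalIntegral_integral_swap
    (f := fun τ ξ => Ψ ξ • g (sphMap (rot hij τ) ξ)) ?_
  refine Integrable.of_bound ?_ B' (Eventually.of_forall fun p => ?_)
  · exact (hΨ.comp measurable_snd).aestronglyMeasurable.smul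
      (Continuous.comp hgc (continuous_sphMap_rot hij)).aestronglyMeasurable
  · simp only [Function.uncurry, norm_smul, Real.norm_eq_abs]
    have h1 := hC p.2
    have h2 := hB' (sphMap (rot hij p.1) p.2) (mem_univ _)
    have h3 := norm_nonneg (g (sphMap (rot hij p.1) p.2))
    have h4 := abs_nonneg (Ψ p.2)
    nlinarith

theorem flowDeriv_comp_coord [CompleteSpace E] {V q : ℝ → E} (hq : Continuous q)
    (hV : ∀ s, HasDerivAt V (q s) s) :
    FlowDeriv hij (fun ξ : Sph d => V ((ξ : Ambient d) 0))
      (fun ξ => ((ξ : Ambient d) i * (EuclideanSpace.single 0 1 : Ambient d) j -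
        (ξ : Ambient d) j * (EuclideanSpace.single 0 1 : Ambient d) i) • q ((ξ : Ambient d) 0)) := by
  have hVc : Continuous V := continuous_iff_continuousAt.2 fun s => (hV s).continuousAt
  refine flowDeriv_of_hasDerivAt hij (by fun_prop) (by fun_prop) fun ξ τ => ?_
  have h1 := hasDerivAt_coord_rot hij 0 τ (ξ : Ambient d)
  exact (hV ((rot hij τ (ξ : Ambient d)) 0)).scomp τ h1

end Flow

section Profile

variable {E : Type*} [NormedAddCommGroup E] [NormedSpace ℝ E]

/-- `F` is locally absolutely continuous on `(0, π)` with derivative `w`, and `w ∘ colat` is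
integrable on the sphere. -/
structure Profile (d : ℕ) (F w : ℝ → E) : Prop where
  meas : StronglyMeasurable w
  integrable : Integrable (fun ξ : Sph d => w (colat ξ)) (surf d)
  sub_eq : ∀ a ∈ Ioo 0 Real.pi, ∀ b ∈ Ioo 0 Real.pi, F b - F a = ∫ x in a..b, w x

theorem sin_ge_of_mem_uIcc {a b x : ℝ} (ha : a ∈ Ioo 0 Real.pi) (hb : b ∈ Ioo 0 Real.pi)
    (hx : x ∈ uIcc a b) : min (Real.sin a) (Real.sin b) ≤ Real.sin x := by
  have h : ConcaveOn ℝ (Icc 0 Real.pi) Real.sin := strictConcaveOn_sin_Icc.concaveOn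
  exact h.min_le_of_mem_segment (Ioo_subset_Icc_self ha) (Ioo_subset_Icc_self hb)
    (by rwa [segment_eq_uIcc])

theorem mem_Ioo_of_mem_uIcc {a b x c e : ℝ} (ha : a ∈ Ioo c e) (hb : b ∈ Ioo c e)
    (hx : x ∈ uIcc a b) : x ∈ Ioo c e :=
  (ordConnected_Ioo.uIcc_subset ha hb) hx

variable [NeZero d]

theorem Profile.integrableOn {F w : ℝ → E} (h : Profile d F w) :
    IntegrableOn (fun τ => Real.sin τ ^ (d - 1) • w τ) (Ioo 0 Real.pi) :=
  (integrable_colat_iff h.meas).1 h.integrable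

/-- The weight sin^(d-1) is bounded below between two points of (0, π), by concavity of the sine. -/
theorem intervalIntegrable_of_integrable_colat {w : ℝ → E} (hw : StronglyMeasurable w)
    (hi : Integrable (fun ξ : Sph d => w (colat ξ)) (surf d)) {a b : ℝ}
    (ha : a ∈ Ioo 0 Real.pi) (hb : b ∈ Ioo 0 Real.pi) : IntervalIntegrable w volume a b := by
  rw [intervalIntegrable_iff']
  have hm : 0 < min (Real.sin a) (Real.sin b) :=
    lt_min (Real.sin_pos_of_mem_Ioo ha) (Real.sin_pos_of_mem_Ioo hb)
  have h1 : IntegrableOn (fun τ => Real.sin τ ^ (d - 1) • w τ) (uIcc a b) :=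
    ((integrable_colat_iff hw).1 hi).mono_set fun x hx => mem_Ioo_of_mem_uIcc ha hb hx
  refine (h1.norm.const_mul ((min (Real.sin a) (Real.sin b) ^ (d - 1))⁻¹)).mono'
    hw.aestronglyMeasurable ?_
  rw [ae_restrict_iff' measurableSet_uIcc]
  refine Eventually.of_forall fun x hx => ?_
  have hs := sin_ge_of_mem_uIcc ha hb hx
  rw [norm_smul, ← mul_assoc, norm_pow, Real.norm_of_nonneg (hm.le.trans hs)]
  refine le_mul_of_one_le_left (norm_nonneg _) ?_
  rw [← div_eq_inv_mul, one_le_div (by positivity)]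
  gcongr

theorem Profile.intervalIntegrable {F w : ℝ → E} (h : Profile d F w) {a b : ℝ}
    (ha : a ∈ Ioo 0 Real.pi) (hb : b ∈ Ioo 0 Real.pi) : IntervalIntegrable w volume a b :=
  intervalIntegrable_of_integrable_colat h.meas h.integrable ha hb

theorem profile_primitive {w : ℝ → E} (hw : StronglyMeasurable w)
    (hi : Integrable (fun ξ : Sph d => w (colat ξ)) (surf d)) :
    Profile d (fun θ => ∫ x in (Real.pi / 2)..θ, w x) w where
  meas := hw
  integrable := hi
  sub_eq a ha b hb := by
    have hc : Real.pi / 2 ∈ Ioo 0 Real.pi := ⟨by positivity, by linarith [Real.pi_pos]⟩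
    exact intervalIntegral.integral_interval_sub_left
      (intervalIntegrable_of_integrable_colat hw hi hc hb)
      (intervalIntegrable_of_integrable_colat hw hi hc ha)

theorem Profile.continuousOn [CompleteSpace E] {F w : ℝ → E} (h : Profile d F w) :
    ContinuousOn F (Ioo 0 Real.pi) := by
  intro θ hθ
  obtain ⟨a, ha1, ha2⟩ := exists_between hθ.1
  obtain ⟨b, hb1, hb2⟩ := exists_between hθ.2
  have ha : a ∈ Ioo 0 Real.pi := ⟨ha1, ha2.trans hθ.2⟩
  have hb : b ∈ Ioo 0 Real.pi := ⟨hθ.1.trans hb1, hb2⟩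
  have h1 : ContinuousOn (fun x => F a + ∫ t in a..x, w t) (uIcc a b) :=
    continuousOn_const.add (intervalIntegral.continuousOn_primitive_interval
      ((intervalIntegrable_iff' (by simp)).1 (h.intervalIntegrable ha hb)))
  have h2 : ContinuousOn F (uIcc a b) := by
    refine h1.congr fun x hx => ?_
    simp only [← h.sub_eq a ha x (mem_Ioo_of_mem_uIcc ha hb hx)]; abel
  rw [uIcc_of_le (ha2.trans hb1).le] at h2
  exact (h2.continuousAt (Icc_mem_nhds ha2 hb1)).continuousWithinAt

theorem Profile.aestronglyMeasurable [CompleteSpace E] {F w : ℝ → E} (h : Profile d F w) :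
    AEStronglyMeasurable (fun ξ : Sph d => F (colat ξ)) (surf d) := by
  have h1 : AEStronglyMeasurable F (volume.restrict (Ioo 0 Real.pi)) :=
    h.continuousOn.aestronglyMeasurable measurableSet_Ioo
  refine AEStronglyMeasurable.comp_measurable ?_ measurable_colat
  rw [map_colat]
  exact h1.mono_ac (withDensity_absolutelyContinuous _ _)

/-- The total mass of `w ∘ colat` controls the growth of `F` at the poles. -/
theorem Profile.norm_sub_mul_le [CompleteSpace E] {F w : ℝ → E} (h : Profile d F w) {θ : ℝ}
    (hθ : θ ∈ Ioo 0 Real.pi) : latConst d * (‖F θ - F (Real.pi / 2)‖ * Real.sin θ ^ (d - 1)) ≤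
      ∫ ξ : Sph d, ‖w (colat ξ)‖ ∂(surf d) := by
  have hp : Real.pi / 2 ∈ Ioo 0 Real.pi := ⟨by positivity, by linarith [Real.pi_pos]⟩
  rw [integral_colat h.meas.norm]
  have hc := latConst_pos (d := d)
  have hs := Real.sin_pos_of_mem_Ioo hθ
  rw [h.sub_eq _ hp _ hθ]
  have e1 : ∫ τ in Ioo 0 Real.pi, (latConst d * Real.sin τ ^ (d - 1)) • ‖w τ‖ =
      latConst d * ∫ τ in Ioo 0 Real.pi, ‖Real.sin τ ^ (d - 1) • w τ‖ := by
    rw [← integral_const_mul]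
    refine setIntegral_congr_fun measurableSet_Ioo fun τ hτ => ?_
    have := Real.sin_pos_of_mem_Ioo hτ
    simp only [norm_smul, smul_eq_mul, norm_pow, Real.norm_of_nonneg this.le]
    ring
  rw [e1]
  gcongr
  calc ‖∫ x in (Real.pi / 2)..θ, w x‖ * Real.sin θ ^ (d - 1)
      = ‖∫ x in (Real.pi / 2)..θ, Real.sin θ ^ (d - 1) • w x‖ := by
        rw [intervalIntegral.integral_smul, norm_smul, norm_pow, Real.norm_of_nonneg hs.le, mul_comm]
    _ ≤ ∫ x in uIoc (Real.pi / 2) θ, ‖Real.sin θ ^ (d - 1) • w x‖ :=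
        intervalIntegral.norm_integral_le_integral_norm_uIoc
    -- Between π/2 and θ the sine is at least sin θ, so the weight frozen at θ may be replaced by
    -- the weight at x.
    _ ≤ ∫ x in uIoc (Real.pi / 2) θ, ‖Real.sin x ^ (d - 1) • w x‖ := by
        have hsub : uIoc (Real.pi / 2) θ ⊆ Ioo 0 Real.pi := fun x hx =>
          mem_Ioo_of_mem_uIcc hp hθ (uIoc_subset_uIcc hx)
        refine setIntegral_mono_on ?_ (h.integrableOn.mono_set hsub).norm measurableSet_uIoc ?_
        · exact ((intervalIntegrable_iff.1 (h.intervalIntegrable hp hθ)).smul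
            (Real.sin θ ^ (d - 1))).norm
        · intro x hx
          have h2 := sin_ge_of_mem_uIcc hp hθ (uIoc_subset_uIcc hx)
          rw [Real.sin_pi_div_two, min_eq_right (Real.sin_le_one _)] at h2
          rw [norm_smul, norm_smul, norm_pow, norm_pow, Real.norm_of_nonneg hs.le,
            Real.norm_of_nonneg (hs.le.trans h2)]
          gcongr
    _ ≤ ∫ τ in Ioo 0 Real.pi, ‖Real.sin τ ^ (d - 1) • w τ‖ := by
        refine setIntegral_mono_set h.integrableOn.norm
          (Eventually.of_forall fun _ => norm_nonneg _) (LE.le.eventuallyLE ?_)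
        exact fun x hx => mem_Ioo_of_mem_uIcc hp hθ (uIoc_subset_uIcc hx)

/-- Against the density sin^(d-1) this becomes a constant on (0, π). It majorizes the possible
growth of a profile at the poles, so every profile is integrable on the sphere. -/
theorem integrable_sin_inv : Integrable
    (fun ξ : Sph d => (Real.sin (colat ξ) ^ (d - 1))⁻¹) (surf d) := by
  rw [integrable_colat_iff (g := fun τ => (Real.sin τ ^ (d - 1))⁻¹)
    (by fun_prop : Measurable _).stronglyMeasurable]
  have : EqOn (fun _ => (1 : ℝ)) (fun τ => Real.sin τ ^ (d - 1) • (Real.sin τ ^ (d - 1))⁻¹)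
      (Ioo 0 Real.pi) := by
    intro τ hτ
    have := (Real.sin_pos_of_mem_Ioo hτ).ne'
    simp [this]
  rw [← integrableOn_congr_fun this measurableSet_Ioo]
  simp

theorem integral_sin_inv : ∫ ξ : Sph d, (Real.sin (colat ξ) ^ (d - 1))⁻¹ ∂(surf d) =
    latConst d * Real.pi := by
  rw [integral_colat (g := fun τ => (Real.sin τ ^ (d - 1))⁻¹)
    (by fun_prop : Measurable _).stronglyMeasurable]
  have : EqOn (fun τ => (latConst d * Real.sin τ ^ (d - 1)) • (Real.sin τ ^ (d - 1))⁻¹)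
      (fun _ => latConst d) (Ioo 0 Real.pi) := by
    intro τ hτ
    have := (Real.sin_pos_of_mem_Ioo hτ).ne'
    simp [this]
  rw [setIntegral_congr_fun measurableSet_Ioo this]
  simp [Real.pi_pos.le, mul_comm]

theorem ae_colat_mem : ∀ᵐ ξ ∂(surf d), colat ξ ∈ Ioo 0 Real.pi :=
  (ae_colat_of_ae (p := fun _ => True) (by simp)).mono fun _ h => h.1

theorem Profile.norm_sub_le [CompleteSpace E] {F w : ℝ → E} (h : Profile d F w) {θ : ℝ}
    (hθ : θ ∈ Ioo 0 Real.pi) : ‖F θ - F (Real.pi / 2)‖ ≤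
      (∫ ξ : Sph d, ‖w (colat ξ)‖ ∂(surf d)) / latConst d * (Real.sin θ ^ (d - 1))⁻¹ := by
  have hc := latConst_pos (d := d)
  have hs := Real.sin_pos_of_mem_Ioo hθ
  have := h.norm_sub_mul_le hθ
  rw [← div_eq_mul_inv, le_div_iff₀ (by positivity), le_div_iff₀ hc]
  linarith

theorem Profile.integrable_sub [CompleteSpace E] {F w : ℝ → E} (h : Profile d F w) :
    Integrable (fun ξ : Sph d => F (colat ξ) - F (Real.pi / 2)) (surf d) := by
  refine (integrable_sin_inv.const_mul
    ((∫ ξ : Sph d, ‖w (colat ξ)‖ ∂(surf d)) / latConst d)).mono' (h.aestronglyMeasurable.sub aestronglyMeasurable_const) ?_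
  filter_upwards [ae_colat_mem] with ξ hξ using h.norm_sub_le hξ

theorem Profile.integrable_comp [CompleteSpace E] {F w : ℝ → E} (h : Profile d F w) :
    Integrable (fun ξ : Sph d => F (colat ξ)) (surf d) := by
  have := h.integrable_sub.add (integrable_const (F (Real.pi / 2)))
  refine this.congr (Eventually.of_forall fun ξ => ?_)
  simp

theorem Profile.integral_norm_sub_le [CompleteSpace E] {F w : ℝ → E} (h : Profile d F w) :
    ∫ ξ : Sph d, ‖F (colat ξ) - F (Real.pi / 2)‖ ∂(surf d) ≤
      Real.pi * ∫ ξ : Sph d, ‖w (colat ξ)‖ ∂(surf d) := by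
  have hc := latConst_pos (d := d)
  calc _ ≤ ∫ ξ : Sph d, (∫ ξ : Sph d, ‖w (colat ξ)‖ ∂(surf d)) / latConst d *
        (Real.sin (colat ξ) ^ (d - 1))⁻¹ ∂(surf d) := by
        refine integral_mono_ae h.integrable_sub.norm (integrable_sin_inv.const_mul _) ?_
        filter_upwards [ae_colat_mem] with ξ hξ using h.norm_sub_le hξ
    _ = _ := by
        rw [integral_const_mul, integral_sin_inv]
        field_simp

theorem Profile.sub {F w F' w' : ℝ → E} (h : Profile d F w) (h' : Profile d F' w') :
    Profile d (F - F') (w - w') where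
  meas := h.meas.sub h'.meas
  integrable := h.integrable.sub h'.integrable
  sub_eq a ha b hb := by
    simp only [Pi.sub_apply]
    rw [intervalIntegral.integral_sub (h.intervalIntegrable ha hb) (h'.intervalIntegrable ha hb),
      ← h.sub_eq a ha b hb, ← h'.sub_eq a ha b hb]
    abel

end Profile

end PolarSphere

end

/-! ### Weak gradients of profiles on the whole sphere. -/

noncomputable section

namespace PolarSphere

variable {d : ℕ}

theorem angularDeriv_self (i : Fin (d + 1)) (φ : Ambient d → ℝ) (ξ : Sph d) :
    angularDeriv i i φ ξ = 0 := by
  simp [angularDeriv]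

theorem continuous_angularDeriv (i j : Fin (d + 1)) {φ : Ambient d → ℝ} (hφ : ContDiff ℝ ∞ φ) :
    Continuous (angularDeriv i j φ) := by
  unfold angularDeriv
  have h1 : Continuous (fderiv ℝ φ) := hφ.continuous_fderiv (by simp)
  have h2 : Continuous fun ξ : Sph d => fderiv ℝ φ (ξ : Ambient d) :=
    h1.comp continuous_subtype_val
  exact h2.clm_apply (by fun_prop)

section

variable {E : Type*} [NormedAddCommGroup E] [NormedSpace ℝ E]

theorem FlowDeriv.of_bound {i j : Fin (d + 1)} {hij : i ≠ j} {v g : Sph d → E}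
    (h : FlowDeriv hij v g) {Ψ : Sph d → ℝ} (hΨ : Measurable Ψ) {C : ℝ} (hC : ∀ ξ, |Ψ ξ| ≤ C)
    (t : ℝ) : ∫ ξ, Ψ (sphMap (rot hij (-t)) ξ) • v ξ ∂(surf d) - ∫ ξ, Ψ ξ • v ξ ∂(surf d) =
      ∫ τ in (0 : ℝ)..t, ∫ ξ, Ψ (sphMap (rot hij (-τ)) ξ) • g ξ ∂(surf d) := by
  have hC0 : 0 ≤ C := (abs_nonneg _).trans (hC (northPole d))
  have hC1 : C + 1 ≠ 0 := by positivity
  have := h (fun ξ => (C + 1)⁻¹ * Ψ ξ) (hΨ.const_mul _) (fun ξ => by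
    rw [abs_mul, abs_of_pos (by positivity), inv_mul_le_one₀ (by positivity)]
    linarith [hC ξ]) t
  simp only [mul_smul, integral_smul, intervalIntegral.integral_smul, ← smul_sub] at this
  exact smul_right_injective E (inv_ne_zero hC1) this

/-- If w vanishes near the poles, the function is V(ξ₀) with V of class C^1, so the smooth case of
the flow identity applies and the poles play no role. -/
theorem profile_of_continuous [CompleteSpace E] {w : ℝ → E} (hw : Continuous w) {m : ℕ}
    (hm : 0 < m) (h0 : ∀ τ, m * Real.sin τ ≤ 1 → w τ = 0)
    (hi : Integrable (fun ξ : Sph d => w (colat ξ)) (surf d)) (c : E) :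
    ∃ F : ℝ → E, F (Real.pi / 2) = c ∧ Profile d F w ∧ ∀ i j : Fin (d + 1), ∀ hij : i ≠ j,
      FlowDeriv hij (fun ξ : Sph d => F (colat ξ)) fun ξ => angColat i j ξ • w (colat ξ) := by
  have hm' : (0 : ℝ) < m := by exact_mod_cast hm
  have hmax : ∀ t : ℝ, 0 < max √(1 - t ^ 2) (1 / m) := fun t => lt_max_of_lt_right (by positivity)
  -- This is the derivative of V, namely -w / sin in the variable t = cos θ. The lower bound 1/m for
  -- the denominator keeps it continuous at t = ±1, and changes nothing because w vanishes where sin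
  -- ≤ 1/m.
  set q : ℝ → E := fun t => -((max √(1 - t ^ 2) (1 / m))⁻¹ • w (Real.arccos t)) with hq
  have hqc : Continuous q := by
    have : Continuous fun t : ℝ => (max √(1 - t ^ 2) (1 / m))⁻¹ :=
      Continuous.inv₀ (by fun_prop) fun t => (hmax t).ne'
    exact (this.smul (hw.comp Real.continuous_arccos)).neg
  have hqw : ∀ x ∈ Icc 0 Real.pi, (-Real.sin x) • q (Real.cos x) = w x := by
    intro x hx
    have hs : 0 ≤ Real.sin x := Real.sin_nonneg_of_mem_Icc hx
    simp only [hq]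
    rw [Real.arccos_cos hx.1 hx.2, ← Real.sin_sq, Real.sqrt_sq hs, neg_smul_neg, smul_smul]
    rcases le_or_gt (m * Real.sin x) 1 with h | h
    · rw [h0 x h, smul_zero]
    · have h1 : 1 / (m : ℝ) < Real.sin x := by rw [div_lt_iff₀ hm']; linarith
      rw [max_eq_left h1.le, mul_inv_cancel₀, one_smul]
      have : 0 < 1 / (m : ℝ) := by positivity
      linarith
  refine ⟨fun θ => c + ∫ t in (0 : ℝ)..Real.cos θ, q t, by simp, ?_, ?_⟩
  · refine ⟨hw.stronglyMeasurable, hi, fun a ha b hb => ?_⟩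
    have h1 : (∫ t in (0 : ℝ)..Real.cos b, q t) - ∫ t in (0 : ℝ)..Real.cos a, q t =
        ∫ t in Real.cos a..Real.cos b, q t :=
      intervalIntegral.integral_interval_sub_left (hqc.intervalIntegrable _ _)
        (hqc.intervalIntegrable _ _)
    rw [add_sub_add_left_eq_sub, h1,
      ← intervalIntegral.integral_deriv_smul_comp (f := Real.cos) (f' := fun x => -Real.sin x)
        (fun x _ => Real.hasDerivAt_cos x) (by fun_prop) hqc]
    refine intervalIntegral.integral_congr fun x hx => ?_
    exact hqw x (Ioo_subset_Icc_self (mem_Ioo_of_mem_uIcc ha hb hx))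
  · intro i j hij
    have hV : ∀ s, HasDerivAt (fun s => c + ∫ t in (0 : ℝ)..s, q t) (q s) s := fun s =>
      (hqc.integral_hasStrictDerivAt 0 s).hasDerivAt.const_add c
    have := flowDeriv_comp_coord hij hqc hV
    convert this using 1
    · ext ξ
      simp only [cos_colat]
    · ext ξ
      rw [← hqw (colat ξ) ⟨colat_nonneg _, colat_le_pi _⟩, cos_colat, smul_smul, angColat_eq]
      rcases (sin_colat_nonneg ξ).eq_or_lt with h | h
      · have : q ((ξ : Ambient d) 0) = 0 := by
          simp only [hq]
          rw [← colat_eq_arccos, h0 _ (by rw [← h]; simp)]; simp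
        simp [this]
      · congr 1
        field_simp

variable [NeZero d]

/-- A cutoff function vanishing near the poles. -/
def poleCutoff (m : ℕ) (τ : ℝ) : ℝ := min 1 (max 0 (m * Real.sin τ - 1))

theorem continuous_poleCutoff (m : ℕ) : Continuous (poleCutoff m) := by
  unfold poleCutoff; fun_prop

theorem poleCutoff_nonneg (m : ℕ) (τ : ℝ) : 0 ≤ poleCutoff m τ :=
  le_min zero_le_one (le_max_left _ _)

theorem poleCutoff_le_one (m : ℕ) (τ : ℝ) : poleCutoff m τ ≤ 1 := min_le_left _ _

theorem poleCutoff_eq_zero {m : ℕ} {τ : ℝ} (h : m * Real.sin τ ≤ 1) : poleCutoff m τ = 0 := by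
  unfold poleCutoff
  rw [max_eq_left (by linarith)]
  simp

theorem tendsto_poleCutoff {τ : ℝ} (h : 0 < Real.sin τ) :
    Tendsto (fun m : ℕ => poleCutoff m τ) atTop (𝓝 1) := by
  refine tendsto_const_nhds.congr' ?_
  obtain ⟨n, hn⟩ := exists_nat_ge (2 / Real.sin τ)
  filter_upwards [eventually_ge_atTop n] with m hm
  have : (n : ℝ) ≤ m := by exact_mod_cast hm
  have h2 : 2 ≤ m * Real.sin τ := by
    rw [div_le_iff₀ h] at hn
    nlinarith
  unfold poleCutoff
  rw [max_eq_right (by linarith), min_eq_left (by linarith)]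

/-- Continuous functions are dense in L^1 of the law of the colatitude; the cutoffs at the poles
tend to 1 almost everywhere, so they cost nothing in the limit. -/
theorem exists_continuous_approx {w : ℝ → E} (hw : StronglyMeasurable w)
    (hi : Integrable (fun ξ : Sph d => w (colat ξ)) (surf d)) {ε : ℝ} (hε : 0 < ε) :
    ∃ (w' : ℝ → E) (m : ℕ), 0 < m ∧ Continuous w' ∧
      Integrable (fun ξ : Sph d => w' (colat ξ)) (surf d) ∧
      (∀ τ, m * Real.sin τ ≤ 1 → w' τ = 0) ∧
      ∫ ξ : Sph d, ‖w (colat ξ) - w' (colat ξ)‖ ∂(surf d) ≤ ε := by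
  have hi' : Integrable w ((surf d).map colat) :=
    (integrable_map_measure hw.aestronglyMeasurable measurable_colat.aemeasurable).2 hi
  obtain ⟨w1, h1, h2, h3, h4⟩ := hi'.exists_hasCompactSupport_integral_sub_le (half_pos hε)
  rw [integral_map measurable_colat.aemeasurable (by
    exact (hw.aestronglyMeasurable.sub h3.aestronglyMeasurable).norm)] at h2
  have h4' : Integrable (fun ξ : Sph d => w1 (colat ξ)) (surf d) :=
    (integrable_map_measure h3.aestronglyMeasurable measurable_colat.aemeasurable).1 h4
  have hmeas : ∀ m, AEStronglyMeasurable
      (fun ξ : Sph d => poleCutoff m (colat ξ) • w1 (colat ξ)) (surf d) := fun m =>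
    ((continuous_poleCutoff m).smul h3).stronglyMeasurable.comp_measurable measurable_colat
      |>.aestronglyMeasurable
  have hint : ∀ m, Integrable (fun ξ : Sph d => poleCutoff m (colat ξ) • w1 (colat ξ))
      (surf d) := by
    refine fun m => h4'.mono (hmeas m) (Eventually.of_forall fun ξ => ?_)
    rw [norm_smul, Real.norm_of_nonneg (poleCutoff_nonneg _ _)]
    exact mul_le_of_le_one_left (norm_nonneg _) (poleCutoff_le_one _ _)
  have hlim : Tendsto (fun m : ℕ => ∫ ξ : Sph d, ‖w1 (colat ξ) -
      poleCutoff m (colat ξ) • w1 (colat ξ)‖ ∂(surf d)) atTop (𝓝 (∫ _ξ : Sph d, 0 ∂(surf d))) := by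
    refine tendsto_integral_of_dominated_convergence (fun ξ => ‖w1 (colat ξ)‖)
      (fun m => (h4'.aestronglyMeasurable.sub (hmeas m)).norm) h4'.norm ?_ ?_
    · refine fun m => Eventually.of_forall fun ξ => ?_
      rw [norm_norm]
      nth_rw 1 [← one_smul ℝ (w1 (colat ξ))]
      rw [← sub_smul, norm_smul]
      refine mul_le_of_le_one_left (norm_nonneg _) ?_
      have := poleCutoff_nonneg m (colat ξ)
      have := poleCutoff_le_one m (colat ξ)
      rw [Real.norm_of_nonneg] <;> linarith
    · filter_upwards [ae_colat_mem] with ξ hξ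
      have := ((tendsto_poleCutoff (Real.sin_pos_of_mem_Ioo hξ)).smul_const
        (w1 (colat ξ))).const_sub (w1 (colat ξ))
      simpa using this.norm
  rw [integral_zero] at hlim
  obtain ⟨m, hm, hm0⟩ := ((hlim.eventually_lt_const (half_pos hε)).and
    (eventually_gt_atTop 0)).exists
  refine ⟨fun τ => poleCutoff m τ • w1 τ, m, hm0, (continuous_poleCutoff m).smul h3, hint m,
    fun τ hτ => by simp [poleCutoff_eq_zero hτ], ?_⟩
  calc _ ≤ ∫ ξ : Sph d, (‖w (colat ξ) - w1 (colat ξ)‖ + ‖w1 (colat ξ) -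
        poleCutoff m (colat ξ) • w1 (colat ξ)‖) ∂(surf d) := by
        refine integral_mono (hi.sub (hint m)).norm
          ((hi.sub h4').norm.add (h4'.sub (hint m)).norm) fun ξ => ?_
        exact norm_sub_le_norm_sub_add_norm_sub _ _ _
    _ ≤ ε := by
        have e := integral_add (hi.sub h4').norm (h4'.sub (hint m)).norm
        simp only [Pi.sub_apply] at e
        rw [e]
        linarith

/-- The identity passes to the L^1 limit from profiles that are constant near the poles. Fixing the
value at π/2 makes convergence of the derivatives imply convergence of the functions. -/
theorem Profile.flowDeriv [CompleteSpace E] {F w : ℝ → E} (h : Profile d F w)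
    {i j : Fin (d + 1)} (hij : i ≠ j) :
    FlowDeriv hij (fun ξ : Sph d => F (colat ξ)) fun ξ => angColat i j ξ • w (colat ξ) := by
  have hb : ∀ ξ : Sph d, |angColat i j ξ| ≤ 1 := abs_angColat_le hij
  refine FlowDeriv.of_approx hij h.integrable_comp
    (integrable_bdd_smul (measurable_angColat i j) hb h.integrable) fun ε hε => ?_
  -- Passing from derivatives to functions costs a factor π, which is at most 4.
  obtain ⟨w', m, hm, hw', hi, h0, hle⟩ := exists_continuous_approx h.meas h.integrable
    (show 0 < ε / 4 by positivity)
  obtain ⟨F', hF', hP, hfl⟩ := profile_of_continuous hw' hm h0 hi (F (Real.pi / 2))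
  refine ⟨fun ξ => F' (colat ξ), fun ξ => angColat i j ξ • w' (colat ξ), hP.integrable_comp,
    integrable_bdd_smul (measurable_angColat i j) hb hi, hfl i j hij, ?_, ?_⟩
  · have := (h.sub hP).integral_norm_sub_le
    simp only [Pi.sub_apply, hF', sub_self, sub_zero] at this
    have hpi := Real.pi_le_four
    have := Real.pi_pos
    nlinarith
  · calc _ ≤ ∫ ξ : Sph d, ‖w (colat ξ) - w' (colat ξ)‖ ∂(surf d) := by
          refine integral_mono ((integrable_bdd_smul (measurable_angColat i j) hb
            h.integrable).sub (integrable_bdd_smul (measurable_angColat i j) hb hi)).norm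
            (h.integrable.sub hi).norm fun ξ => ?_
          simp only [← smul_sub, norm_smul]
          exact mul_le_of_le_one_left (norm_nonneg _) (hb ξ)
      _ ≤ ε := by linarith

end

section WeakGradient

variable {𝕜 : Type*} [RCLike 𝕜]

/-- Take Ψ = φ in the flow identity and differentiate both sides at t = 0: the left side may be
differentiated under the integral, and the right side is a primitive of a continuous function. -/
theorem integral_angularDeriv_smul {i j : Fin (d + 1)} {hij : i ≠ j} {v g : Sph d → 𝕜}
    (h : FlowDeriv hij v g) (hv : Integrable v (surf d)) (hg : Integrable g (surf d))
    {φ : Ambient d → ℝ} (hφ : ContDiff ℝ ∞ φ) :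
    ∫ ξ, angularDeriv i j φ ξ • v ξ ∂(surf d) = - ∫ ξ, φ ξ • g ξ ∂(surf d) := by
  have hφc : Continuous fun ξ : Sph d => φ ξ := hφ.continuous.comp continuous_subtype_val
  have hac := continuous_angularDeriv i j hφ
  obtain ⟨B, hB⟩ := isCompact_univ.exists_bound_of_continuousOn hφc.continuousOn
  obtain ⟨B', hB'⟩ := isCompact_univ.exists_bound_of_continuousOn hac.continuousOn
  have hB1 : ∀ ξ : Sph d, |φ ξ| ≤ B := fun ξ => hB ξ (mem_univ _)
  have hid := fun t => h.of_bound hφc.measurable hB1 t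
  have hc := continuous_integral_rot hij hφc.measurable hB1 hg
  have d1 : HasDerivAt (fun t => ∫ τ in (0 : ℝ)..t,
      ∫ ξ : Sph d, φ (sphMap (rot hij (-τ)) ξ) • g ξ ∂(surf d))
      (∫ ξ : Sph d, φ (sphMap (rot hij (-0)) ξ) • g ξ ∂(surf d)) 0 :=
    (hc.integral_hasStrictDerivAt 0 0).hasDerivAt
  have hpt : ∀ (ξ : Sph d) (t : ℝ), HasDerivAt (fun t => φ (sphMap (rot hij (-t)) ξ) • v ξ)
      ((-angularDeriv i j φ (sphMap (rot hij (-t)) ξ)) • v ξ) t := by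
    intro ξ t
    have h1 := HasDerivAt.scomp (h := fun t : ℝ => -t) (h' := -1) t
      (hasDerivAt_rot hij (-t) (ξ : Ambient d)) (hasDerivAt_neg t)
    have h2 := ((hφ.differentiable (by simp)) (rot hij (-t) (ξ : Ambient d))).hasFDerivAt
    have h3 := h2.comp_hasDerivAt t h1
    have h4 : HasDerivAt (fun t => φ (sphMap (rot hij (-t)) ξ))
        (-angularDeriv i j φ (sphMap (rot hij (-t)) ξ)) t := by
      refine h3.congr_deriv ?_
      rw [neg_one_smul, map_neg]
      rfl
    exact h4.smul_const _
  have d2 : HasDerivAt (fun t => ∫ ξ : Sph d, φ (sphMap (rot hij (-t)) ξ) • v ξ ∂(surf d))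
      (∫ ξ : Sph d, (-angularDeriv i j φ (sphMap (rot hij (-0)) ξ)) • v ξ ∂(surf d)) 0 := by
    have m1 : ∀ t : ℝ, Integrable (fun ξ : Sph d => φ (sphMap (rot hij (-t)) ξ) • v ξ) (surf d) :=
      fun t => integrable_bdd_smul (measurable_comp_rot hij hφc.measurable _) (fun _ => hB1 _) hv
    have m2 : AEStronglyMeasurable
        (fun ξ : Sph d => (-angularDeriv i j φ (sphMap (rot hij (-0)) ξ)) • v ξ) (surf d) :=
      (hac.comp (continuous_sphMap _)).neg.aestronglyMeasurable.smul hv.aestronglyMeasurable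
    refine (hasDerivAt_integral_of_dominated_loc_of_deriv_le (𝕜 := ℝ) (s := univ)
      (F := fun t ξ => φ (sphMap (rot hij (-t)) ξ) • v ξ)
      (F' := fun t ξ => (-angularDeriv i j φ (sphMap (rot hij (-t)) ξ)) • v ξ)
      (bound := fun ξ => B' * ‖v ξ‖)
      univ_mem (Eventually.of_forall fun t => (m1 t).aestronglyMeasurable) (m1 0) m2 ?_
      (hv.norm.const_mul _) ?_).2
    · refine Eventually.of_forall fun ξ t _ => ?_
      rw [norm_smul, norm_neg]
      exact mul_le_mul_of_nonneg_right (hB' _ (mem_univ _)) (norm_nonneg _)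
    · exact Eventually.of_forall fun ξ t _ => hpt ξ t
  have d3 := (d2.sub_const (∫ ξ : Sph d, φ ξ • v ξ ∂(surf d))).unique
    (d1.congr_of_eventuallyEq (Eventually.of_forall hid))
  simp only [neg_zero, sphMap_rot_zero, neg_smul, integral_neg] at d3
  rw [← d3, neg_neg]

variable [NeZero d]

theorem Profile.integrable_radGrad {F w : ℝ → 𝕜} (h : Profile d F w) :
    Integrable (radGrad w : Sph d → EuclideanSpace 𝕜 (Fin (d + 1))) (surf d) := by
  refine h.integrable.mono ?_ ?_
  · have : Measurable fun ξ : Sph d => (fun i => tanCoord ξ i • w (colat ξ) : Fin (d + 1) → 𝕜) :=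
      measurable_pi_lambda _ fun i => (measurable_tanCoord i).smul
        (h.meas.measurable.comp measurable_colat)
    exact ((PiLp.continuous_toLp 2 _).measurable.comp this).aestronglyMeasurable
  · filter_upwards [ae_colat_mem] with ξ hξ
    rw [norm_radGrad w hξ]

/-- No condition at the poles is needed, since `Profile.flowDeriv` is an identity on the whole
sphere. -/
theorem Profile.isWeakGradientOn {F w : ℝ → 𝕜} (h : Profile d F w) :
    IsWeakGradientOn univ (fun ξ : Sph d => F (colat ξ)) (radGrad w) where
  locallyIntegrable_fun := h.integrable_comp.locallyIntegrable.locallyIntegrableOn _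
  locallyIntegrable_grad := h.integrable_radGrad.locallyIntegrable.locallyIntegrableOn _
  tangential := by
    refine Eventually.of_forall fun ξ _ => ?_
    simp only [radGrad, smul_smul]
    rw [← Finset.sum_smul, sum_coord_mul_tanCoord, zero_smul]
  integral_eq φ hφ _ i j := by
    rcases eq_or_ne i j with rfl | hij
    · simp [angularDeriv_self]
    · rw [integral_angularDeriv_smul (h.flowDeriv hij) h.integrable_comp
        (integrable_bdd_smul (measurable_angColat i j) (abs_angColat_le hij) h.integrable) hφ]
      simp only [radGrad, smul_smul, ← sub_smul, angColat]

end WeakGradient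

end PolarSphere

end

/-! ### Measurable profiles of polar functions, and uniqueness of weak gradients. -/

noncomputable section

namespace PolarSphere

variable {d : ℕ}

/-- Compact subsets exhaust the preimage up to a null set, and their images under the colatitude are
compact subsets of S. This descends measurability from the sphere to the interval. -/
theorem exists_measurableSet_colat_inner {S : Set ℝ}
    (hS : NullMeasurableSet ((colat : Sph d → ℝ) ⁻¹' S) (surf d)) :
    ∃ L ⊆ S, MeasurableSet L ∧ surf d (colat ⁻¹' S \ colat ⁻¹' L) = 0 := by
  obtain ⟨T, hTS, hTm, hTe⟩ := hS.exists_measurable_subset_ae_eq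
  have hK : ∀ n : ℕ, ∃ K ⊆ T, IsCompact K ∧ surf d (T \ K) < ((n : ℝ≥0∞) + 1)⁻¹ := fun n =>
    hTm.exists_isCompact_sdiff_lt (measure_ne_top _ _) (by simp)
  choose K hKT hKc hKlt using hK
  refine ⟨⋃ n, colat '' K n, ?_, ?_, ?_⟩
  · refine iUnion_subset fun n => ?_
    rintro _ ⟨ξ, hξ, rfl⟩
    exact hTS (hKT n hξ)
  · exact MeasurableSet.iUnion fun n => ((hKc n).image continuous_colat).measurableSet
  · have h1 : surf d (T \ ⋃ n, K n) = 0 := by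
      refine le_antisymm (ENNReal.le_of_forall_pos_le_add fun ε hε _ => ?_) zero_le
      obtain ⟨n, hn⟩ := ENNReal.exists_inv_nat_lt (a := (ε : ℝ≥0∞)) (by simpa using hε.ne')
      rw [zero_add]
      refine (measure_mono (sdiff_subset_sdiff_right (subset_iUnion K n))).trans
        ((hKlt n).le.trans (le_trans ?_ hn.le))
      exact ENNReal.inv_le_inv.2 le_self_add
    have h2 : surf d (colat ⁻¹' S \ T) = 0 := by
      rw [← ae_le_set]; exact hTe.symm.le
    refine measure_mono_null (t := (colat ⁻¹' S \ T) ∪ (T \ ⋃ n, K n)) ?_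
      (measure_union_null h2 h1)
    rintro ξ ⟨hξ, hξ'⟩
    by_cases hT : ξ ∈ T
    · refine Or.inr ⟨hT, fun h => hξ' ?_⟩
      obtain ⟨n, hn⟩ := mem_iUnion.1 h
      exact mem_iUnion.2 ⟨n, ξ, hn, rfl⟩
    · exact Or.inl ⟨hξ, hT⟩

theorem nullMeasurableSet_of_colat_preimage {S : Set ℝ}
    (hS : NullMeasurableSet ((colat : Sph d → ℝ) ⁻¹' S) (surf d)) :
    NullMeasurableSet S ((surf d).map colat) := by
  obtain ⟨L, hLS, hL, h0⟩ := exists_measurableSet_colat_inner hS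
  obtain ⟨L', hLS', hL', h0'⟩ := exists_measurableSet_colat_inner (S := Sᶜ) (by
    rw [preimage_compl]; exact hS.compl)
  have h1 : ((surf d).map colat) (L'ᶜ \ L) = 0 := by
    rw [Measure.map_apply measurable_colat (hL'.compl.diff hL)]
    refine measure_mono_null ?_ (measure_union_null h0 h0')
    rintro ξ ⟨h2, h3⟩
    by_cases h : colat ξ ∈ S
    · exact Or.inl ⟨h, h3⟩
    · exact Or.inr ⟨h, h2⟩
  have h2 : L =ᵐ[(surf d).map colat] S := by
    refine hLS.eventuallyLE.antisymm (ae_le_set.2 (measure_mono_null ?_ h1))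
    exact sdiff_subset_sdiff_left fun x hx hx' => hLS' hx' hx
  exact hL.nullMeasurableSet.congr h2

theorem aemeasurable_of_comp_colat {F : ℝ → ℂ}
    (hF : AEMeasurable (fun ξ : Sph d => F (colat ξ)) (surf d)) :
    AEMeasurable F ((surf d).map colat) := by
  refine NullMeasurable.aemeasurable fun B hB => ?_
  exact nullMeasurableSet_of_colat_preimage (hF.nullMeasurable hB)

theorem exists_profile_of_isPolar [NeZero d] {f f₀ : Sph d → ℂ} (hf : AEStronglyMeasurable f (surf d))
    (hf₀ : IsPolar f₀) (h : f =ᵐ[surf d] f₀) :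
    ∃ F : ℝ → ℂ, StronglyMeasurable F ∧ f =ᵐ[surf d] fun ξ => F (colat ξ) := by
  have e : f₀ = fun ξ => f₀ (mer (colat ξ)) := by
    funext ξ
    exact isPolar_iff_colat.1 hf₀ _ _ (colat_mer ⟨colat_nonneg _, colat_le_pi _⟩).symm
  have hm : AEMeasurable (fun ξ : Sph d => f₀ (mer (colat ξ))) (surf d) := by
    rw [← e]
    exact (hf.congr h).aemeasurable
  have hm' := aemeasurable_of_comp_colat (F := fun τ => f₀ (mer τ)) hm
  refine ⟨hm'.mk, hm'.measurable_mk.stronglyMeasurable, ?_⟩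
  refine (h.trans (Eventually.of_forall fun ξ => congrFun e ξ)).trans ?_
  exact ae_of_ae_map measurable_colat.aemeasurable hm'.ae_eq_mk

section Uniqueness

variable {𝕜 : Type*} [RCLike 𝕜]

/-- The smooth version of the du Bois-Reymond lemma holds in the ambient space for any locally
finite measure; it is applied to the surface measure pushed forward and to the extension of `h` by
0. -/
theorem ae_eq_zero_of_integral_smooth {E : Type*} [NormedAddCommGroup E] [NormedSpace ℝ E]
    [CompleteSpace E] {h : Sph d → E} (hh : Integrable h (surf d))
    (h0 : ∀ φ : Ambient d → ℝ, ContDiff ℝ ∞ φ → ∫ ξ : Sph d, φ ξ • h ξ ∂(surf d) = 0) :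
    ∀ᵐ ξ ∂(surf d), h ξ = 0 := by
  have hme : MeasurableEmbedding ((↑) : Sph d → Ambient d) :=
    MeasurableEmbedding.subtype_coe Metric.isClosed_sphere.measurableSet
  have hext : ∀ ξ : Sph d, Function.extend ((↑) : Sph d → Ambient d) h 0 ξ = h ξ :=
    fun ξ => Subtype.val_injective.extend_apply _ _ _
  have hint : Integrable (Function.extend ((↑) : Sph d → Ambient d) h 0)
      ((surf d).map (↑)) := by
    rw [hme.integrable_map_iff]
    exact hh.congr (Eventually.of_forall fun ξ => (hext ξ).symm)
  have := ae_eq_zero_of_integral_contDiff_smul_eq_zero hint.locallyIntegrable (fun φ hφ _ => by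
    rw [hme.integral_map]
    simp only [hext]
    exact h0 φ hφ)
  rw [hme.ae_map_iff] at this
  filter_upwards [this] with ξ hξ
  rwa [hext] at hξ

/-- The test identities determine all combinations x_i G_j - x_j G_i. Summing them against x_i
recovers G_j, because |x| = 1 and G is tangential. -/
theorem IsWeakGradientOn.unique {g : Sph d → 𝕜} {G G' : Sph d → EuclideanSpace 𝕜 (Fin (d + 1))}
    (h : IsWeakGradientOn univ g G) (h' : IsWeakGradientOn univ g G')
    (hG : Integrable G (surf d)) (hG' : Integrable G' (surf d)) : G =ᵐ[surf d] G' := by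
  have hc : ∀ {K : Sph d → EuclideanSpace 𝕜 (Fin (d + 1))}, Integrable K (surf d) →
      ∀ i j, Integrable (fun ξ : Sph d => (ξ : Ambient d) i • K ξ j - (ξ : Ambient d) j • K ξ i)
        (surf d) := by
    intro K hK i j
    have hk : ∀ j, Integrable (fun ξ => K ξ j) (surf d) := fun j =>
      (EuclideanSpace.proj (𝕜 := 𝕜) j : _ →L[𝕜] 𝕜).integrable_comp hK
    exact (integrable_bdd_smul (continuous_coord i).measurable
      (fun ξ => coord_abs_le_one ξ i) (hk j)).sub
      (integrable_bdd_smul (continuous_coord j).measurable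
      (fun ξ => coord_abs_le_one ξ j) (hk i))
  have key : ∀ i j, ∀ᵐ ξ : Sph d ∂(surf d), ((ξ : Ambient d) i • G ξ j - (ξ : Ambient d) j • G ξ i) -
      ((ξ : Ambient d) i • G' ξ j - (ξ : Ambient d) j • G' ξ i) = 0 := by
    intro i j
    refine ae_eq_zero_of_integral_smooth ((hc hG i j).sub (hc hG' i j)) fun φ hφ => ?_
    have hφc : Continuous fun ξ : Sph d => φ ξ := hφ.continuous.comp continuous_subtype_val
    obtain ⟨B, hB⟩ := isCompact_univ.exists_bound_of_continuousOn hφc.continuousOn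
    have hB1 : ∀ ξ : Sph d, |φ ξ| ≤ B := fun ξ => hB ξ (mem_univ _)
    simp only [smul_sub (φ _) (_ - _) (_ - _)]
    rw [integral_sub (integrable_bdd_smul hφc.measurable hB1 (hc hG i j))
      (integrable_bdd_smul hφc.measurable hB1 (hc hG' i j)), sub_eq_zero]
    have h1 := h.integral_eq φ hφ (subset_univ _) i j
    have h2 := h'.integral_eq φ hφ (subset_univ _) i j
    exact neg_injective (h1.symm.trans h2)
  have key' : ∀ᵐ ξ : Sph d ∂(surf d), ∀ i j, ((ξ : Ambient d) i • G ξ j - (ξ : Ambient d) j • G ξ i) -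
      ((ξ : Ambient d) i • G' ξ j - (ξ : Ambient d) j • G' ξ i) = 0 :=
    ae_all_iff.2 fun i => ae_all_iff.2 fun j => key i j
  filter_upwards [key', h.tangential, h'.tangential] with ξ h1 h2 h3
  have h2 := h2 (mem_univ _)
  have h3 := h3 (mem_univ _)
  ext j
  have e : ∑ i, (ξ : Ambient d) i • (((ξ : Ambient d) i • G ξ j - (ξ : Ambient d) j • G ξ i) -
      ((ξ : Ambient d) i • G' ξ j - (ξ : Ambient d) j • G' ξ i)) =
      (∑ i, (ξ : Ambient d) i ^ 2) • (G ξ j - G' ξ j) - (ξ : Ambient d) j •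
        (∑ i, (ξ : Ambient d) i • G ξ i - ∑ i, (ξ : Ambient d) i • G' ξ i) := by
    rw [Finset.sum_smul, ← Finset.sum_sub_distrib, Finset.smul_sum, ← Finset.sum_sub_distrib]
    refine Finset.sum_congr rfl fun i _ => ?_
    module
  rw [Finset.sum_eq_zero fun i _ => by rw [h1 i j, smul_zero], sum_coord_sq, h2, h3] at e
  simp only [one_smul, sub_zero, smul_zero] at e
  exact sub_eq_zero.1 e.symm

end Uniqueness

end PolarSphere

end

/-! ### From polar Sobolev functions to profiles. -/

noncomputable section

namespace PolarSphere

variable {d : ℕ}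

section Radial

variable {𝕜 : Type*} [RCLike 𝕜]

/-- The derivative of a function with gradient `G` in direction of the meridians. -/
def radPart (G : Sph d → EuclideanSpace 𝕜 (Fin (d + 1))) (ξ : Sph d) : 𝕜 :=
  ∑ i, tanCoord ξ i • G ξ i

theorem sum_tanCoord_sq_le (ξ : Sph d) : ∑ i, tanCoord ξ i ^ 2 ≤ 1 := by
  by_cases h : Real.sin (colat ξ) = 0
  · simp [tanCoord, h]
  · exact (sum_tanCoord_sq h).le

theorem norm_radPart_le (G : Sph d → EuclideanSpace 𝕜 (Fin (d + 1))) (ξ : Sph d) :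
    ‖radPart G ξ‖ ≤ ‖G ξ‖ := by
  calc ‖radPart G ξ‖ ≤ ∑ i, |tanCoord ξ i| * ‖G ξ i‖ := by
        refine (norm_sum_le _ _).trans_eq ?_
        simp [norm_smul]
    _ ≤ √(∑ i, |tanCoord ξ i| ^ 2) * √(∑ i, ‖G ξ i‖ ^ 2) :=
        Real.sum_mul_le_sqrt_mul_sqrt _ _ _
    _ ≤ 1 * √(∑ i, ‖G ξ i‖ ^ 2) := by
        gcongr
        rw [Real.sqrt_le_one]
        simpa using sum_tanCoord_sq_le ξ
    _ = ‖G ξ‖ := by rw [one_mul, EuclideanSpace.norm_eq]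

theorem integrable_radPart {G : Sph d → EuclideanSpace 𝕜 (Fin (d + 1))}
    (hG : Integrable G (surf d)) : Integrable (radPart G) (surf d) := by
  refine hG.mono ?_ (Eventually.of_forall (norm_radPart_le G))
  refine Finset.aestronglyMeasurable_fun_sum _ fun i _ => ?_
  exact (measurable_tanCoord i).aestronglyMeasurable.smul
    (((EuclideanSpace.proj (𝕜 := 𝕜) i : _ →L[𝕜] 𝕜).integrable_comp hG).aestronglyMeasurable)

theorem sin_smul_radPart {G : Sph d → EuclideanSpace 𝕜 (Fin (d + 1))} {ξ : Sph d}
    (h : ∑ i, (ξ : Ambient d) i • G ξ i = 0) (hs : Real.sin (colat ξ) ≠ 0) :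
    Real.sin (colat ξ) • radPart G ξ = -G ξ 0 := by
  have : ∀ i, Real.sin (colat ξ) • tanCoord ξ i • G ξ i =
      (ξ : Ambient d) 0 • ((ξ : Ambient d) i • G ξ i) -
        (EuclideanSpace.single 0 1 : Ambient d) i • G ξ i := by
    intro i
    rw [tanCoord, smul_smul, mul_div_cancel₀ _ hs]
    module
  rw [radPart, Finset.smul_sum, Finset.sum_congr rfl fun i _ => this i, Finset.sum_sub_distrib,
    ← Finset.smul_sum, h, smul_zero, zero_sub]
  simp [ite_smul]

theorem radPart_radGrad (w : ℝ → 𝕜) {ξ : Sph d} (hs : Real.sin (colat ξ) ≠ 0) :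
    radPart (radGrad w) ξ = w (colat ξ) := by
  simp only [radPart, radGrad, smul_smul, ← pow_two]
  rw [← Finset.sum_smul, sum_tanCoord_sq hs, one_smul]

/-- Conditional expectation with respect to the colatitude. It provides a candidate for the
derivative of the profile before the gradient is known to be radial. -/
theorem exists_radial_condExp {k : Sph d → 𝕜} (hk : Integrable k (surf d)) :
    ∃ w : ℝ → 𝕜, StronglyMeasurable w ∧ Integrable (fun ξ : Sph d => w (colat ξ)) (surf d) ∧
      ∀ ψ : ℝ → ℝ, Measurable ψ → ∀ C : ℝ, (∀ t, |ψ t| ≤ C) →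
        ∫ ξ, ψ (colat ξ) • k ξ ∂(surf d) = ∫ ξ : Sph d, ψ (colat ξ) • w (colat ξ) ∂(surf d) := by
  set m : MeasurableSpace (Sph d) := MeasurableSpace.comap colat inferInstance with hm
  have hle : m ≤ Subtype.instMeasurableSpace := measurable_colat.comap_le
  obtain ⟨w, hw, he⟩ := StronglyMeasurable.exists_eq_measurable_comp
    (stronglyMeasurable_condExp (f := k) (m := m) (μ := surf d))
  have he' : ∀ ξ, ((surf d)[k | m]) ξ = w (colat ξ) := fun ξ => congrFun he ξ
  refine ⟨w, hw, ?_, fun ψ hψ C hC => ?_⟩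
  · refine (integrable_condExp (f := k) (m := m) (μ := surf d)).congr ?_
    exact Eventually.of_forall he'
  · have h1 : AEStronglyMeasurable[m] (fun ξ : Sph d => ψ (colat ξ)) (surf d) :=
      (Measurable.stronglyMeasurable (hψ.comp (comap_measurable colat))).aestronglyMeasurable
    have h2 : Integrable ((fun ξ : Sph d => ψ (colat ξ)) • k) (surf d) :=
      integrable_bdd_smul (hψ.comp measurable_colat) (fun _ => hC _) hk
    have h3 := condExp_smul_of_aestronglyMeasurable_left h1 h2 hk
    rw [← integral_condExp hle (f := fun ξ : Sph d => ψ (colat ξ) • k ξ)]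
    refine integral_congr_ae ?_
    filter_upwards [h3] with ξ hξ
    refine hξ.trans ?_
    simp [he']

end Radial

section OneDim

/-- The function on `[-1, 1]` from which a test function on `(0, π)` is recovered. -/
def testLift (d : ℕ) (η : ℝ → ℝ) (s : ℝ) : ℝ := η (Real.arccos s) / √(1 - s ^ 2) ^ d

/-- The support of η stays away from 0 and π, so the points s = ±1 at which the arccosine and the
square root fail to be smooth are never met; off the preimage of the support the function is locally
0. -/
theorem contDiff_testLift {η : ℝ → ℝ} (hη : ContDiff ℝ ∞ η) (hs : tsupport η ⊆ Ioo 0 Real.pi) :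
    ContDiff ℝ ∞ (testLift d η) := by
  rw [contDiff_iff_contDiffAt]
  intro s
  by_cases h : Real.arccos s ∈ tsupport η
  · have h1 := hs h
    have hs1 : s ≠ -1 := by
      rintro rfl; simp at h1
    have hs2 : s ≠ 1 := by
      rintro rfl; simp at h1
    have h3 : 0 < 1 - s ^ 2 := by
      have := Real.arccos_pos.1 h1.1
      have := Real.arccos_lt_pi.1 h1.2
      nlinarith
    have h4 : ContDiffAt ℝ ∞ (fun s : ℝ => √(1 - s ^ 2)) s :=
      ContDiffAt.sqrt (by fun_prop) h3.ne'
    exact (hη.contDiffAt.comp s (Real.contDiffAt_arccos hs1 hs2)).div (h4.pow d)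
      (pow_ne_zero _ (Real.sqrt_pos.2 h3).ne')
  · have h1 : ∀ᶠ t in 𝓝 s, Real.arccos t ∉ tsupport η :=
      (Real.continuous_arccos.isOpen_preimage _ (isClosed_tsupport η).isOpen_compl).mem_nhds h
    refine contDiffAt_const (c := (0 : ℝ)) |>.congr_of_eventuallyEq ?_
    filter_upwards [h1] with t ht
    simp [testLift, image_eq_zero_of_notMem_tsupport ht]

theorem testLift_cos {η : ℝ → ℝ} {τ : ℝ} (hτ : τ ∈ Ioo 0 Real.pi) :
    testLift d η (Real.cos τ) = η τ / Real.sin τ ^ d := by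
  have hs := Real.sin_pos_of_mem_Ioo hτ
  rw [testLift, Real.arccos_cos hτ.1.le hτ.2.le, ← Real.sin_sq, Real.sqrt_sq hs.le]

/-- The power d in `testLift` is chosen for this: the bracket is the integrand produced by
`integral_angular_sum`, and sin^(d-1) is the density of the colatitude. -/
theorem deriv_testLift_cos [NeZero d] {η : ℝ → ℝ} (hη : ContDiff ℝ ∞ η)
    (hs : tsupport η ⊆ Ioo 0 Real.pi) {τ : ℝ} (hτ : τ ∈ Ioo 0 Real.pi) :
    deriv η τ = Real.sin τ ^ (d - 1) * (d * Real.cos τ * testLift d η (Real.cos τ) -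
      Real.sin τ ^ 2 * deriv (testLift d η) (Real.cos τ)) := by
  have h1 : η =ᶠ[𝓝 τ] fun t => Real.sin t ^ d * testLift d η (Real.cos t) := by
    filter_upwards [Ioo_mem_nhds hτ.1 hτ.2] with t ht
    have := (Real.sin_pos_of_mem_Ioo ht).ne'
    rw [testLift_cos ht]
    field_simp
  have h2 : HasDerivAt (testLift d η) (deriv (testLift d η) (Real.cos τ)) (Real.cos τ) :=
    ((contDiff_testLift hη hs).differentiable (by simp) _).hasDerivAt
  have h3 := ((Real.hasDerivAt_sin τ).pow d).mul (h2.comp τ (Real.hasDerivAt_cos τ))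
  rw [(h3.congr_of_eventuallyEq h1).deriv]
  have : Real.sin τ ^ d = Real.sin τ ^ (d - 1) * Real.sin τ := by
    rw [← pow_succ, Nat.sub_add_cancel NeZero.one_le]
  simp only [Function.comp, Pi.pow_apply, this]
  ring

theorem hasFDerivAt_coord_mul (j : Fin (d + 1)) {ψ : ℝ → ℝ} (hψ : Differentiable ℝ ψ)
    (ξ : Sph d) : angularDeriv 0 j (fun x : Ambient d => x j * ψ (x 0)) ξ =
      ((ξ : Ambient d) 0 - (ξ : Ambient d) j * (EuclideanSpace.single 0 1 : Ambient d) j) *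
        ψ ((ξ : Ambient d) 0) +
      ((ξ : Ambient d) 0 * (ξ : Ambient d) j * (EuclideanSpace.single 0 1 : Ambient d) j -
        (ξ : Ambient d) j ^ 2) * deriv ψ ((ξ : Ambient d) 0) := by
  have hp : ∀ i : Fin (d + 1), HasFDerivAt (fun x : Ambient d => x i)
      (EuclideanSpace.proj i : Ambient d →L[ℝ] ℝ) (ξ : Ambient d) := fun i =>
    (EuclideanSpace.proj i : Ambient d →L[ℝ] ℝ).hasFDerivAt
  have h1 := (hψ ((ξ : Ambient d) 0)).hasDerivAt.comp_hasFDerivAt (ξ : Ambient d) (hp 0)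
  have h2 : HasFDerivAt (fun x : Ambient d => x j * ψ (x 0)) _ (ξ : Ambient d) := (hp j).mul h1
  rw [angularDeriv, h2.fderiv]
  by_cases hj : j = 0
  · subst hj; simp [pow_two]
  · simp [hj, Ne.symm hj]; ring

variable {𝕜 : Type*} [RCLike 𝕜]

/-- Test with x_j ψ(x_0) in the (0, j)-plane and sum over j. The combined field x_0 x - e is sin
`colat` times the unit field along the meridians, and tangentiality and |x| = 1 leave only the
zeroth component of G. -/
theorem integral_angular_sum {g : Sph d → 𝕜} {G : Sph d → EuclideanSpace 𝕜 (Fin (d + 1))}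
    (h : IsWeakGradientOn univ g G) (hg : Integrable g (surf d)) (hG : Integrable G (surf d))
    {ψ : ℝ → ℝ} (hψ : ContDiff ℝ ∞ ψ) :
    ∫ ξ : Sph d, (d * (ξ : Ambient d) 0 * ψ ((ξ : Ambient d) 0) -
        (1 - (ξ : Ambient d) 0 ^ 2) * deriv ψ ((ξ : Ambient d) 0)) • g ξ ∂(surf d) =
      ∫ ξ : Sph d, ψ ((ξ : Ambient d) 0) • G ξ 0 ∂(surf d) := by
  have hφ : ∀ j : Fin (d + 1), ContDiff ℝ ∞ fun x : Ambient d => x j * ψ (x 0) := fun j =>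
    (EuclideanSpace.proj j : Ambient d →L[ℝ] ℝ).contDiff.mul
      (hψ.comp (EuclideanSpace.proj 0 : Ambient d →L[ℝ] ℝ).contDiff)
  have hbd : ∀ φ : Sph d → ℝ, Continuous φ → ∃ B, ∀ ξ, |φ ξ| ≤ B := fun φ hφ => by
    obtain ⟨B, hB⟩ := isCompact_univ.exists_bound_of_continuousOn hφ.continuousOn
    exact ⟨B, fun ξ => hB ξ (mem_univ _)⟩
  have hG' : ∀ j, Integrable (fun ξ => G ξ j) (surf d) := fun j =>
    (EuclideanSpace.proj (𝕜 := 𝕜) j : _ →L[𝕜] 𝕜).integrable_comp hG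
  have hs := Finset.sum_congr (rfl : (Finset.univ : Finset (Fin (d + 1))) = _)
    fun j _ => h.integral_eq _ (hφ j) (subset_univ _) 0 j
  have hψc : Continuous fun ξ : Sph d => ψ ((ξ : Ambient d) 0) :=
    hψ.continuous.comp (continuous_coord 0)
  rw [Finset.sum_neg_distrib, ← integral_finsetSum, ← integral_finsetSum] at hs
  · have e1 : ∀ ξ : Sph d, ∑ j, angularDeriv 0 j (fun x : Ambient d => x j * ψ (x 0)) ξ • g ξ =
        (d * (ξ : Ambient d) 0 * ψ ((ξ : Ambient d) 0) -
        (1 - (ξ : Ambient d) 0 ^ 2) * deriv ψ ((ξ : Ambient d) 0)) • g ξ := by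
      intro ξ
      rw [← Finset.sum_smul, Finset.sum_congr rfl fun j _ =>
        hasFDerivAt_coord_mul j (hψ.differentiable (by simp)) ξ, Finset.sum_add_distrib,
        ← Finset.sum_mul, ← Finset.sum_mul, Finset.sum_sub_distrib, Finset.sum_sub_distrib,
        sum_coord_sq]
      simp
      ring_nf
    have e2 : ∀ᵐ ξ : Sph d ∂(surf d), ∑ j, ((ξ : Ambient d) j * ψ ((ξ : Ambient d) 0)) •
        ((ξ : Ambient d) 0 • G ξ j - (ξ : Ambient d) j • G ξ 0) =
        -(ψ ((ξ : Ambient d) 0) • G ξ 0) := by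
      filter_upwards [h.tangential] with ξ ht
      have ht := ht (mem_univ _)
      have : ∀ j, ((ξ : Ambient d) j * ψ ((ξ : Ambient d) 0)) •
        ((ξ : Ambient d) 0 • G ξ j - (ξ : Ambient d) j • G ξ 0) =
        (ψ ((ξ : Ambient d) 0) * (ξ : Ambient d) 0) • ((ξ : Ambient d) j • G ξ j) -
        ((ξ : Ambient d) j ^ 2) • (ψ ((ξ : Ambient d) 0) • G ξ 0) := by
        intro j; module
      rw [Finset.sum_congr rfl fun j _ => this j, Finset.sum_sub_distrib, ← Finset.smul_sum, ht,
        smul_zero, zero_sub, ← Finset.sum_smul, sum_coord_sq, one_smul]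
    rw [integral_congr_ae (Eventually.of_forall e1), integral_congr_ae e2, integral_neg,
      neg_neg] at hs
    exact hs
  · intro j _
    have hc : Continuous fun ξ : Sph d => (ξ : Ambient d) j * ψ ((ξ : Ambient d) 0) :=
      (continuous_coord j).mul hψc
    obtain ⟨B, hB⟩ := hbd _ hc
    exact integrable_bdd_smul hc.measurable hB ((integrable_bdd_smul
      (continuous_coord 0).measurable (fun ξ => coord_abs_le_one ξ 0) (hG' j)).sub
      (integrable_bdd_smul (continuous_coord j).measurable (fun ξ => coord_abs_le_one ξ j) (hG' 0)))
  · intro j _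
    obtain ⟨B, hB⟩ := hbd _ (continuous_angularDeriv 0 j (hφ j))
    exact integrable_bdd_smul (continuous_angularDeriv 0 j (hφ j)).measurable hB hg

theorem _root_.MeasureTheory.LocallyIntegrableOn.integrable_smul_of_tsupport_subset
    {E : Type*} [NormedAddCommGroup E] [NormedSpace ℝ E] {D : ℝ → E} {U : Set ℝ}
    (hD : LocallyIntegrableOn D U) {φ : ℝ → ℝ} (hφ : Continuous φ) (hc : HasCompactSupport φ)
    (hs : tsupport φ ⊆ U) : Integrable (fun τ => φ τ • D τ) := by
  have h1 : IntegrableOn (fun τ => φ τ • D τ) (tsupport φ) :=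
    (hD.integrableOn_compact_subset hs hc).continuousOn_smul hφ.continuousOn hc
  refine (integrableOn_iff_integrable_of_support_subset ?_).1 h1
  exact (Function.support_smul_subset_left _ _).trans (subset_tsupport φ)

/-- A locally integrable function with vanishing weak derivative is constant. -/
theorem ae_eq_const_of_integral_deriv_smul {D : ℝ → 𝕜} {a b : ℝ} (hab : a < b)
    (hD : LocallyIntegrableOn D (Ioo a b))
    (h : ∀ η : ℝ → ℝ, ContDiff ℝ ∞ η → tsupport η ⊆ Ioo a b →
      ∫ τ in Ioo a b, deriv η τ • D τ = 0) :
    ∃ c, ∀ᵐ τ, τ ∈ Ioo a b → D τ = c := by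
  -- A bump of unit mass inside the interval; the constant will be the mean of D against it.
  let χ : ContDiffBump ((a + b) / 2) :=
    ⟨(b - a) / 8, (b - a) / 4, by linarith, by linarith⟩
  have hχs : tsupport (χ.normed volume) ⊆ Ioo a b := by
    rw [χ.tsupport_normed_eq, Real.closedBall_eq_Icc]
    have : χ.rOut = (b - a) / 4 := rfl
    exact fun x hx => ⟨by linarith [hx.1], by linarith [hx.2]⟩
  have hset : ∀ φ : ℝ → ℝ, tsupport φ ⊆ Ioo a b →
      ∫ τ in Ioo a b, φ τ • D τ = ∫ τ, φ τ • D τ := by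
    intro φ hs
    refine setIntegral_eq_integral_of_forall_compl_eq_zero fun x hx => ?_
    rw [image_eq_zero_of_notMem_tsupport fun h => hx (hs h), zero_smul]
  set c := ∫ τ, χ.normed volume τ • D τ with hc
  refine ⟨c, ?_⟩
  have key := isOpen_Ioo.ae_eq_zero_of_integral_contDiff_smul_eq_zero (U := Ioo a b)
    (f := fun τ => D τ - c) (μ := volume) (hD.sub (locallyIntegrableOn_const c)) ?_
  · filter_upwards [key] with τ hτ h'
    exact sub_eq_zero.1 (hτ h')
  intro φ hφ hφc hφs
  set m := ∫ τ, φ τ with hm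
  -- Subtracting the right multiple of the bump makes the mean zero, so the primitive of ζ has
  -- compact support in the interval and is an admissible test function.
  set ζ : ℝ → ℝ := fun τ => φ τ - m * χ.normed volume τ with hζ
  have hζc : ContDiff ℝ ∞ ζ := hφ.sub (contDiff_const.mul χ.contDiff_normed)
  have hζ0 : ∫ τ, ζ τ = 0 := by
    rw [hζ, integral_sub (hφ.continuous.integrable_of_hasCompactSupport hφc)
      (χ.integrable_normed.const_mul m), integral_const_mul, χ.integral_normed, mul_one, sub_self]
  have hK : IsCompact (tsupport φ ∪ tsupport (χ.normed volume)) :=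
    hφc.isCompact.union (χ.hasCompactSupport_normed (μ := volume)).isCompact
  obtain ⟨a', ha', b', hb', hK'⟩ : ∃ a' > a, ∃ b' < b,
      tsupport φ ∪ tsupport (χ.normed volume) ⊆ Icc a' b' := by
    have hne : (tsupport φ ∪ tsupport (χ.normed volume)).Nonempty := by
      rw [χ.tsupport_normed_eq]
      exact ⟨(a + b) / 2, Or.inr (Metric.mem_closedBall_self χ.rOut_pos.le)⟩
    have hsub := union_subset hφs hχs
    exact ⟨_, (hsub (hK.sInf_mem hne)).1, _, (hsub (hK.sSup_mem hne)).2, fun x hx =>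
      ⟨csInf_le hK.bddBelow hx, le_csSup hK.bddAbove hx⟩⟩
  have hζz : ∀ x, x ∉ Icc a' b' → ζ x = 0 := by
    intro x hx
    simp only [hζ]
    rw [image_eq_zero_of_notMem_tsupport fun h => hx (hK' (Or.inl h)),
      image_eq_zero_of_notMem_tsupport fun h => hx (hK' (Or.inr h))]
    simp
  have hηd : ∀ x, HasDerivAt (fun x => ∫ t in a..x, ζ t) (ζ x) x := fun x =>
    hζc.continuous.integral_hasStrictDerivAt a x |>.hasDerivAt
  have hηs : tsupport (fun x => ∫ t in a..x, ζ t) ⊆ Icc a' b' := by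
    refine closure_minimal (fun x hx => ?_) isClosed_Icc
    by_contra hx'
    refine hx ?_
    rcases lt_or_ge x a' with h1 | h1
    · refine intervalIntegral.integral_zero_ae (Eventually.of_forall fun t ht => hζz t fun h2 => ?_)
      have : t ≤ max a x := ht.2
      exact absurd (h2.1.trans this) (not_le.2 (max_lt ha' h1))
    · have h2 : b' < x := by
        by_contra h3; exact hx' ⟨h1, not_lt.1 h3⟩
      simp only
      rw [intervalIntegral.integral_of_le (ha'.le.trans h1),
        setIntegral_eq_integral_of_forall_compl_eq_zero, hζ0]
      intro y hy
      refine hζz y fun h3 => hy ⟨ha'.trans_le h3.1, h3.2.trans h2.le⟩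
  have hη : ContDiff ℝ ∞ (fun x => ∫ t in a..x, ζ t) := by
    rw [contDiff_infty_iff_deriv]
    exact ⟨fun x => (hηd x).differentiableAt, by simpa only [funext fun x => (hηd x).deriv]⟩
  have h1 := h _ hη (hηs.trans fun x hx => ⟨ha'.trans_le hx.1, hx.2.trans_lt hb'⟩)
  simp only [fun x => (hηd x).deriv] at h1
  have hi1 := hD.integrable_smul_of_tsupport_subset hφ.continuous hφc hφs
  have hi2 := hD.integrable_smul_of_tsupport_subset χ.continuous_normed (χ.hasCompactSupport_normed (μ := volume)) hχs
  have hζs : tsupport ζ ⊆ Ioo a b := by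
    refine (closure_minimal (fun x hx => ?_) isClosed_Icc).trans
      (fun x hx => ⟨ha'.trans_le hx.1, hx.2.trans_lt hb'⟩ : Icc a' b' ⊆ Ioo a b)
    by_contra hx'
    exact hx (hζz x hx')
  rw [hset ζ hζs] at h1
  simp only [hζ, sub_smul, mul_smul] at h1
  have e := integral_sub hi1 (hi2.smul m)
  simp only [Pi.smul_apply] at e
  rw [e, integral_smul, ← hc, sub_eq_zero] at h1
  simp only [smul_sub]
  rw [integral_sub hi1 ((hφ.continuous.integrable_of_hasCompactSupport hφc).smul_const c), h1,
    integral_smul_const, sub_self]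

variable [NeZero d]

/-- The identity of `integral_angular_sum` for the lifted test function, written in the colatitude;
only the radial part of the gradient enters, and it may be replaced by its conditional expectation.
-/
theorem integral_deriv_test_smul {g : Sph d → 𝕜} {G : Sph d → EuclideanSpace 𝕜 (Fin (d + 1))}
    (h : IsWeakGradientOn univ g G) (hg : Integrable g (surf d)) (hG : Integrable G (surf d))
    {F w : ℝ → 𝕜} (hF : StronglyMeasurable F) (hgF : g =ᵐ[surf d] fun ξ => F (colat ξ))
    (hw : StronglyMeasurable w)
    (hkw : ∀ ψ : ℝ → ℝ, Measurable ψ → ∀ C : ℝ, (∀ t, |ψ t| ≤ C) →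
      ∫ ξ, ψ (colat ξ) • radPart G ξ ∂(surf d) = ∫ ξ : Sph d, ψ (colat ξ) • w (colat ξ) ∂(surf d))
    {η : ℝ → ℝ} (hη : ContDiff ℝ ∞ η) (hs : tsupport η ⊆ Ioo 0 Real.pi) :
    ∫ τ in Ioo 0 Real.pi, deriv η τ • F τ = - ∫ τ in Ioo 0 Real.pi, η τ • w τ := by
  have hψ := contDiff_testLift (d := d) hη hs
  have hψd : Continuous (deriv (testLift d η)) := hψ.continuous_deriv (by simp)
  have h1 := integral_angular_sum h hg hG hψ
  have h2 : ∫ ξ : Sph d, (testLift d η) ((ξ : Ambient d) 0) • G ξ 0 ∂(surf d) =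
      - ∫ ξ : Sph d, (testLift d η (Real.cos (colat ξ)) * Real.sin (colat ξ)) • radPart G ξ
        ∂(surf d) := by
    rw [← integral_neg]
    refine integral_congr_ae ?_
    filter_upwards [h.tangential, ae_colat_mem] with ξ hξ hm
    rw [mul_smul, sin_smul_radPart (hξ (mem_univ _)) (Real.sin_pos_of_mem_Ioo hm).ne', smul_neg,
      neg_neg, cos_colat]
  have hψc := hψ.continuous
  obtain ⟨B, hB⟩ := (isCompact_Icc (a := (-1 : ℝ)) (b := 1)).exists_bound_of_continuousOn
    hψc.continuousOn
  have h3 := hkw (fun τ => testLift d η (Real.cos τ) * Real.sin τ) (by fun_prop) (B * 1) (by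
    intro t
    rw [abs_mul]
    have := hB (Real.cos t) ⟨Real.neg_one_le_cos t, Real.cos_le_one t⟩
    exact mul_le_mul this (Real.abs_sin_le_one t) (abs_nonneg _) ((norm_nonneg _).trans this))
  have h4 : ∫ ξ : Sph d, (d * (ξ : Ambient d) 0 * testLift d η ((ξ : Ambient d) 0) -
        (1 - (ξ : Ambient d) 0 ^ 2) * deriv (testLift d η) ((ξ : Ambient d) 0)) • g ξ ∂(surf d) =
      ∫ ξ : Sph d, (fun τ => (d * Real.cos τ * testLift d η (Real.cos τ) -
        Real.sin τ ^ 2 * deriv (testLift d η) (Real.cos τ)) • F τ) (colat ξ) ∂(surf d) := by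
    refine integral_congr_ae ?_
    filter_upwards [hgF] with ξ hξ
    rw [hξ, ← cos_colat, Real.sin_sq]
  rw [h4, h2, h3, integral_colat (g := fun τ => (d * Real.cos τ * testLift d η (Real.cos τ) -
        Real.sin τ ^ 2 * deriv (testLift d η) (Real.cos τ)) • F τ), integral_colat (g := fun τ =>
    (testLift d η (Real.cos τ) * Real.sin τ) • w τ)] at h1
  · have e1 : EqOn (fun τ => (latConst d * Real.sin τ ^ (d - 1)) •
        ((d * Real.cos τ * testLift d η (Real.cos τ) -
        Real.sin τ ^ 2 * deriv (testLift d η) (Real.cos τ)) • F τ))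
        (fun τ => latConst d • (deriv η τ • F τ)) (Ioo 0 Real.pi) := by
      intro τ hτ
      simp only
      rw [deriv_testLift_cos (d := d) hη hs hτ, smul_smul, smul_smul, mul_assoc]
    have e2 : EqOn (fun τ => (latConst d * Real.sin τ ^ (d - 1)) •
        ((testLift d η (Real.cos τ) * Real.sin τ) • w τ))
        (fun τ => latConst d • (η τ • w τ)) (Ioo 0 Real.pi) := by
      intro τ hτ
      have hsn := (Real.sin_pos_of_mem_Ioo hτ).ne'
      simp only
      rw [smul_smul, smul_smul, testLift_cos (d := d) hτ]
      congr 1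
      have : Real.sin τ ^ d = Real.sin τ ^ (d - 1) * Real.sin τ := by
        rw [← pow_succ, Nat.sub_add_cancel NeZero.one_le]
      rw [this]
      field_simp
    rw [setIntegral_congr_fun measurableSet_Ioo e1, setIntegral_congr_fun measurableSet_Ioo e2,
      integral_smul, integral_smul, ← smul_neg] at h1
    exact smul_right_injective 𝕜 latConst_pos.ne' h1
  · exact ((by fun_prop : Continuous fun τ => testLift d η (Real.cos τ) * Real.sin τ).measurable
      |>.stronglyMeasurable).smul hw
  · exact ((by fun_prop : Continuous fun τ => (d * Real.cos τ * testLift d η (Real.cos τ) -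
        Real.sin τ ^ 2 * deriv (testLift d η) (Real.cos τ))).measurable.stronglyMeasurable).smul hF

/-- A Borel profile of g and the primitive of the averaged radial part of G have the same weak
derivative on (0, π), so they differ by a constant. Thus g comes from a profile, whose gradient is
radial, and uniqueness of weak gradients forces G to be radial as well. -/
theorem exists_profile_of_isWeakGradientOn {g : Sph d → ℂ}
    {G : Sph d → EuclideanSpace ℂ (Fin (d + 1))}
    (h : IsWeakGradientOn univ g G) (hg : Integrable g (surf d)) (hG : Integrable G (surf d))
    {f₀ : Sph d → ℂ} (hf₀ : IsPolar f₀) (hgf : g =ᵐ[surf d] f₀) :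
    ∃ F w : ℝ → ℂ, Profile d F w ∧ (g =ᵐ[surf d] fun ξ => F (colat ξ)) ∧
      G =ᵐ[surf d] radGrad w := by
  obtain ⟨F₁, hF₁, hgF⟩ := exists_profile_of_isPolar hg.aestronglyMeasurable hf₀ hgf
  obtain ⟨w, hw, hwi, hkw⟩ := exists_radial_condExp (integrable_radPart hG)
  have hP := profile_primitive hw hwi
  set F₀ : ℝ → ℂ := fun θ => ∫ x in (Real.pi / 2)..θ, w x with hF₀
  have hm₀ : Measurable ((Ioo 0 Real.pi).piecewise F₀ 0) :=
    hP.continuousOn.measurable_piecewise continuousOn_const measurableSet_Ioo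
  have hD₀ : LocallyIntegrableOn F₀ (Ioo 0 Real.pi) :=
    hP.continuousOn.locallyIntegrableOn measurableSet_Ioo
  have hD₁ : LocallyIntegrableOn F₁ (Ioo 0 Real.pi) := by
    intro θ hθ
    obtain ⟨a, ha1, ha2⟩ := exists_between hθ.1
    obtain ⟨b, hb1, hb2⟩ := exists_between hθ.2
    exact ⟨Ioc a b, mem_nhdsWithin_of_mem_nhds (Ioc_mem_nhds ha2 hb1),
      (intervalIntegrable_iff_integrableOn_Ioc_of_le (ha2.trans hb1).le).1
        (intervalIntegrable_of_integrable_colat (d := d) hF₁ (hg.congr hgF) ⟨ha1, ha2.trans hθ.2⟩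
          ⟨hθ.1.trans hb1, hb2⟩)⟩
  have h1 : ∀ η : ℝ → ℝ, ContDiff ℝ ∞ η → tsupport η ⊆ Ioo 0 Real.pi →
      ∫ τ in Ioo 0 Real.pi, deriv η τ • (F₁ - F₀) τ = 0 := by
    intro η hη hs
    have e1 := integral_deriv_test_smul h hg hG hF₁ hgF hw hkw hη hs
    -- The same identity for the primitive, whose gradient has radial part w ∘ `colat`. Cutting it
    -- off outside (0, π) makes it measurable on the whole line.
    have e2 := integral_deriv_test_smul (d := d) (F := (Ioo 0 Real.pi).piecewise F₀ 0) hP.isWeakGradientOn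
      hP.integrable_comp hP.integrable_radGrad
      hm₀.stronglyMeasurable (by
        filter_upwards [ae_colat_mem] with ξ hξ
        rw [piecewise_eq_of_mem _ _ _ hξ]) hw (fun ψ _ C _ => by
        refine integral_congr_ae ?_
        filter_upwards [ae_colat_mem] with ξ hξ
        rw [radPart_radGrad w (Real.sin_pos_of_mem_Ioo hξ).ne']) hη hs
    have e3 : ∫ τ in Ioo 0 Real.pi, deriv η τ • (Ioo 0 Real.pi).piecewise F₀ 0 τ =
        ∫ τ in Ioo 0 Real.pi, deriv η τ • F₀ τ :=
      setIntegral_congr_fun measurableSet_Ioo fun τ hτ => by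
        simp only [piecewise_eq_of_mem _ _ _ hτ]
    have hc : HasCompactSupport η := isCompact_Icc.of_isClosed_subset (isClosed_tsupport η)
      (hs.trans Ioo_subset_Icc_self)
    have hs' : tsupport (deriv η) ⊆ Ioo 0 Real.pi :=
      (closure_minimal support_deriv_subset (isClosed_tsupport η)).trans hs
    have hcd : Continuous (deriv η) := hη.continuous_deriv (by simp)
    have i1 := (hD₁.integrable_smul_of_tsupport_subset hcd hc.deriv hs').integrableOn
      (s := Ioo 0 Real.pi)
    have i2 := (hD₀.integrable_smul_of_tsupport_subset hcd hc.deriv hs').integrableOn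
      (s := Ioo 0 Real.pi)
    simp only [Pi.sub_apply, smul_sub]
    rw [integral_sub i1 i2, e1, ← e3, e2, sub_self]
  obtain ⟨c, hc⟩ := ae_eq_const_of_integral_deriv_smul Real.pi_pos (hD₁.sub hD₀) h1
  have hP' : Profile d (fun θ => F₀ θ + c) w := ⟨hw, hwi, fun a ha b hb => by
    rw [← hP.sub_eq a ha b hb]; ring⟩
  have hgF' : g =ᵐ[surf d] fun ξ => F₀ (colat ξ) + c := by
    filter_upwards [hgF, ae_colat_of_ae hc] with ξ h2 h3
    rw [h2, ← h3.2]; simp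
  refine ⟨_, w, hP', hgF', ?_⟩
  have h2 : IsWeakGradientOn univ g (radGrad w) := by
    have h3 := hP'.isWeakGradientOn
    exact ⟨h.locallyIntegrable_fun, h3.locallyIntegrable_grad, h3.tangential, fun φ hφ hs i j => by
      rw [← h3.integral_eq φ hφ hs i j]
      refine integral_congr_ae ?_
      filter_upwards [hgF'] with ξ hξ
      rw [hξ]⟩
  exact h.unique h2 hG hP'.integrable_radGrad

end OneDim

end PolarSphere

end

/-! ### Absolute continuity in one variable, and volumes of geodesic balls. -/

noncomputable section

namespace PolarSphere

variable {d : ℕ}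

section OneDim

variable {v k : ℝ → ℝ} {a b : ℝ}

/-- Increments are dominated by those of a primitive of `k`, which is absolutely continuous. -/
theorem absolutelyContinuousOnInterval_of_abs_sub_le (hab : a ≤ b)
    (hk : IntervalIntegrable k volume a b)
    (h : ∀ x ∈ Icc a b, ∀ y ∈ Icc a b, x ≤ y → |v y - v x| ≤ ∫ t in x..y, k t) :
    AbsolutelyContinuousOnInterval v a b := by
  have hK : AbsolutelyContinuousOnInterval (fun x => ∫ t in a..x, k t) a b :=
    hk.absolutelyContinuousOnInterval_intervalIntegral (by simp)
  have hle : ∀ x ∈ Icc a b, ∀ y ∈ Icc a b, dist (v x) (v y) ≤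
      dist (∫ t in a..x, k t) (∫ t in a..y, k t) := by
    have hi : ∀ x ∈ Icc a b, IntervalIntegrable k volume a x := fun x hx =>
      hk.mono_set (by rw [uIcc_of_le hab, uIcc_of_le hx.1]; exact Icc_subset_Icc_right hx.2)
    have h1 : ∀ x ∈ Icc a b, ∀ y ∈ Icc a b, x ≤ y → dist (v x) (v y) ≤
        dist (∫ t in a..x, k t) (∫ t in a..y, k t) := by
      intro x hx y hy hxy
      rw [dist_comm, dist_comm (∫ t in a..x, k t), Real.dist_eq, Real.dist_eq,
        intervalIntegral.integral_interval_sub_left (hi y hy) (hi x hx)]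
      exact (h x hx y hy hxy).trans (le_abs_self _)
    intro x hx y hy
    rcases le_total x y with hxy | hxy
    · exact h1 x hx y hy hxy
    · rw [dist_comm, dist_comm (∫ t in a..x, k t)]
      exact h1 y hy x hx hxy
  unfold AbsolutelyContinuousOnInterval at hK ⊢
  refine squeeze_zero' (Eventually.of_forall fun _ => Finset.sum_nonneg fun _ _ => dist_nonneg)
    ?_ hK
  refine eventually_inf_principal.2 (Eventually.of_forall fun E hE => ?_)
  refine Finset.sum_le_sum fun i hi => ?_
  have := hE.1 i hi
  rw [uIcc_of_le hab] at this
  exact hle _ this.1 _ this.2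

/-- Compare difference quotients with those of the primitive of `k` at its Lebesgue points. -/
theorem ae_abs_deriv_le_of_abs_sub_le (hab : a ≤ b) (hk : IntervalIntegrable k volume a b)
    (h : ∀ x ∈ Icc a b, ∀ y ∈ Icc a b, x ≤ y → |v y - v x| ≤ ∫ t in x..y, k t) :
    ∀ᵐ x, x ∈ Ioo a b → DifferentiableAt ℝ v x ∧ |deriv v x| ≤ k x := by
  have hac := absolutelyContinuousOnInterval_of_abs_sub_le hab hk h
  filter_upwards [hac.ae_differentiableAt, hk.ae_hasDerivAt_integral] with x h1 h2 hx
  rw [uIcc_of_le hab] at h1 h2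
  have h1 := h1 (Ioo_subset_Icc_self hx)
  have h2 := h2 (Ioo_subset_Icc_self hx) x (Ioo_subset_Icc_self hx)
  refine ⟨h1, ?_⟩
  have t1 := (hasDerivAt_iff_tendsto_slope.1 h1.hasDerivAt).abs
  have t2 := hasDerivAt_iff_tendsto_slope.1 h2
  refine le_of_tendsto_of_tendsto t1 t2 ?_
  filter_upwards [self_mem_nhdsWithin, mem_nhdsWithin_of_mem_nhds (Ioo_mem_nhds hx.1 hx.2)]
    with y hy hy'
  have hx' := Ioo_subset_Icc_self hx
  have hy' := Ioo_subset_Icc_self hy'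
  rw [slope_def_field, slope_def_field, intervalIntegral.integral_same, sub_zero, abs_div]
  rcases lt_or_gt_of_ne (hy : y ≠ x) with hlt | hlt
  · rw [abs_of_neg (sub_neg.2 hlt), abs_sub_comm, intervalIntegral.integral_symm, neg_div,
      ← div_neg]
    have := h y hy' x hx' hlt.le
    have h0 : 0 < -(y - x) := by linarith
    gcongr
  · rw [abs_of_pos (sub_pos.2 hlt)]
    have := h x hx' y hy' hlt.le
    have h0 : 0 < y - x := by linarith
    gcongr

theorem ae_Ioo_of_forall_Ioo {c e : ℝ} {p : ℝ → Prop}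
    (h : ∀ a b, c < a → a ≤ b → b < e → ∀ᵐ x, x ∈ Ioo a b → p x) : ∀ᵐ x, x ∈ Ioo c e → p x := by
  have h1 : ∀ q : ℚ × ℚ, ∀ᵐ x, (c < q.1 ∧ (q.1 : ℝ) ≤ q.2 ∧ q.2 < e) →
      x ∈ Ioo (q.1 : ℝ) q.2 → p x := by
    intro q
    by_cases hq : c < q.1 ∧ (q.1 : ℝ) ≤ q.2 ∧ q.2 < e
    · filter_upwards [h q.1 q.2 hq.1 hq.2.1 hq.2.2] with x hx _ using hx
    · exact Eventually.of_forall fun x hx => absurd hx hq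
  filter_upwards [ae_all_iff.2 h1] with x hx hxm
  obtain ⟨a, ha1, ha2⟩ := exists_rat_btwn hxm.1
  obtain ⟨b, hb1, hb2⟩ := exists_rat_btwn hxm.2
  exact hx (a, b) ⟨ha1, (ha2.trans hb1).le, hb2⟩ ⟨ha2, hb1⟩

theorem ae_Ioo_abs_deriv_le {c e : ℝ}
    (hk : ∀ a b, c < a → a ≤ b → b < e → IntervalIntegrable k volume a b)
    (h : ∀ x ∈ Ioo c e, ∀ y ∈ Ioo c e, x ≤ y → |v y - v x| ≤ ∫ t in x..y, k t) :
    ∀ᵐ x, x ∈ Ioo c e → DifferentiableAt ℝ v x ∧ |deriv v x| ≤ k x :=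
  ae_Ioo_of_forall_Ioo fun a b hca hab hbe =>
    ae_abs_deriv_le_of_abs_sub_le hab (hk a b hca hab hbe) fun x hx y hy =>
      h x ⟨hca.trans_le hx.1, hx.2.trans_lt hbe⟩ y ⟨hca.trans_le hy.1, hy.2.trans_lt hbe⟩

variable [NeZero d]

theorem profile_deriv (hk : StronglyMeasurable k)
    (hki : Integrable (fun ξ : Sph d => k (colat ξ)) (surf d))
    (h : ∀ x ∈ Ioo 0 Real.pi, ∀ y ∈ Ioo 0 Real.pi, x ≤ y → |v y - v x| ≤ ∫ t in x..y, k t) :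
    Profile d v (deriv v) ∧
      ∀ᵐ x, x ∈ Ioo 0 Real.pi → DifferentiableAt ℝ v x ∧ |deriv v x| ≤ k x := by
  have hii : ∀ a ∈ Ioo 0 Real.pi, ∀ b ∈ Ioo 0 Real.pi, IntervalIntegrable k volume a b :=
    fun a ha b hb => intervalIntegrable_of_integrable_colat hk hki ha hb
  have h1 := ae_Ioo_abs_deriv_le (c := 0) (e := Real.pi) (fun a b ha hab hb =>
    hii a ⟨ha, hab.trans_lt hb⟩ b ⟨ha.trans_le hab, hb⟩) h
  refine ⟨⟨(measurable_deriv v).stronglyMeasurable, ?_, ?_⟩, h1⟩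
  · refine hki.mono' ((measurable_deriv v).comp measurable_colat).aestronglyMeasurable ?_
    filter_upwards [ae_colat_of_ae h1] with ξ hξ using hξ.2.2
  · have h2 : ∀ a ∈ Ioo 0 Real.pi, ∀ b ∈ Ioo 0 Real.pi, a ≤ b →
        v b - v a = ∫ x in a..b, deriv v x := fun a ha b hb hab =>
      (absolutelyContinuousOnInterval_of_abs_sub_le hab (hii a ha b hb)
        fun x hx y hy => h x ⟨ha.1.trans_le hx.1, hx.2.trans_lt hb.2⟩
          y ⟨ha.1.trans_le hy.1, hy.2.trans_lt hb.2⟩).integral_deriv_eq_sub.symm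
    intro a ha b hb
    rcases le_total a b with hab | hab
    · exact h2 a ha b hb hab
    · rw [intervalIntegral.integral_symm, ← h2 b hb a ha hab]; ring

/-- The reverse triangle inequality. From here on only |F| and the majorant |w| of its derivative
are used, so continuity of f ↦ |f| in the Sobolev norm is never needed. -/
theorem Profile.norm {E : Type*} [NormedAddCommGroup E] [NormedSpace ℝ E] [CompleteSpace E]
    {F w : ℝ → E} (h : Profile d F w) :
    Profile d (fun τ => ‖F τ‖) (deriv fun τ => ‖F τ‖) ∧
      ∀ᵐ x, x ∈ Ioo 0 Real.pi → DifferentiableAt ℝ (fun τ => ‖F τ‖) x ∧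
        |deriv (fun τ => ‖F τ‖) x| ≤ ‖w x‖ := by
  refine profile_deriv h.meas.norm h.integrable.norm fun x hx y hy hxy => ?_
  refine (abs_norm_sub_norm_le _ _).trans ?_
  rw [h.sub_eq x hx y hy]
  exact intervalIntegral.norm_integral_le_integral_norm hxy

end OneDim

section Balls

theorem surf_geoDist_preimage (ζ : Sph d) (E : Set ℝ) :
    surf d {ξ | geoDist ζ ξ ∈ E} = surf d (colat ⁻¹' E) := by
  obtain ⟨R, hR, -⟩ := exists_sphMap_eq (northPole d) ζ
  rw [← (measurePreserving_sphMap R).measure_preimage_equiv (f := sphEquiv R)]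
  congr 1
  ext ξ
  change geoDist ζ (sphMap R ξ) ∈ E ↔ geoDist (northPole d) ξ ∈ E
  rw [← hR, geoDist_sphMap]

/-- The measure of a geodesic ball of radius `r`. -/
def ballVol (d : ℕ) (r : ℝ) : ℝ := (surf d).real (geoBall (northPole d) r)

theorem surf_geoBall (ζ : Sph d) (r : ℝ) : surf d (geoBall ζ r) = ENNReal.ofReal (ballVol d r) := by
  rw [ballVol, Measure.real, ENNReal.ofReal_toReal (measure_ne_top _ _)]
  exact surf_geoDist_preimage ζ (Iio r)

theorem ballVol_mono : Monotone (ballVol d) := fun _ _ h =>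
  measureReal_mono (fun _ hξ => lt_of_lt_of_le hξ h)

variable [NeZero d]

theorem surf_colat_preimage {E : Set ℝ} (hE : MeasurableSet E) :
    surf d (colat ⁻¹' E) =
      ∫⁻ τ in Ioo 0 Real.pi ∩ E, ENNReal.ofReal (latConst d * Real.sin τ ^ (d - 1)) := by
  rw [← Measure.map_apply measurable_colat hE, map_colat, withDensity_apply _ hE,
    Measure.restrict_restrict hE, inter_comm]

theorem ballVol_eq {r : ℝ} (h0 : 0 ≤ r) (hr : r ≤ Real.pi) :
    ballVol d r = ∫ τ in 0..r, latConst d * Real.sin τ ^ (d - 1) := by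
  have h1 : geoBall (northPole d) r = colat ⁻¹' Iio r := rfl
  rw [ballVol, Measure.real, h1, surf_colat_preimage measurableSet_Iio,
    intervalIntegral.integral_of_le h0, integral_Ioc_eq_integral_Ioo, Ioo_inter_Iio, min_eq_right hr,
    integral_eq_lintegral_of_nonneg_ae]
  · refine (ae_restrict_iff' measurableSet_Ioo).2 (Eventually.of_forall fun τ hτ => ?_)
    have := Real.sin_pos_of_mem_Ioo ⟨hτ.1, hτ.2.trans_le hr⟩
    have := latConst_pos (d := d)
    change 0 ≤ latConst d * Real.sin τ ^ (d - 1)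
    positivity
  · exact (by fun_prop : Continuous fun τ => latConst d * Real.sin τ ^ (d - 1)).aestronglyMeasurable

theorem ballVol_pos {r : ℝ} (h0 : 0 < r) (hr : r ≤ Real.pi) : 0 < ballVol d r := by
  rw [ballVol_eq h0.le hr]
  refine intervalIntegral.intervalIntegral_pos_of_pos_on
    ((by fun_prop : Continuous _).intervalIntegrable _ _) (fun τ hτ => ?_) h0
  have := Real.sin_pos_of_mem_Ioo ⟨hτ.1, hτ.2.trans_le hr⟩
  have := latConst_pos (d := d)
  positivity

theorem sin_mul_le {t x : ℝ} (ht : 1 ≤ t) (hx : 0 ≤ x) (htx : t * x ≤ Real.pi) :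
    Real.sin (t * x) ≤ t * Real.sin x := by
  have h : ConcaveOn ℝ (Icc 0 Real.pi) Real.sin := strictConcaveOn_sin_Icc.concaveOn
  have ht0 : 0 < t := by linarith
  have h1 := h.2 (show (0 : ℝ) ∈ Icc 0 Real.pi from ⟨le_rfl, Real.pi_pos.le⟩)
    (show t * x ∈ Icc 0 Real.pi from ⟨by positivity, htx⟩)
    (show 0 ≤ 1 - t⁻¹ by simpa using inv_le_one_of_one_le₀ ht)
    (show 0 ≤ t⁻¹ by positivity) (by ring)
  simp only [smul_eq_mul, Real.sin_zero, mul_zero, zero_add, inv_mul_cancel_left₀ ht0.ne'] at h1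
  rwa [inv_mul_le_iff₀ ht0] at h1

/-- Concavity gives sin (t x) ≤ t sin x, which is used in the density after scaling the variable.
The exact power t^d is what makes the dimension appear in `IsOpt.abs_deriv_maxR_le`. -/
theorem ballVol_mul_le {t r : ℝ} (ht : 1 ≤ t) (h0 : 0 ≤ r) (htr : t * r ≤ Real.pi) :
    ballVol d (t * r) ≤ t ^ d * ballVol d r := by
  have ht0 : 0 < t := by linarith
  have hrt : r ≤ t * r := le_mul_of_one_le_left h0 ht
  rw [ballVol_eq (by positivity) htr, ballVol_eq h0 (hrt.trans htr)]
  have e := intervalIntegral.mul_integral_comp_mul_left (a := 0) (b := r)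
    (f := fun τ => latConst d * Real.sin τ ^ (d - 1)) t
  rw [mul_zero] at e
  rw [← e, ← intervalIntegral.integral_const_mul, ← intervalIntegral.integral_const_mul]
  refine intervalIntegral.integral_mono_on h0
    ((by fun_prop : Continuous _).intervalIntegrable _ _)
    ((by fun_prop : Continuous _).intervalIntegrable _ _) fun x hx => ?_
  have hxp : t * x ≤ Real.pi := (mul_le_mul_of_nonneg_left hx.2 ht0.le).trans htr
  have h1 := sin_mul_le ht hx.1 hxp
  have h2 : 0 ≤ Real.sin (t * x) :=
    Real.sin_nonneg_of_nonneg_of_le_pi (mul_nonneg ht0.le hx.1) hxp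
  have := latConst_pos (d := d)
  have e2 : t ^ d = t * t ^ (d - 1) := by
    rw [← pow_succ', Nat.sub_add_cancel NeZero.one_le]
  calc t * (latConst d * Real.sin (t * x) ^ (d - 1))
      ≤ t * (latConst d * (t * Real.sin x) ^ (d - 1)) := by gcongr
    _ = t ^ d * (latConst d * Real.sin x ^ (d - 1)) := by rw [mul_pow, e2]; ring

theorem continuousOn_ballVol : ContinuousOn (ballVol d) (Icc 0 Real.pi) := by
  refine ContinuousOn.congr (f := fun r => ∫ τ in 0..r, latConst d * Real.sin τ ^ (d - 1)) ?_
    fun r hr => ballVol_eq hr.1 hr.2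
  exact (intervalIntegral.continuous_primitive
    (fun a b => (by fun_prop : Continuous _).intervalIntegrable _ _) _).continuousOn

/-- The density of the distance to any point is at most `latConst`, so thin shells have small
measure uniformly in center and radius. -/
theorem surf_annulus_le (ζ : Sph d) (a b : ℝ) :
    surf d {ξ | geoDist ζ ξ ∈ Icc a b} ≤ ENNReal.ofReal (latConst d * (b - a)) := by
  rw [surf_geoDist_preimage, surf_colat_preimage measurableSet_Icc]
  have hL := latConst_pos (d := d)
  calc _ ≤ ∫⁻ τ in Ioo 0 Real.pi ∩ Icc a b, ENNReal.ofReal (latConst d) := by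
        refine lintegral_mono fun τ => ENNReal.ofReal_le_ofReal ?_
        refine mul_le_of_le_one_right hL.le ?_
        refine (le_abs_self _).trans ?_
        rw [abs_pow]
        exact pow_le_one₀ (abs_nonneg _) (Real.abs_sin_le_one τ)
    _ ≤ ENNReal.ofReal (latConst d) * volume (Icc a b) := by
        rw [setLIntegral_const]
        gcongr
        exact inter_subset_right
    _ = _ := by rw [Real.volume_Icc, ← ENNReal.ofReal_mul hL.le]

theorem surf_sphere_eq_zero (ζ : Sph d) (r : ℝ) : surf d {ξ | geoDist ζ ξ = r} = 0 := by
  have := surf_annulus_le ζ r r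
  simpa using this

end Balls

end PolarSphere

end

/-! ### Ball integrals and fractional averages of a profile. -/

noncomputable section

namespace PolarSphere

variable {d : ℕ} [NeZero d] {β : ℝ}

/-- Integral over the ball with center `mer θ` of the polar function with profile `v`. -/
def ballInt (d : ℕ) [NeZero d] (v : ℝ → ℝ) (θ r : ℝ) : ℝ :=
  ∫ ξ in geoBall (mer θ : Sph d) r, v (colat ξ) ∂(surf d)

/-- The derivative of `ballInt` in `θ`. -/
def ballSlope (d : ℕ) [NeZero d] (h : ℝ → ℝ) (θ r : ℝ) : ℝ :=
  ∫ ξ in geoBall (mer θ : Sph d) r, angColat 0 1 ξ • h (colat ξ) ∂(surf d)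

/-- The normalizing factor `r^β / σ(B_r)`. -/
def coef (d : ℕ) (β r : ℝ) : ℝ := r ^ β / ballVol d r

/-- The fractional average of the polar function with profile `v`. -/
def avg (d : ℕ) [NeZero d] (β : ℝ) (v : ℝ → ℝ) (θ r : ℝ) : ℝ := coef d β r * ballInt d v θ r

section BallInt

variable {v h k : ℝ → ℝ} {θ r : ℝ}

theorem geoBall_mer (θ r : ℝ) : geoBall (mer θ : Sph d) r =
    sphMap (rot zero_ne_one_fin (-θ)) ⁻¹' geoBall (northPole d) r := by
  have : northPole d = sphMap (rot zero_ne_one_fin (-θ)) (mer θ) := by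
    rw [sphMap_rot_mer, neg_add_cancel, mer_zero]
  rw [this, sphMap_preimage_geoBall]

theorem setIntegral_geoBall_mer {E : Type*} [NormedAddCommGroup E] [NormedSpace ℝ E]
    (g : Sph d → E) (θ r : ℝ) : ∫ ξ in geoBall (mer θ : Sph d) r, g ξ ∂(surf d) =
    ∫ ξ, (geoBall (northPole d) r).indicator (1 : Sph d → ℝ)
      (sphMap (rot zero_ne_one_fin (-θ)) ξ) • g ξ ∂(surf d) := by
  rw [← integral_indicator (measurableSet_geoBall _ _), geoBall_mer]
  refine integral_congr_ae (Eventually.of_forall fun ξ => ?_)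
  by_cases hξ : sphMap (rot zero_ne_one_fin (-θ)) ξ ∈ geoBall (northPole d) r
  · simp [hξ]
  · simp [hξ]

theorem measurable_indicator_geoBall (ζ : Sph d) (r : ℝ) :
    Measurable ((geoBall ζ r).indicator (1 : Sph d → ℝ)) :=
  measurable_one.indicator (measurableSet_geoBall _ _)

theorem abs_indicator_one_le {α : Type*} (s : Set α) (x : α) :
    |s.indicator (1 : α → ℝ) x| ≤ 1 := by
  by_cases h : x ∈ s <;> simp [h]

theorem Profile.integrable_angColat_smul (hv : Profile d v h) :
    Integrable (fun ξ : Sph d => angColat 0 1 ξ • h (colat ξ)) (surf d) :=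
  integrable_bdd_smul (measurable_angColat _ _) (abs_angColat_le zero_ne_one_fin) hv.integrable

theorem Profile.continuous_ballSlope (hv : Profile d v h) (r : ℝ) :
    Continuous fun θ => ballSlope d h θ r := by
  simp only [ballSlope, setIntegral_geoBall_mer]
  exact continuous_integral_rot _ (measurable_indicator_geoBall _ _) (abs_indicator_one_le _)
    hv.integrable_angColat_smul

/-- The flow identity with Ψ the indicator of a ball around the pole, whose rotates are the balls
centered on the meridian. This is why `FlowDeriv` admits measurable Ψ. -/
theorem Profile.ballInt_eq (hv : Profile d v h) (θ r : ℝ) :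
    ballInt d v θ r = ballInt d v 0 r + ∫ τ in 0..θ, ballSlope d h τ r := by
  have e := hv.flowDeriv (zero_ne_one_fin (d := d)) _ (measurable_indicator_geoBall (northPole d) r)
    (abs_indicator_one_le _) θ
  simp only [ballInt, ballSlope, setIntegral_geoBall_mer]
  rw [← e]
  simp [sphMap_rot_zero]

theorem Profile.hasDerivAt_ballInt (hv : Profile d v h) (θ r : ℝ) :
    HasDerivAt (fun θ => ballInt d v θ r) (ballSlope d h θ r) θ := by
  rw [funext fun θ => hv.ballInt_eq θ r]
  exact ((hv.continuous_ballSlope r).integral_hasStrictDerivAt 0 θ).hasDerivAt.const_add _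

theorem Profile.ballInt_sub (hv : Profile d v h) (a b r : ℝ) :
    ballInt d v b r - ballInt d v a r = ∫ τ in a..b, ballSlope d h τ r := by
  rw [hv.ballInt_eq a, hv.ballInt_eq b, add_sub_add_left_eq_sub,
    intervalIntegral.integral_interval_sub_left] <;>
  exact (hv.continuous_ballSlope r).intervalIntegrable _ _

theorem abs_ballSlope_le
    (hki : Integrable (fun ξ : Sph d => k (colat ξ)) (surf d))
    (hk : ∀ᵐ τ, τ ∈ Ioo 0 Real.pi → |h τ| ≤ k τ) (θ r : ℝ) :
    |ballSlope d h θ r| ≤ ∫ ξ in geoBall (mer θ : Sph d) r, k (colat ξ) ∂(surf d) := by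
  refine norm_integral_le_of_norm_le (f := fun ξ : Sph d => angColat 0 1 ξ • h (colat ξ))
    hki.integrableOn (ae_restrict_of_ae ?_)
  filter_upwards [ae_colat_of_ae hk] with ξ hξ
  rw [norm_smul]
  exact (mul_le_of_le_one_left (norm_nonneg _) (abs_angColat_le zero_ne_one_fin ξ)).trans hξ.2

theorem abs_ballSlope_le_total
    (hki : Integrable (fun ξ : Sph d => k (colat ξ)) (surf d))
    (hk : ∀ᵐ τ, τ ∈ Ioo 0 Real.pi → |h τ| ≤ k τ) (θ r : ℝ) :
    |ballSlope d h θ r| ≤ ∫ ξ : Sph d, k (colat ξ) ∂(surf d) := by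
  refine (abs_ballSlope_le hki hk θ r).trans (setIntegral_le_integral hki ?_)
  filter_upwards [ae_colat_of_ae hk] with ξ hξ using (abs_nonneg _).trans hξ.2

/-- Geodesic spheres are null sets, so the indicators of the balls converge almost everywhere as the
radius varies. -/
theorem continuous_ballInt_radius (hv : Integrable (fun ξ : Sph d => v (colat ξ)) (surf d))
    (θ : ℝ) : Continuous fun r => ballInt d v θ r := by
  have e : ∀ r, ballInt d v θ r =
      ∫ ξ : Sph d, (geoBall (mer θ) r).indicator (fun ξ => v (colat ξ)) ξ ∂(surf d) := fun r =>
    (integral_indicator (measurableSet_geoBall _ _)).symm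
  rw [funext e, continuous_iff_continuousAt]
  intro r
  refine continuousAt_of_dominated (bound := fun ξ : Sph d => ‖v (colat ξ)‖)
    (Eventually.of_forall fun s => hv.aestronglyMeasurable.indicator (measurableSet_geoBall _ _))
    (Eventually.of_forall fun s => Eventually.of_forall fun ξ => norm_indicator_le_norm_self _ _)
    hv.norm ?_
  have : ∀ᵐ ξ ∂(surf d), geoDist (mer θ) ξ ≠ r := by
    rw [ae_iff]; simpa using surf_sphere_eq_zero (mer θ : Sph d) r
  filter_upwards [this] with ξ hξ
  rcases lt_or_gt_of_ne hξ with h1 | h1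
  · refine continuousAt_const (y := v (colat ξ)) |>.congr ?_
    filter_upwards [lt_mem_nhds h1] with s hs
    exact (indicator_of_mem (show ξ ∈ geoBall (mer θ) s from hs) fun ξ => v (colat ξ)).symm
  · refine continuousAt_const (y := (0 : ℝ)) |>.congr ?_
    filter_upwards [gt_mem_nhds h1] with s hs
    exact (indicator_of_notMem (fun h : ξ ∈ geoBall (mer θ) s => lt_asymm hs h)
      fun ξ => v (colat ξ)).symm

theorem ballInt_pi (v : ℝ → ℝ) (θ : ℝ) :
    ballInt d v θ Real.pi = ∫ ξ : Sph d, v (colat ξ) ∂(surf d) := by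
  rw [ballInt, ← setIntegral_univ (μ := surf d) (f := fun ξ : Sph d => v (colat ξ))]
  refine setIntegral_congr_set (μ := surf d) (f := fun ξ : Sph d => v (colat ξ)) ?_
  have : ∀ᵐ ξ ∂(surf d), geoDist (mer θ) ξ ≠ Real.pi := by
    rw [ae_iff]; simpa using surf_sphere_eq_zero (mer θ : Sph d) Real.pi
  filter_upwards [this] with ξ hξ
  exact propext ⟨fun _ => trivial, fun _ => lt_of_le_of_ne (geoDist_le_pi _ _) hξ⟩

theorem ballInt_nonneg (hv : ∀ τ, 0 ≤ v τ) (θ r : ℝ) : 0 ≤ ballInt d v θ r :=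
  integral_nonneg (f := fun ξ : Sph d => v (colat ξ)) fun _ => hv _

theorem ballInt_le_mul {V : ℝ} (hvi : Integrable (fun ξ : Sph d => v (colat ξ)) (surf d))
    (hθ : θ ∈ Icc 0 Real.pi)
    (hV : ∀ τ ∈ Ioo 0 Real.pi, |τ - θ| < r → v τ ≤ V) :
    ballInt d v θ r ≤ ballVol d r * V := by
  have h1 : ∫ ξ in geoBall (mer θ : Sph d) r, V ∂(surf d) = ballVol d r * V := by
    rw [setIntegral_const, smul_eq_mul, Measure.real, surf_geoBall,
      ENNReal.toReal_ofReal (show 0 ≤ ballVol d r from measureReal_nonneg)]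
  rw [← h1]
  refine setIntegral_mono_on_ae hvi.integrableOn (integrable_const _).integrableOn
    (measurableSet_geoBall _ _) ?_
  filter_upwards [ae_colat_mem] with ξ hξ hm
  refine hV _ hξ ?_
  have h2 := abs_colat_sub_le (mer θ) ξ
  rw [colat_mer hθ, abs_sub_comm] at h2
  exact h2.trans_lt hm

end BallInt

section Coef

theorem coef_pos {r : ℝ} (h0 : 0 < r) (hr : r ≤ Real.pi) : 0 < coef d β r :=
  div_pos (Real.rpow_pos_of_pos h0 _) (ballVol_pos h0 hr)

theorem coef_le (hβ : 0 ≤ β) {r₀ r : ℝ} (h0 : 0 < r₀) (hr : r₀ ≤ r) (hrp : r ≤ Real.pi) :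
    coef d β r ≤ Real.pi ^ β / ballVol d r₀ := by
  have := ballVol_pos (d := d) h0 (hr.trans hrp)
  have h1 := ballVol_mono (d := d) hr
  have h2 : 0 ≤ r := h0.le.trans hr
  unfold coef
  gcongr

theorem coef_le_mul (hβ : 0 ≤ β) {t r : ℝ} (ht : 1 ≤ t) (h0 : 0 < r) (htr : t * r ≤ Real.pi) :
    coef d β r ≤ t ^ d * coef d β (t * r) := by
  have hrt : r ≤ t * r := le_mul_of_one_le_left h0.le ht
  have h1 := ballVol_pos (d := d) h0 (hrt.trans htr)
  have h2 := ballVol_pos (d := d) (h0.trans_le hrt) htr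
  have h3 := ballVol_mul_le (d := d) ht h0.le htr
  have h4 : r ^ β ≤ (t * r) ^ β := Real.rpow_le_rpow h0.le hrt hβ
  have h5 : 0 ≤ r ^ β := Real.rpow_nonneg h0.le _
  unfold coef
  rw [← mul_div_assoc, div_le_div_iff₀ h1 h2]
  calc r ^ β * ballVol d (t * r) ≤ (t * r) ^ β * (t ^ d * ballVol d r) := by gcongr
    _ = _ := by ring

theorem continuousOn_coef (hβ : 0 ≤ β) : ContinuousOn (coef d β) (Ioc 0 Real.pi) := by
  refine ContinuousOn.div ?_ (continuousOn_ballVol.mono Ioc_subset_Icc_self)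
    fun r hr => (ballVol_pos hr.1 hr.2).ne'
  exact (Real.continuous_rpow_const hβ).continuousOn

end Coef

section Avg

variable {v h k : ℝ → ℝ} {θ r : ℝ}

theorem avg_nonneg (hv : ∀ τ, 0 ≤ v τ) (θ : ℝ) (hr : r ∈ Ioc 0 Real.pi) : 0 ≤ avg d β v θ r :=
  mul_nonneg (coef_pos hr.1 hr.2).le (ballInt_nonneg hv _ _)

theorem continuousOn_avg_radius (hβ : 0 ≤ β)
    (hv : Integrable (fun ξ : Sph d => v (colat ξ)) (surf d)) (θ : ℝ) :
    ContinuousOn (avg d β v θ) (Ioc 0 Real.pi) :=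
  (continuousOn_coef hβ).mul (continuous_ballInt_radius hv θ).continuousOn

theorem Profile.hasDerivAt_avg (hv : Profile d v h) (θ r : ℝ) :
    HasDerivAt (fun θ => avg d β v θ r) (coef d β r * ballSlope d h θ r) θ :=
  (hv.hasDerivAt_ballInt θ r).const_mul _

theorem avg_le_rpow_mul {V : ℝ} (hvi : Integrable (fun ξ : Sph d => v (colat ξ)) (surf d))
    (hθ : θ ∈ Icc 0 Real.pi) (hr : r ∈ Ioc 0 Real.pi)
    (hV : ∀ τ ∈ Ioo 0 Real.pi, |τ - θ| < r → v τ ≤ V) : avg d β v θ r ≤ r ^ β * V := by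
  refine (mul_le_mul_of_nonneg_left (ballInt_le_mul hvi hθ hV) (coef_pos hr.1 hr.2).le).trans_eq ?_
  have := (ballVol_pos (d := d) hr.1 hr.2).ne'
  rw [coef]; field_simp

/-- Radii below a threshold do not compete with the whole sphere. -/
theorem exists_radius_threshold (d : ℕ) [NeZero d] (hβ : 0 < β) {δ m : ℝ} (V : ℝ) (hδ : 0 < δ)
    (hδ' : δ ≤ Real.pi) (hm : 0 < m) :
    ∃ r₀, 0 < r₀ ∧ r₀ < δ ∧ ∀ v : ℝ → ℝ, (∀ τ, 0 ≤ v τ) →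
      Integrable (fun ξ : Sph d => v (colat ξ)) (surf d) →
      (∀ τ ∈ Icc (δ / 2) (Real.pi - δ / 2), v τ ≤ V) → m ≤ ∫ ξ : Sph d, v (colat ξ) ∂(surf d) →
      ∀ θ ∈ Icc δ (Real.pi - δ), ∀ r ∈ Ioc 0 r₀, avg d β v θ r < avg d β v θ Real.pi := by
  have hc := coef_pos (d := d) (β := β) Real.pi_pos le_rfl
  -- With radius below δ/2 the ball stays in the band where v ≤ V, so its fractional average is at
  -- most r^β max(V, 0). The radius π already yields `coef` · m, independently of r. The maximum
  -- with 0 makes the bound monotone in r.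
  have h1 : Tendsto (fun r : ℝ => r ^ β * max V 0) (𝓝[>] 0) (𝓝 (0 ^ β * max V 0)) :=
    (((Real.continuous_rpow_const hβ.le).tendsto 0).mono_left nhdsWithin_le_nhds).mul_const _
  rw [Real.zero_rpow hβ.ne', zero_mul] at h1
  have h2 := h1.eventually (gt_mem_nhds (show 0 < coef d β Real.pi * m by positivity))
  obtain ⟨r₀, h3, h4⟩ := (h2.and (Ioo_mem_nhdsGT (show 0 < δ / 2 by positivity))).exists
  have h5 : r₀ < δ / 2 := h4.2
  refine ⟨r₀, h4.1, by linarith, fun v hv hvi hV hmv θ hθ r hr => ?_⟩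
  have h6 : r < δ / 2 := hr.2.trans_lt h5
  have hθ' : θ ∈ Icc 0 Real.pi := ⟨hδ.le.trans hθ.1, hθ.2.trans (by linarith)⟩
  calc avg d β v θ r ≤ r ^ β * max V 0 :=
        avg_le_rpow_mul hvi hθ' ⟨hr.1, by linarith⟩ fun τ _ hτ' => by
          rw [abs_lt] at hτ'
          exact le_max_of_le_left (hV τ ⟨by linarith [hθ.1], by linarith [hθ.2]⟩)
    _ ≤ r₀ ^ β * max V 0 := by
        gcongr
        · exact hr.1.le
        · exact hr.2
    _ < coef d β Real.pi * m := h3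
    _ ≤ avg d β v θ Real.pi := by
        rw [avg, ballInt_pi]
        gcongr

end Avg

end PolarSphere

end

/-! ### Optimal radii and the derivative of the maximal function. -/

noncomputable section

namespace PolarSphere

/-- If `u` is bounded below near `θ` by a line up to an error `η |s|`, then its derivative
differs from the slope of that line by at most `η`. -/
theorem abs_deriv_sub_le {u : ℝ → ℝ} {θ p η : ℝ} (hu : DifferentiableAt ℝ u θ)
    (h : ∀ᶠ s in 𝓝 0, u θ + p * s - η * |s| ≤ u (θ + s)) : |deriv u θ - p| ≤ η := by
  have ht := hasDerivAt_iff_tendsto_slope_zero.1 hu.hasDerivAt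
  rw [abs_le]
  constructor
  · have h1 : p - η ≤ deriv u θ := by
      refine ge_of_tendsto (ht.mono_left (nhdsGT_le_nhdsNE 0)) ?_
      filter_upwards [self_mem_nhdsWithin, nhdsWithin_le_nhds h] with s (hs : 0 < s) h2
      rw [abs_of_pos hs] at h2
      rw [smul_eq_mul, inv_mul_eq_div, le_div_iff₀ hs]
      linarith
    linarith
  · have h1 : deriv u θ ≤ p + η := by
      refine le_of_tendsto (ht.mono_left (nhdsLT_le_nhdsNE 0)) ?_
      filter_upwards [self_mem_nhdsWithin, nhdsWithin_le_nhds h] with s (hs : s < 0) h2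
      rw [abs_of_neg hs] at h2
      rw [smul_eq_mul, inv_mul_eq_div, div_le_iff_of_neg hs]
      linarith
    linarith

/-- Bernoulli's inequality for (1 - x)^d; it linearizes the loss (1 + x)^(-d) caused by enlarging a
ball. -/
theorem one_sub_mul_mul_one_add_pow_le (d : ℕ) {x : ℝ} (h0 : 0 ≤ x) (h1 : x ≤ 1) :
    (1 - d * x) * (1 + x) ^ d ≤ 1 := by
  have hb : 1 + (d : ℝ) * (-x) ≤ (1 + -x) ^ d := one_add_mul_le_pow (by linarith) d
  calc (1 - d * x) * (1 + x) ^ d ≤ (1 + -x) ^ d * (1 + x) ^ d := by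
        gcongr
        linarith
    _ = (1 - x ^ 2) ^ d := by rw [← mul_pow]; ring
    _ ≤ 1 := pow_le_one₀ (by nlinarith) (by nlinarith)

variable {d : ℕ} [NeZero d] {β : ℝ}

/-- The radius `r` realizes the maximal function at `θ`. -/
def IsOpt (d : ℕ) [NeZero d] (β : ℝ) (v : ℝ → ℝ) (θ r : ℝ) : Prop :=
  r ∈ Ioc 0 Real.pi ∧ ∀ r' ∈ Ioc 0 Real.pi, avg d β v θ r' ≤ avg d β v θ r

/-- The maximal function over radii at least `ρ` of the polar function with profile `v`. -/
def maxFrom (d : ℕ) [NeZero d] (β : ℝ) (v : ℝ → ℝ) (ρ θ : ℝ) : ℝ≥0∞ :=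
  ⨆ r ∈ Ioc 0 Real.pi ∩ Ici ρ, ENNReal.ofReal (avg d β v θ r)

/-- The maximal function of the polar function with profile `v`. -/
def maxFn (d : ℕ) [NeZero d] (β : ℝ) (v : ℝ → ℝ) (θ : ℝ) : ℝ≥0∞ :=
  ⨆ r ∈ Ioc 0 Real.pi, ENNReal.ofReal (avg d β v θ r)

/-- The real valued maximal function of the polar function with profile `v`. -/
def maxR (d : ℕ) [NeZero d] (β : ℝ) (v : ℝ → ℝ) (θ : ℝ) : ℝ := (maxFn d β v θ).toReal

section Opt

variable {v h k : ℝ → ℝ} {θ r : ℝ}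

theorem IsOpt.maxFn_eq (ho : IsOpt d β v θ r) :
    maxFn d β v θ = ENNReal.ofReal (avg d β v θ r) :=
  le_antisymm (iSup₂_le fun r' hr' => ENNReal.ofReal_le_ofReal (ho.2 r' hr'))
    (le_iSup₂ (f := fun r _ => ENNReal.ofReal (avg d β v θ r)) r ho.1)

theorem IsOpt.maxR_eq (ho : IsOpt d β v θ r) (hv : ∀ τ, 0 ≤ v τ) :
    maxR d β v θ = avg d β v θ r := by
  rw [maxR, ho.maxFn_eq, ENNReal.toReal_ofReal (avg_nonneg hv θ ho.1)]

theorem IsOpt.avg_le (ho : IsOpt d β v θ r) (hv : ∀ τ, 0 ≤ v τ) {r' : ℝ}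
    (hr' : r' ∈ Ioc 0 Real.pi) : avg d β v θ r' ≤ maxR d β v θ := by
  rw [ho.maxR_eq hv]; exact ho.2 r' hr'

theorem exists_isOpt (hβ : 0 ≤ β) (hvi : Integrable (fun ξ : Sph d => v (colat ξ)) (surf d))
    {r₀ : ℝ} (h0 : 0 < r₀) (hr₀ : r₀ ≤ Real.pi)
    (h : ∀ r ∈ Ioc 0 r₀, avg d β v θ r ≤ avg d β v θ Real.pi) : ∃ r, IsOpt d β v θ r := by
  obtain ⟨r, hr, hm⟩ := isCompact_Icc.exists_isMaxOn ⟨Real.pi, hr₀, le_rfl⟩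
    ((continuousOn_avg_radius hβ hvi θ).mono fun r hr => ⟨h0.trans_le hr.1, hr.2⟩)
  refine ⟨r, ⟨h0.trans_le hr.1, hr.2⟩, fun r' hr' => ?_⟩
  rcases le_total r' r₀ with h1 | h1
  · exact (h r' ⟨hr'.1, h1⟩).trans (hm ⟨hr₀, le_rfl⟩)
  · exact hm ⟨h1, hr'.2⟩

theorem IsOpt.lt_radius {r₀ : ℝ} (ho : IsOpt d β v θ r)
    (h : ∀ r ∈ Ioc 0 r₀, avg d β v θ r < avg d β v θ Real.pi) : r₀ < r := by
  by_contra h1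
  exact absurd (ho.2 Real.pi ⟨Real.pi_pos, le_rfl⟩) (not_le.2 (h r ⟨ho.1.1, not_lt.1 h1⟩))

/-- The radius optimal at θ competes at θ', so the difference is at most that of the two averages
with this radius, and a frozen radius gives Lipschitz dependence on the center. -/
theorem Profile.maxR_sub_le (hβ : 0 ≤ β) (hv : Profile d v h) (hv0 : ∀ τ, 0 ≤ v τ)
    (hki : Integrable (fun ξ : Sph d => k (colat ξ)) (surf d))
    (hk : ∀ᵐ τ, τ ∈ Ioo 0 Real.pi → |h τ| ≤ k τ) {θ' r' r₀ : ℝ} (h0 : 0 < r₀)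
    (ho : IsOpt d β v θ r) (hr : r₀ ≤ r) (ho' : IsOpt d β v θ' r') :
    maxR d β v θ - maxR d β v θ' ≤
      Real.pi ^ β / ballVol d r₀ * (∫ ξ : Sph d, k (colat ξ) ∂(surf d)) * |θ - θ'| := by
  have hc := coef_pos (d := d) (β := β) ho.1.1 ho.1.2
  calc maxR d β v θ - maxR d β v θ' ≤ avg d β v θ r - avg d β v θ' r := by
        rw [ho.maxR_eq hv0]; linarith [ho'.avg_le hv0 ho.1]
    _ = coef d β r * ∫ τ in θ'..θ, ballSlope d h τ r := by
        rw [avg, avg, ← mul_sub, hv.ballInt_sub]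
    _ ≤ coef d β r * ((∫ ξ : Sph d, k (colat ξ) ∂(surf d)) * |θ - θ'|) := by
        gcongr
        have := intervalIntegral.norm_integral_le_of_norm_le_const (a := θ') (b := θ)
          (f := fun τ => ballSlope d h τ r) fun τ _ => abs_ballSlope_le_total hki hk τ r
        exact (le_abs_self _).trans this
    _ ≤ _ := by
        rw [← mul_assoc]
        have h1 := (abs_nonneg _).trans (abs_ballSlope_le_total hki hk 0 r)
        gcongr
        exact coef_le hβ h0 hr ho.1.2

/-- The maximal function minus the average with frozen radius r is nonnegative near θ and vanishes
at θ, so its derivative there is 0, whichever optimal radius is frozen. -/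
theorem Profile.deriv_maxR (hv : Profile d v h) (hv0 : ∀ τ, 0 ≤ v τ) (ho : IsOpt d β v θ r)
    (hex : ∀ᶠ θ' in 𝓝 θ, ∃ r', IsOpt d β v θ' r') (hd : DifferentiableAt ℝ (maxR d β v) θ) :
    deriv (maxR d β v) θ = coef d β r * ballSlope d h θ r := by
  have hm : IsLocalMin (fun θ' => maxR d β v θ' - avg d β v θ' r) θ := by
    filter_upwards [hex] with θ' ⟨r', ho'⟩
    rw [ho.maxR_eq hv0, sub_self, sub_nonneg]
    exact ho'.avg_le hv0 ho.1
  exact sub_eq_zero.1 (hm.hasDerivAt_eq_zero (hd.hasDerivAt.sub (hv.hasDerivAt_avg θ r)))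

theorem geoBall_mer_subset {θ θ' r r' : ℝ} (h : |θ - θ'| + r ≤ r') (hp : |θ - θ'| ≤ Real.pi) :
    geoBall (mer θ : Sph d) r ⊆ geoBall (mer θ') r' := by
  intro ξ hξ
  have h1 := geoDist_triangle (mer θ' : Sph d) (mer θ) ξ
  rw [geoDist_comm (mer θ') (mer θ), geoDist_mer hp] at h1
  exact h1.trans_lt (lt_of_lt_of_le (by linarith [show geoDist (mer θ) ξ < r from hξ]) h)

theorem ballInt_mono (hvi : Integrable (fun ξ : Sph d => v (colat ξ)) (surf d))
    (hv0 : ∀ τ, 0 ≤ v τ) {θ' r' : ℝ} (h : |θ - θ'| + r ≤ r') (hp : |θ - θ'| ≤ Real.pi) :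
    ballInt d v θ r ≤ ballInt d v θ' r' :=
  setIntegral_mono_set hvi.integrableOn (Eventually.of_forall fun _ => hv0 _)
    (geoBall_mer_subset h hp).eventuallyLE

/-- Comparison of maximal functions at different points. -/
theorem IsOpt.maxR_le_mul (hβ : 0 ≤ β)
    (hvi : Integrable (fun ξ : Sph d => v (colat ξ)) (surf d)) (hv0 : ∀ τ, 0 ≤ v τ)
    (ho : IsOpt d β v θ r) {θ' r' t : ℝ} (ho' : IsOpt d β v θ' r') (ht : 1 ≤ t)
    (htr : t * r ≤ Real.pi) (h : |θ - θ'| + r ≤ t * r) :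
    maxR d β v θ ≤ t ^ d * maxR d β v θ' := by
  have hr0 := ho.1.1
  have hrt : r ≤ t * r := le_mul_of_one_le_left hr0.le ht
  have hc := coef_pos (d := d) (β := β) ho.1.1 ho.1.2
  have hct := coef_pos (d := d) (β := β) (hr0.trans_le hrt) htr
  calc maxR d β v θ = coef d β r * ballInt d v θ r := ho.maxR_eq hv0
    _ ≤ (t ^ d * coef d β (t * r)) * ballInt d v θ' (t * r) := by
        have := ballInt_mono hvi hv0 h (by linarith)
        have := ballInt_nonneg (d := d) hv0 θ r
        have := coef_le_mul (d := d) hβ ht hr0 htr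
        gcongr
    _ = t ^ d * avg d β v θ' (t * r) := by rw [avg, mul_assoc]
    _ ≤ _ := by
        gcongr
        exact ho'.avg_le hv0 ⟨hr0.trans_le hrt, htr⟩

/-- A shift of the center by s is absorbed by the radius r + |s|, at the cost of a factor (1 +
|s|/r)^d; this needs room below π. The bound uses no derivative of v and is the one suited to small
radii. -/
theorem IsOpt.abs_deriv_maxR_le (hβ : 0 ≤ β)
    (hvi : Integrable (fun ξ : Sph d => v (colat ξ)) (surf d)) (hv0 : ∀ τ, 0 ≤ v τ)
    (ho : IsOpt d β v θ r) (hr : r < Real.pi)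
    (hex : ∀ᶠ θ' in 𝓝 θ, ∃ r', IsOpt d β v θ' r') (hd : DifferentiableAt ℝ (maxR d β v) θ) :
    |deriv (maxR d β v) θ| ≤ d * (maxR d β v θ / r) := by
  have hr0 := ho.1.1
  have hu0 : 0 ≤ maxR d β v θ := ENNReal.toReal_nonneg
  rw [← sub_zero (deriv _ _)]
  refine abs_deriv_sub_le hd ?_
  have e1 : ∀ᶠ s in 𝓝 (0 : ℝ), ∃ r', IsOpt d β v (θ + s) r' := by
    have : Tendsto (fun s => θ + s) (𝓝 0) (𝓝 θ) := by
      simpa using (by fun_prop : Continuous fun s : ℝ => θ + s).tendsto 0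
    exact this.eventually hex
  have e2 : ∀ᶠ s in 𝓝 (0 : ℝ), |s| < min r (Real.pi - r) := by
    have : Tendsto (fun s : ℝ => |s|) (𝓝 0) (𝓝 0) := by simpa using continuous_abs.tendsto (0 : ℝ)
    exact this.eventually (gt_mem_nhds (lt_min hr0 (sub_pos.2 hr)))
  filter_upwards [e1, e2] with s ⟨r', ho'⟩ hs
  have h1 : |s| < r := hs.trans_le (min_le_left _ _)
  have h2 : |s| < Real.pi - r := hs.trans_le (min_le_right _ _)
  have hx0 : 0 ≤ |s| / r := by positivity
  have hx1 : |s| / r ≤ 1 := (div_le_one hr0).2 h1.le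
  have e3 : (1 + |s| / r) * r = r + |s| := by field_simp
  have h3 := ho.maxR_le_mul (t := 1 + |s| / r) hβ hvi hv0 ho' (by linarith) (by rw [e3]; linarith)
    (by rw [e3, sub_add_cancel_left, abs_neg, add_comm])
  have h4 := one_sub_mul_mul_one_add_pow_le d hx0 hx1
  have hp : 0 < (1 + |s| / r) ^ d := by positivity
  have h5 : (1 - d * (|s| / r)) * maxR d β v θ ≤ maxR d β v (θ + s) := by
    refine le_of_mul_le_mul_left ?_ hp
    calc _ = ((1 - d * (|s| / r)) * (1 + |s| / r) ^ d) * maxR d β v θ := by ring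
      _ ≤ 1 * maxR d β v θ := by gcongr
      _ ≤ _ := by rw [one_mul]; exact h3
  refine le_trans (le_of_eq ?_) h5
  field_simp
  ring

end Opt

section Measurability

variable {v h : ℝ → ℝ}

/-- A supremum of continuous functions is lower semicontinuous, over any set of radii. -/
theorem Profile.measurable_iSup_avg (hv : Profile d v h) (S : Set ℝ) :
    Measurable fun θ => ⨆ r ∈ S, ENNReal.ofReal (avg d β v θ r) := by
  refine LowerSemicontinuous.measurable ?_
  refine lowerSemicontinuous_biSup fun r _ => ?_
  have : Continuous fun θ => avg d β v θ r :=
    continuous_iff_continuousAt.2 fun θ => (hv.hasDerivAt_avg θ r).continuousAt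
  exact (ENNReal.continuous_ofReal.comp this).lowerSemicontinuous

theorem Profile.measurable_maxFn (hv : Profile d v h) : Measurable (maxFn d β v) :=
  hv.measurable_iSup_avg _

theorem Profile.measurable_maxFrom (hv : Profile d v h) (ρ : ℝ) :
    Measurable (maxFrom d β v ρ) :=
  hv.measurable_iSup_avg _

end Measurability

section Link

/-- An isometry fixing the pole carries the center to the chosen meridian and preserves the
colatitude. -/
theorem setLIntegral_geoBall_polar (g : ℝ → ℝ≥0∞) (ξ : Sph d) (r : ℝ) :
    ∫⁻ η in geoBall ξ r, g (colat η) ∂(surf d) =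
      ∫⁻ η in geoBall (mer (colat ξ) : Sph d) r, g (colat η) ∂(surf d) := by
  have hc : colat (mer (colat ξ) : Sph d) = colat ξ := colat_mer ⟨colat_nonneg _, colat_le_pi _⟩
  obtain ⟨R, hR, hN⟩ := exists_sphMap_eq (mer (colat ξ)) ξ
  have e := (measurePreserving_sphMap R).setLIntegral_comp_preimage_emb
    (sphEquiv R).measurableEmbedding (fun η => g (colat η)) (geoBall ξ r)
  rw [← e]
  have h1 : sphMap R ⁻¹' geoBall ξ r = geoBall (mer (colat ξ)) r := by
    conv_lhs => rw [← hR]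
    exact sphMap_preimage_geoBall R _ r
  rw [h1]
  simp only [colat_sphMap R (hN hc)]

theorem fracAverage_eq {f : Sph d → ℂ} {F : ℝ → ℂ} (hf : f =ᵐ[surf d] fun ξ => F (colat ξ))
    (hi : Integrable (fun ξ : Sph d => F (colat ξ)) (surf d)) (ξ : Sph d) {r : ℝ}
    (hr : r ∈ Ioc 0 Real.pi) :
    fracAverage β f ξ r = ENNReal.ofReal (avg d β (fun τ => ‖F τ‖) (colat ξ) r) := by
  have h1 : ∫⁻ η in geoBall ξ r, ‖f η‖ₑ ∂(surf d) =
      ENNReal.ofReal (ballInt d (fun τ => ‖F τ‖) (colat ξ) r) := by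
    rw [ballInt, ofReal_integral_norm_eq_lintegral_enorm hi.integrableOn,
      ← setLIntegral_geoBall_polar fun τ => ‖F τ‖ₑ]
    refine lintegral_congr_ae (ae_restrict_of_ae ?_)
    filter_upwards [hf] with η hη
    rw [hη]
  rw [fracAverage, h1, surf_geoBall, avg, coef, ← ENNReal.ofReal_div_of_pos
    (ballVol_pos hr.1 hr.2), ENNReal.ofReal_mul]
  exact (coef_pos hr.1 hr.2).le

/-- The function enters only through integrals, so the equality holds at every point although the
profile is known only almost everywhere. -/
theorem fracMaximal_eq {f : Sph d → ℂ} {F : ℝ → ℂ} (hf : f =ᵐ[surf d] fun ξ => F (colat ξ))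
    (hi : Integrable (fun ξ : Sph d => F (colat ξ)) (surf d)) (ξ : Sph d) :
    fracMaximal β f ξ = maxFn d β (fun τ => ‖F τ‖) (colat ξ) := by
  unfold fracMaximal maxFn
  exact iSup_congr fun r => iSup_congr fun hr => fracAverage_eq hf hi ξ hr

end Link

end PolarSphere

end

/-! ### Local Lipschitz regularity and weak gradients off the poles. -/

noncomputable section

namespace PolarSphere

variable {d : ℕ}

theorem mem_offPoles_iff {ξ : Sph d} : ξ ∈ offPoles d ↔ colat ξ ∈ Ioo 0 Real.pi := by
  have n1 : ‖(northPole d : Ambient d)‖ = 1 := norm_eq_of_mem_sphere _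
  have n2 : ‖(ξ : Ambient d)‖ = 1 := norm_eq_of_mem_sphere _
  have h1 : inner ℝ (northPole d : Ambient d) (ξ : Ambient d) = 1 ↔ ξ = northPole d := by
    rw [inner_eq_one_iff_of_norm_eq_one n1 n2, ← Subtype.ext_iff, eq_comm]
  have h2 : inner ℝ (northPole d : Ambient d) (ξ : Ambient d) = -1 ↔ ξ = -northPole d := by
    rw [inner_eq_neg_one_iff_of_norm_eq_one n1 n2, eq_neg_iff_add_eq_zero, add_comm,
      ← eq_neg_iff_add_eq_zero, Subtype.ext_iff]
    rfl
  have h3 := abs_le.1 (abs_real_inner_le_norm (northPole d : Ambient d) (ξ : Ambient d))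
  rw [n1, n2, mul_one] at h3
  rw [colat, geoDist_eq_arccos, mem_Ioo, Real.arccos_pos, Real.arccos_lt_pi,
    h3.2.lt_iff_ne, h3.1.lt_iff_ne, ne_comm (a := (-1 : ℝ)), ne_eq, ne_eq, h1, h2]
  simp [offPoles]

/-- Only the restriction of φ to the sphere vanishes near ξ. The derivative is taken along an orbit
of rotations, which stays on the sphere. -/
theorem angularDeriv_eq_zero {φ : Ambient d → ℝ} (hφ : Differentiable ℝ φ) (i j : Fin (d + 1))
    {ξ : Sph d} (h : ξ ∉ tsupport fun ξ : Sph d => φ ξ) : angularDeriv i j φ ξ = 0 := by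
  rcases eq_or_ne i j with rfl | hij
  · exact angularDeriv_self i φ ξ
  have h1 := hasDerivAt_rot hij 0 (ξ : Ambient d)
  rw [rot_zero] at h1
  have h2 : HasFDerivAt φ (fderiv ℝ φ (ξ : Ambient d)) (rot hij 0 (ξ : Ambient d)) := by
    rw [rot_zero]; exact (hφ _).hasFDerivAt
  have h3 := h2.comp_hasDerivAt 0 h1
  have h4 : (φ ∘ fun s => rot hij s (ξ : Ambient d)) =ᶠ[𝓝 0] fun _ => 0 := by
    have h5 : ∀ᶠ s in 𝓝 0, sphMap (rot hij s) ξ ∉ tsupport fun ξ : Sph d => φ ξ := by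
      refine (continuous_orbit hij ξ).continuousAt.eventually_mem
        (s := (tsupport fun ξ : Sph d => φ ξ)ᶜ) ?_
      rw [sphMap_rot_zero]
      exact (isClosed_tsupport _).isOpen_compl.mem_nhds h
    filter_upwards [h5] with s hs
    exact image_eq_zero_of_notMem_tsupport (f := fun ξ : Sph d => φ ξ) hs
  exact h3.unique ((hasDerivAt_const (0 : ℝ) (0 : ℝ)).congr_of_eventuallyEq h4)

variable [NeZero d] {β : ℝ}

/-- A nonnegative profile `v` with derivative `h`, whose absolute value is dominated by `k`. -/
structure NonnegProfile (d : ℕ) (v h k : ℝ → ℝ) : Prop where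
  profile : Profile d v h
  nonneg : ∀ τ, 0 ≤ v τ
  integrable_bound : Integrable (fun ξ : Sph d => k (colat ξ)) (surf d)
  bound : ∀ᵐ τ, τ ∈ Ioo 0 Real.pi → |h τ| ≤ k τ
  meas_bound : StronglyMeasurable k
  bound_nonneg : ∀ τ, 0 ≤ k τ

theorem Profile.nonnegProfile {E : Type*} [NormedAddCommGroup E] [NormedSpace ℝ E]
    [CompleteSpace E] {F w : ℝ → E} (h : Profile d F w) :
    NonnegProfile d (fun τ => ‖F τ‖) (deriv fun τ => ‖F τ‖) fun τ => ‖w τ‖ where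
  profile := h.norm.1
  nonneg _ := norm_nonneg _
  integrable_bound := h.integrable.norm
  bound := h.norm.2.mono fun _ h hx => (h hx).2
  meas_bound := h.meas.norm
  bound_nonneg _ := norm_nonneg _

variable {v h k : ℝ → ℝ}

theorem NonnegProfile.integrable (H : NonnegProfile d v h k) :
    Integrable (fun ξ : Sph d => v (colat ξ)) (surf d) := H.profile.integrable_comp

theorem NonnegProfile.ae_bound (H : NonnegProfile d v h k) :
    ∀ᵐ ξ : Sph d ∂(surf d), |h (colat ξ)| ≤ k (colat ξ) :=
  (ae_colat_of_ae H.bound).mono fun _ h => h.2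

theorem NonnegProfile.intervalIntegrable_bound (H : NonnegProfile d v h k) {a b : ℝ}
    (ha : a ∈ Ioo 0 Real.pi) (hb : b ∈ Ioo 0 Real.pi) : IntervalIntegrable k volume a b :=
  intervalIntegrable_of_integrable_colat H.meas_bound H.integrable_bound ha hb

theorem NonnegProfile.abs_sub_le (H : NonnegProfile d v h k) {a b : ℝ}
    (ha : a ∈ Ioo 0 Real.pi) (hb : b ∈ Ioo 0 Real.pi) (hab : a ≤ b) :
    |v b - v a| ≤ ∫ t in a..b, k t := by
  rw [H.profile.sub_eq a ha b hb]
  refine intervalIntegral.norm_integral_le_of_norm_le (f := h) hab ?_ (H.intervalIntegrable_bound ha hb)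
  filter_upwards [H.bound] with t ht hm using ht ⟨ha.1.trans hm.1, hm.2.trans_lt hb.2⟩

theorem NonnegProfile.integral_abs_le (H : NonnegProfile d v h k) :
    ∫ ξ : Sph d, |h (colat ξ)| ∂(surf d) ≤ ∫ ξ : Sph d, k (colat ξ) ∂(surf d) :=
  integral_mono_ae H.profile.integrable.abs H.integrable_bound H.ae_bound

theorem NonnegProfile.integral_bound_nonneg (H : NonnegProfile d v h k) :
    0 ≤ ∫ ξ : Sph d, k (colat ξ) ∂(surf d) :=
  MeasureTheory.integral_nonneg (f := fun ξ : Sph d => k (colat ξ)) fun _ => H.bound_nonneg _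

theorem NonnegProfile.integral_nonneg (H : NonnegProfile d v h k) :
    0 ≤ ∫ ξ : Sph d, v (colat ξ) ∂(surf d) :=
  MeasureTheory.integral_nonneg (f := fun ξ : Sph d => v (colat ξ)) fun _ => H.nonneg _

theorem surf_real_univ_pos : 0 < (surf d).real univ := by
  have h1 := ballVol_pos (d := d) Real.pi_pos le_rfl
  exact h1.trans_le (measureReal_mono (subset_univ _))

/-- Away from the poles a profile is bounded by its Sobolev norm. -/
theorem exists_sup_bound (d : ℕ) [NeZero d] {δ : ℝ} (hδ : 0 < δ) (hδ' : δ ≤ Real.pi) :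
    ∃ C, 0 ≤ C ∧ ∀ v h k : ℝ → ℝ, NonnegProfile d v h k →
      ∀ τ ∈ Icc (δ / 2) (Real.pi - δ / 2), v τ ≤
        C * ((∫ ξ : Sph d, v (colat ξ) ∂(surf d)) + ∫ ξ : Sph d, k (colat ξ) ∂(surf d)) := by
  set c := Real.sin (δ / 2) with hc
  have hc0 : 0 < c := Real.sin_pos_of_mem_Ioo ⟨by positivity, by linarith⟩
  have hL := latConst_pos (d := d)
  have hS := surf_real_univ_pos (d := d)
  have hpi := Real.pi_pos
  refine ⟨(1 + Real.pi) / (surf d).real univ + (latConst d * c ^ (d - 1))⁻¹, by positivity,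
    fun v h k H τ hτ => ?_⟩
  set I := ∫ ξ : Sph d, v (colat ξ) ∂(surf d) with hI
  set K := ∫ ξ : Sph d, k (colat ξ) ∂(surf d) with hK
  have hI0 : 0 ≤ I := H.integral_nonneg
  have hK0 : 0 ≤ K := H.integral_bound_nonneg
  have hτ' : τ ∈ Ioo 0 Real.pi := ⟨by linarith [hτ.1], by linarith [hτ.2]⟩
  have hsin : c ≤ Real.sin τ := by
    have := sin_ge_of_mem_uIcc (a := δ / 2) (b := Real.pi - δ / 2) (x := τ)
      ⟨by positivity, by linarith⟩ ⟨by linarith, by linarith⟩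
      (by rw [uIcc_of_le (by linarith)]; exact hτ)
    rwa [Real.sin_pi_sub, min_self] at this
  have h1 : |v τ - v (Real.pi / 2)| ≤ (latConst d * c ^ (d - 1))⁻¹ * K := by
    refine (H.profile.norm_sub_le hτ').trans ?_
    calc (∫ ξ : Sph d, |h (colat ξ)| ∂(surf d)) / latConst d * (Real.sin τ ^ (d - 1))⁻¹
        ≤ K / latConst d * (c ^ (d - 1))⁻¹ := by
          have hsn := hc0.trans_le hsin
          gcongr
          exact H.integral_abs_le
      _ = _ := by field_simp
  -- The value at the equator is compared with the mean of v: integrate v(π/2) ≤ v + |v - v(π/2)|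
  -- over the sphere.
  have h2 : v (Real.pi / 2) ≤ (I + Real.pi * K) / (surf d).real univ := by
    rw [le_div_iff₀ hS]
    have e : v (Real.pi / 2) * (surf d).real univ = ∫ _ : Sph d, v (Real.pi / 2) ∂(surf d) := by
      rw [integral_const, smul_eq_mul, mul_comm]
    rw [e]
    have hs := H.profile.integrable_sub
    calc ∫ _ : Sph d, v (Real.pi / 2) ∂(surf d)
        ≤ ∫ ξ : Sph d, (v (colat ξ) + ‖v (colat ξ) - v (Real.pi / 2)‖) ∂(surf d) := by
          refine integral_mono (integrable_const _) (H.integrable.add hs.norm) fun ξ => ?_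
          have := neg_abs_le (v (colat ξ) - v (Real.pi / 2))
          simp only [Real.norm_eq_abs]
          linarith
      _ = I + ∫ ξ : Sph d, ‖v (colat ξ) - v (Real.pi / 2)‖ ∂(surf d) :=
          integral_add H.integrable hs.norm
      _ ≤ I + Real.pi * K := by
          gcongr
          refine H.profile.integral_norm_sub_le.trans ?_
          gcongr
          exact H.integral_abs_le
  calc v τ ≤ v (Real.pi / 2) + |v τ - v (Real.pi / 2)| := by
        linarith [le_abs_self (v τ - v (Real.pi / 2))]
    _ ≤ (I + Real.pi * K) / (surf d).real univ + (latConst d * c ^ (d - 1))⁻¹ * K :=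
        add_le_add h2 h1
    _ ≤ (1 + Real.pi) * (I + K) / (surf d).real univ +
        (latConst d * c ^ (d - 1))⁻¹ * (I + K) := by
        gcongr
        · nlinarith [mul_nonneg hpi.le hI0]
        · linarith
    _ = _ := by ring

/-- Optimal radii exist and are bounded away from zero, uniformly on bounded sets of functions
that stay away from zero. -/
theorem exists_uniform_radius (d : ℕ) [NeZero d] (hβ : 0 < β) {δ m : ℝ} (K : ℝ) (hδ : 0 < δ)
    (hδ' : δ ≤ Real.pi) (hm : 0 < m) :
    ∃ r₀, 0 < r₀ ∧ r₀ < δ ∧ ∀ v h k : ℝ → ℝ, NonnegProfile d v h k →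
      (∫ ξ : Sph d, v (colat ξ) ∂(surf d)) + ∫ ξ : Sph d, k (colat ξ) ∂(surf d) ≤ K →
      m ≤ ∫ ξ : Sph d, v (colat ξ) ∂(surf d) →
      ∀ θ ∈ Icc δ (Real.pi - δ), (∃ r, IsOpt d β v θ r) ∧ ∀ r, IsOpt d β v θ r → r₀ < r := by
  obtain ⟨C, hC0, hC⟩ := exists_sup_bound d hδ hδ'
  obtain ⟨r₀, h1, h2, h3⟩ := exists_radius_threshold d hβ (C * K) hδ hδ' hm
  refine ⟨r₀, h1, h2, fun v h k H hK hmv θ hθ => ?_⟩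
  have h4 := h3 v H.nonneg H.integrable (fun τ hτ => (hC v h k H τ hτ).trans (by gcongr)) hmv θ hθ
  exact ⟨exists_isOpt hβ.le H.integrable h1 (h2.le.trans hδ') fun r hr => (h4 r hr).le,
    fun r ho => ho.lt_radius h4⟩

theorem NonnegProfile.exists_isOpt (H : NonnegProfile d v h k) (hβ : 0 < β)
    (hpos : 0 < ∫ ξ : Sph d, v (colat ξ) ∂(surf d)) {θ : ℝ} (hθ : θ ∈ Ioo 0 Real.pi) :
    ∃ r, IsOpt d β v θ r := by
  have hδ : 0 < min θ (Real.pi - θ) := lt_min hθ.1 (sub_pos.2 hθ.2)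
  obtain ⟨r₀, -, -, h3⟩ := exists_uniform_radius d hβ _ hδ ((min_le_left _ _).trans hθ.2.le) hpos
  exact (h3 v h k H le_rfl le_rfl θ ⟨min_le_left _ _, by linarith [min_le_right θ (Real.pi - θ)]⟩).1

theorem NonnegProfile.eventually_exists_isOpt (H : NonnegProfile d v h k) (hβ : 0 < β)
    (hpos : 0 < ∫ ξ : Sph d, v (colat ξ) ∂(surf d)) {θ : ℝ} (hθ : θ ∈ Ioo 0 Real.pi) :
    ∀ᶠ θ' in 𝓝 θ, ∃ r, IsOpt d β v θ' r := by
  filter_upwards [Ioo_mem_nhds hθ.1 hθ.2] with θ' hθ' using H.exists_isOpt hβ hpos hθ'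

theorem NonnegProfile.maxFn_eq_zero (H : NonnegProfile d v h k)
    (h0 : ∫ ξ : Sph d, v (colat ξ) ∂(surf d) = 0) (θ : ℝ) : maxFn d β v θ = 0 := by
  have h1 : ∀ r, avg d β v θ r = 0 := by
    intro r
    have h2 : ballInt d v θ r ≤ 0 := by
      rw [← h0]
      exact setIntegral_le_integral H.integrable (Eventually.of_forall fun _ => H.nonneg _)
    rw [avg, le_antisymm h2 (ballInt_nonneg H.nonneg _ _), mul_zero]
  simp [maxFn, h1]

theorem NonnegProfile.maxFn_lt_top (H : NonnegProfile d v h k) (hβ : 0 < β) {θ : ℝ}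
    (hθ : θ ∈ Ioo 0 Real.pi) : maxFn d β v θ < ⊤ := by
  rcases H.integral_nonneg.eq_or_lt with h0 | hpos
  · rw [H.maxFn_eq_zero h0.symm]; exact ENNReal.zero_lt_top
  · obtain ⟨r, hr⟩ := H.exists_isOpt hβ hpos hθ
    rw [hr.maxFn_eq]; exact ENNReal.ofReal_lt_top

/-- Lipschitz bound on the set where the optimal radii are bounded from below. -/
theorem NonnegProfile.abs_maxR_sub_le (H : NonnegProfile d v h k) (hβ : 0 < β) {r₀ θ θ' r r' : ℝ}
    (h0 : 0 < r₀) (ho : IsOpt d β v θ r) (hr : r₀ ≤ r) (ho' : IsOpt d β v θ' r') (hr' : r₀ ≤ r') :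
    |maxR d β v θ - maxR d β v θ'| ≤
      Real.pi ^ β / ballVol d r₀ * (∫ ξ : Sph d, k (colat ξ) ∂(surf d)) * |θ - θ'| := by
  rw [abs_sub_le_iff]
  refine ⟨H.profile.maxR_sub_le hβ.le H.nonneg H.integrable_bound H.bound h0 ho hr ho', ?_⟩
  rw [abs_sub_comm]
  exact H.profile.maxR_sub_le hβ.le H.nonneg H.integrable_bound H.bound h0 ho' hr' ho

/-- Lipschitz continuity on compact subintervals of `(0, π)`. -/
def LocLip (u : ℝ → ℝ) : Prop :=
  ∀ δ, 0 < δ → δ ≤ Real.pi → ∃ Λ, ∀ x ∈ Icc δ (Real.pi - δ), ∀ y ∈ Icc δ (Real.pi - δ),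
    |u y - u x| ≤ Λ * |y - x|

theorem NonnegProfile.locLip_maxR (H : NonnegProfile d v h k) (hβ : 0 < β) :
    LocLip (maxR d β v) := by
  intro δ hδ hδ'
  rcases H.integral_nonneg.eq_or_lt with h0 | hpos
  · exact ⟨0, fun x _ y _ => by simp [maxR, H.maxFn_eq_zero h0.symm]⟩
  · obtain ⟨r₀, hr₀, -, h3⟩ := exists_uniform_radius d hβ _ hδ hδ' hpos
    have h3 := h3 v h k H le_rfl le_rfl
    refine ⟨Real.pi ^ β / ballVol d r₀ * ∫ ξ : Sph d, k (colat ξ) ∂(surf d), fun x hx y hy => ?_⟩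
    obtain ⟨⟨r, hr⟩, h4⟩ := h3 x hx
    obtain ⟨⟨r', hr'⟩, h5⟩ := h3 y hy
    exact H.abs_maxR_sub_le hβ hr₀ hr' (h5 _ hr').le hr (h4 _ hr).le

section LocLip

variable {u : ℝ → ℝ}

theorem LocLip.exists_lipschitz (hu : LocLip u) {a b : ℝ} (ha : 0 < a) (hb : b < Real.pi) :
    ∃ Λ, 0 ≤ Λ ∧ ∀ x ∈ Icc a b, ∀ y ∈ Icc a b, |u y - u x| ≤ Λ * |y - x| := by
  have hδ : 0 < min (min a (Real.pi - b)) Real.pi :=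
    lt_min (lt_min ha (sub_pos.2 hb)) Real.pi_pos
  obtain ⟨Λ, hΛ⟩ := hu _ hδ (min_le_right _ _)
  have h1 : min (min a (Real.pi - b)) Real.pi ≤ a := (min_le_left _ _).trans (min_le_left _ _)
  have h2 : min (min a (Real.pi - b)) Real.pi ≤ Real.pi - b :=
    (min_le_left _ _).trans (min_le_right _ _)
  refine ⟨max Λ 0, le_max_right _ _, fun x hx y hy => ?_⟩
  refine (hΛ x ⟨h1.trans hx.1, by linarith [hx.2]⟩ y ⟨h1.trans hy.1, by linarith [hy.2]⟩).trans ?_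
  gcongr
  exact le_max_left _ _

theorem LocLip.abs_sub_le_integral (hu : LocLip u) {a b : ℝ} (ha : 0 < a) (hb : b < Real.pi) :
    ∃ Λ, 0 ≤ Λ ∧ ∀ x ∈ Icc a b, ∀ y ∈ Icc a b, x ≤ y → |u y - u x| ≤ ∫ _ in x..y, Λ := by
  obtain ⟨Λ, h0, hΛ⟩ := hu.exists_lipschitz ha hb
  refine ⟨Λ, h0, fun x hx y hy hxy => (hΛ x hx y hy).trans_eq ?_⟩
  rw [intervalIntegral.integral_const, smul_eq_mul, abs_of_nonneg (sub_nonneg.2 hxy), mul_comm]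

theorem LocLip.ae_differentiableAt (hu : LocLip u) :
    ∀ᵐ x, x ∈ Ioo 0 Real.pi → DifferentiableAt ℝ u x := by
  refine ae_Ioo_of_forall_Ioo fun a b ha hab hb => ?_
  obtain ⟨Λ, -, hΛ⟩ := hu.abs_sub_le_integral ha hb
  filter_upwards [ae_abs_deriv_le_of_abs_sub_le hab intervalIntegrable_const hΛ] with x hx hm
    using (hx hm).1

theorem LocLip.abs_deriv_le (hu : LocLip u) {a b : ℝ} (ha : 0 < a) (hb : b < Real.pi) :
    ∃ Λ, ∀ x ∈ Ioo a b, |deriv u x| ≤ Λ := by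
  obtain ⟨Λ, h0, hΛ⟩ := hu.exists_lipschitz ha hb
  refine ⟨Λ, fun x hx => ?_⟩
  refine norm_deriv_le_of_lip' (𝕜 := ℝ) (f := u) h0 ?_
  filter_upwards [Ioo_mem_nhds hx.1 hx.2] with y hy
  exact hΛ x (Ioo_subset_Icc_self hx) y (Ioo_subset_Icc_self hy)

theorem LocLip.integral_deriv (hu : LocLip u) {a b : ℝ} (ha : a ∈ Ioo 0 Real.pi)
    (hb : b ∈ Ioo 0 Real.pi) : u b - u a = ∫ x in a..b, deriv u x := by
  have h1 : ∀ a ∈ Ioo 0 Real.pi, ∀ b ∈ Ioo 0 Real.pi, a ≤ b →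
      u b - u a = ∫ x in a..b, deriv u x := by
    intro a ha b hb hab
    obtain ⟨Λ, -, hΛ⟩ := hu.abs_sub_le_integral ha.1 hb.2
    exact (absolutelyContinuousOnInterval_of_abs_sub_le hab intervalIntegrable_const
      hΛ).integral_deriv_eq_sub.symm
  rcases le_total a b with hab | hab
  · exact h1 a ha b hb hab
  · rw [intervalIntegral.integral_symm, ← h1 b hb a ha hab]; ring

/-- Integrability of the derivative is the only extra condition for extending the weak gradient over
the poles. -/
theorem LocLip.profile (hu : LocLip u)
    (hi : Integrable (fun ξ : Sph d => deriv u (colat ξ)) (surf d)) : Profile d u (deriv u) :=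
  ⟨(measurable_deriv u).stronglyMeasurable, hi, fun _ ha _ hb => hu.integral_deriv ha hb⟩

/-- Setting the derivative to 0 outside a band makes it bounded, hence that of a profile on the
whole sphere. -/
theorem LocLip.exists_profile_eq (hu : LocLip u) (d : ℕ) [NeZero d] {δ : ℝ} (hδ : 0 < δ)
    (hδ' : δ < Real.pi / 2) : ∃ U w : ℝ → ℝ, Profile d U w ∧
      EqOn U u (Ioo δ (Real.pi - δ)) ∧ EqOn w (deriv u) (Ioo δ (Real.pi - δ)) := by
  set w := (Ioo δ (Real.pi - δ)).indicator (deriv u) with hw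
  have hwm : StronglyMeasurable w :=
    ((measurable_deriv u).indicator measurableSet_Ioo).stronglyMeasurable
  obtain ⟨Λ, hΛ⟩ := hu.abs_deriv_le (a := δ) (b := Real.pi - δ) hδ (by linarith)
  have hwi : Integrable (fun ξ : Sph d => w (colat ξ)) (surf d) := by
    refine Integrable.of_bound (hwm.measurable.comp measurable_colat).aestronglyMeasurable (max Λ 0)
      (Eventually.of_forall fun ξ => ?_)
    by_cases hξ : colat ξ ∈ Ioo δ (Real.pi - δ)
    · rw [hw, indicator_of_mem hξ]; exact (hΛ _ hξ).trans (le_max_left _ _)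
    · rw [hw, indicator_of_notMem hξ]; simp
  have hP := profile_primitive hwm hwi
  have hc : Real.pi / 2 ∈ Ioo δ (Real.pi - δ) := ⟨hδ', by linarith⟩
  refine ⟨fun θ => (∫ x in (Real.pi / 2)..θ, w x) + u (Real.pi / 2), w,
    ⟨hwm, hwi, fun a ha b hb => ?_⟩, fun θ hθ => ?_, fun θ hθ => indicator_of_mem hθ _⟩
  · rw [← hP.sub_eq a ha b hb]; ring
  · have hsub : ∀ x ∈ Ioo δ (Real.pi - δ), x ∈ Ioo 0 Real.pi := fun x hx =>
      ⟨hδ.trans hx.1, hx.2.trans (by linarith)⟩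
    have e : ∫ x in (Real.pi / 2)..θ, w x = ∫ x in (Real.pi / 2)..θ, deriv u x :=
      intervalIntegral.integral_congr fun x hx =>
        indicator_of_mem (mem_Ioo_of_mem_uIcc hc hθ hx) _
    simp only [e, ← hu.integral_deriv (hsub _ hc) (hsub _ hθ), sub_add_cancel]

theorem exists_band_subset {ξ : Sph d} (hξ : ξ ∈ offPoles d) :
    ∃ δ, 0 < δ ∧ δ < Real.pi / 2 ∧ colat ξ ∈ Ioo δ (Real.pi - δ) := by
  rw [mem_offPoles_iff] at hξ
  have h1 : 0 < min (colat ξ) (Real.pi - colat ξ) := lt_min hξ.1 (sub_pos.2 hξ.2)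
  refine ⟨min (colat ξ) (Real.pi - colat ξ) / 2, by positivity, ?_, ?_, ?_⟩ <;>
  linarith [min_le_left (colat ξ) (Real.pi - colat ξ), min_le_right (colat ξ) (Real.pi - colat ξ)]

theorem exists_band_of_isCompact {S : Set (Sph d)} (hS : IsCompact S) (hSU : S ⊆ offPoles d) :
    ∃ δ, 0 < δ ∧ δ < Real.pi / 2 ∧ ∀ ξ ∈ S, colat ξ ∈ Ioo δ (Real.pi - δ) := by
  have hpi := Real.pi_pos
  rcases S.eq_empty_or_nonempty with rfl | hne
  · exact ⟨Real.pi / 4, by positivity, by linarith, by simp⟩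
  obtain ⟨x, hx, hxm⟩ := hS.exists_isMinOn hne (f := fun ξ : Sph d =>
    min (colat ξ) (Real.pi - colat ξ))
    (continuous_colat.min (continuous_const.sub continuous_colat)).continuousOn
  have h1 := mem_offPoles_iff.1 (hSU hx)
  have h2 : 0 < min (colat x) (Real.pi - colat x) := lt_min h1.1 (sub_pos.2 h1.2)
  have e1 := min_le_left (colat x) (Real.pi - colat x)
  have e2 := min_le_right (colat x) (Real.pi - colat x)
  refine ⟨min (colat x) (Real.pi - colat x) / 2, by positivity, by linarith, fun ξ hξ => ?_⟩
  have h3 : min (colat x) (Real.pi - colat x) ≤ min (colat ξ) (Real.pi - colat ξ) := hxm hξ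
  have h4 := le_min_iff.1 h3
  exact ⟨by linarith, by linarith⟩

/-- A test function supported off the poles has compact support in some band, where u agrees with an
honest profile. -/
theorem LocLip.isWeakGradientOn (hu : LocLip u) :
    IsWeakGradientOn (offPoles d) (fun ξ : Sph d => u (colat ξ)) (radGrad (deriv u)) where
  locallyIntegrable_fun := by
    intro ξ hξ
    obtain ⟨δ, h0, h1, h2⟩ := exists_band_subset hξ
    obtain ⟨U, w, hP, hU, -⟩ := hu.exists_profile_eq d h0 h1
    refine ⟨colat ⁻¹' Ioo δ (Real.pi - δ), mem_nhdsWithin_of_mem_nhds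
      (continuous_colat.continuousAt.preimage_mem_nhds (Ioo_mem_nhds h2.1 h2.2)), ?_⟩
    exact hP.integrable_comp.integrableOn.congr_fun (fun η hη => hU hη)
      (measurable_colat measurableSet_Ioo)
  locallyIntegrable_grad := by
    intro ξ hξ
    obtain ⟨δ, h0, h1, h2⟩ := exists_band_subset hξ
    obtain ⟨U, w, hP, -, hw⟩ := hu.exists_profile_eq d h0 h1
    refine ⟨colat ⁻¹' Ioo δ (Real.pi - δ), mem_nhdsWithin_of_mem_nhds
      (continuous_colat.continuousAt.preimage_mem_nhds (Ioo_mem_nhds h2.1 h2.2)), ?_⟩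
    exact hP.integrable_radGrad.integrableOn.congr_fun (fun η hη => by
      simp only [radGrad, hw hη]) (measurable_colat measurableSet_Ioo)
  tangential := by
    refine Eventually.of_forall fun ξ _ => ?_
    simp only [radGrad, smul_smul]
    rw [← Finset.sum_smul, sum_coord_mul_tanCoord, zero_smul]
  integral_eq φ hφ hs i j := by
    obtain ⟨δ, h0, h1, h2⟩ := exists_band_of_isCompact (isClosed_tsupport _).isCompact hs
    obtain ⟨U, w, hP, hU, hw⟩ := hu.exists_profile_eq d h0 h1
    have e := hP.isWeakGradientOn.integral_eq φ hφ (subset_univ _) i j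
    have e1 : ∀ ξ : Sph d, angularDeriv i j φ ξ • u (colat ξ) =
        angularDeriv i j φ ξ • U (colat ξ) := by
      intro ξ
      by_cases hξ : ξ ∈ tsupport fun ξ : Sph d => φ ξ
      · rw [hU (h2 ξ hξ)]
      · rw [angularDeriv_eq_zero (hφ.differentiable (by simp)) i j hξ, zero_smul, zero_smul]
    have e2 : ∀ ξ : Sph d, φ ξ • ((ξ : Ambient d) i • radGrad (deriv u) ξ j -
        (ξ : Ambient d) j • radGrad (deriv u) ξ i) =
        φ ξ • ((ξ : Ambient d) i • radGrad w ξ j - (ξ : Ambient d) j • radGrad w ξ i) := by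
      intro ξ
      by_cases hξ : ξ ∈ tsupport fun ξ : Sph d => φ ξ
      · simp only [radGrad, hw (h2 ξ hξ)]
      · rw [image_eq_zero_of_notMem_tsupport (f := fun ξ : Sph d => φ ξ) hξ, zero_smul, zero_smul]
    simp only [e1, e2]
    exact e

end LocLip

end PolarSphere

end

/-! ### Crossing points and the largest optimal radius. -/

noncomputable section

namespace PolarSphere

section Crossing

variable {v k : ℝ → ℝ} {a b : ℝ}

/-- The total variation of `v` needed to pass from the level `p` to the level `q` is spent at
points with values between `p` and `q`. -/
theorem ofReal_sub_le_lintegral_crossing (hab : a ≤ b) (hk : IntervalIntegrable k volume a b)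
    (hvc : ContinuousOn v (Icc a b))
    (h : ∀ x ∈ Icc a b, ∀ y ∈ Icc a b, x ≤ y → |v y - v x| ≤ ∫ t in x..y, k t) {p q : ℝ}
    (hpq : p ≤ q) {y z : ℝ} (hy : y ∈ Icc a b) (hz : z ∈ Icc a b) (hyp : v y ≤ p) (hzq : q ≤ v z) :
    ENNReal.ofReal (q - p) ≤
      ∫⁻ τ in Icc a b, {τ | p ≤ v τ ∧ v τ ≤ q}.indicator (fun τ => ENNReal.ofReal (k τ)) τ := by
  -- Truncating v to [p, q] keeps the increment q - p between y and z, and makes the derivative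
  -- vanish where v lies outside [p, q].
  set V : ℝ → ℝ := fun τ => max (min (v τ) q) p with hV
  have hVle : ∀ x y, |V y - V x| ≤ |v y - v x| := fun x y =>
    (abs_max_sub_max_le_abs _ _ _).trans (by
      have := abs_min_sub_min_le_max (v y) q (v x) q
      simpa using this)
  have h' : ∀ x ∈ Icc a b, ∀ y ∈ Icc a b, x ≤ y → |V y - V x| ≤ ∫ t in x..y, k t :=
    fun x hx y hy hxy => (hVle x y).trans (h x hx y hy hxy)
  have hyz : uIcc y z ⊆ uIcc a b := by
    rw [uIcc_of_le hab]; exact uIcc_subset_Icc hy hz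
  have hac := (absolutelyContinuousOnInterval_of_abs_sub_le hab hk h').mono hyz
  have hd := ae_abs_deriv_le_of_abs_sub_le hab hk h'
  have h0 : ∀ τ ∈ Ioo a b, ¬ (p ≤ v τ ∧ v τ ≤ q) → deriv V τ = 0 := by
    intro τ hτ hn
    have hc : ContinuousAt v τ := hvc.continuousAt (Icc_mem_nhds hτ.1 hτ.2)
    rcases lt_or_ge (v τ) p with h1 | h1
    · have : V =ᶠ[𝓝 τ] fun _ => p := by
        filter_upwards [hc.eventually (gt_mem_nhds h1)] with s hs
        exact max_eq_right ((min_le_left _ _).trans hs.le)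
      rw [this.deriv_eq, deriv_const]
    · have h2 : q < v τ := by
        by_contra h3; exact hn ⟨h1, not_lt.1 h3⟩
      have : V =ᶠ[𝓝 τ] fun _ => q := by
        filter_upwards [hc.eventually (lt_mem_nhds h2)] with s hs
        simp only [hV]
        rw [min_eq_right hs.le, max_eq_left hpq]
      rw [this.deriv_eq, deriv_const]
  have hVz : V z = q := by simp only [hV]; rw [min_eq_right hzq, max_eq_left hpq]
  have hVy : V y = p := by simp only [hV]; exact max_eq_right ((min_le_left _ _).trans hyp)
  have e := hac.integral_deriv_eq_sub
  rw [hVz, hVy] at e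
  rw [← e]
  calc ENNReal.ofReal (∫ x in y..z, deriv V x) ≤ ‖∫ x in y..z, deriv V x‖ₑ := by
        rw [Real.enorm_eq_ofReal_abs]; exact ENNReal.ofReal_le_ofReal (le_abs_self _)
    _ = ‖∫ x in uIoc y z, deriv V x‖ₑ := by
        rw [← ofReal_norm, ← ofReal_norm,
          intervalIntegral.norm_intervalIntegral_eq]
    _ ≤ ∫⁻ x in uIoc y z, ‖deriv V x‖ₑ := enorm_integral_le_lintegral_enorm _
    _ ≤ ∫⁻ x in Icc a b, ‖deriv V x‖ₑ :=
        lintegral_mono_set (uIoc_subset_uIcc.trans (uIcc_subset_Icc hy hz))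
    _ = ∫⁻ x in Ioo a b, ‖deriv V x‖ₑ := setLIntegral_congr Ioo_ae_eq_Icc.symm
    _ ≤ ∫⁻ τ in Ioo a b, {τ | p ≤ v τ ∧ v τ ≤ q}.indicator (fun τ => ENNReal.ofReal (k τ)) τ := by
        refine lintegral_mono_ae ?_
        filter_upwards [ae_restrict_of_ae hd, ae_restrict_mem measurableSet_Ioo] with τ h1 h2
        by_cases hm : p ≤ v τ ∧ v τ ≤ q
        · rw [indicator_of_mem (by exact hm), Real.enorm_eq_ofReal_abs]
          exact ENNReal.ofReal_le_ofReal (h1 h2).2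
        · rw [indicator_of_notMem (by exact hm), h0 τ h2 hm, enorm_zero]
    _ ≤ _ := lintegral_mono_set Ioo_subset_Icc_self

end Crossing

variable {d : ℕ} [NeZero d] {β : ℝ} {v h k : ℝ → ℝ} {θ r : ℝ}

theorem rpow_mul_le_avg {V : ℝ} (hvi : Integrable (fun ξ : Sph d => v (colat ξ)) (surf d))
    (hθ : θ ∈ Icc 0 Real.pi) (hr : r ∈ Ioc 0 Real.pi)
    (hV : ∀ τ ∈ Ioo 0 Real.pi, |τ - θ| < r → V ≤ v τ) : r ^ β * V ≤ avg d β v θ r := by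
  have h1 := avg_le_rpow_mul (d := d) (β := β) (v := fun τ => - v τ) (V := -V) hvi.neg hθ hr
    fun τ h1 h2 => neg_le_neg (hV τ h1 h2)
  have h2 : avg d β (fun τ => - v τ) θ r = - avg d β v θ r := by
    simp only [avg, ballInt, integral_neg, mul_neg]
  rw [h2] at h1
  linarith

/-- `maxR` / r^β is the mean of v over the optimal ball, so v cannot stay below a fraction c < 1 of
it. -/
theorem IsOpt.exists_high (ho : IsOpt d β v θ r)
    (hvi : Integrable (fun ξ : Sph d => v (colat ξ)) (surf d)) (hv0 : ∀ τ, 0 ≤ v τ)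
    (hθ : θ ∈ Icc 0 Real.pi) (hu : 0 < maxR d β v θ) {c : ℝ} (hc : c < 1) :
    ∃ z, |z - θ| < r ∧ c * (maxR d β v θ / r ^ β) ≤ v z := by
  by_contra! hn
  have h1 := avg_le_rpow_mul (d := d) (β := β) hvi hθ ho.1 fun τ _ h2 => (hn τ h2).le
  have hr := Real.rpow_pos_of_pos ho.1.1 β
  rw [← ho.maxR_eq hv0] at h1
  have e : r ^ β * (c * (maxR d β v θ / r ^ β)) = c * maxR d β v θ := by field_simp
  rw [e] at h1
  nlinarith

/-- The radius 2r does no better than r, so the mean over the doubled ball is at most 2^(-β) times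
the mean over the optimal one, and v cannot exceed a larger fraction of it throughout. -/
theorem IsOpt.exists_low (ho : IsOpt d β v θ r)
    (hvi : Integrable (fun ξ : Sph d => v (colat ξ)) (surf d)) (hv0 : ∀ τ, 0 ≤ v τ)
    (hθ : θ ∈ Icc 0 Real.pi) (hu : 0 < maxR d β v θ) (hr : 2 * r ≤ Real.pi) {b : ℝ}
    (hb : 1 < 2 ^ β * b) : ∃ y, |y - θ| < 2 * r ∧ v y ≤ b * (maxR d β v θ / r ^ β) := by
  by_contra! hn
  have hr0 := ho.1.1
  have h0 : 2 * r ∈ Ioc 0 Real.pi := ⟨by linarith, hr⟩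
  have h1 := rpow_mul_le_avg (d := d) (β := β) hvi hθ h0 fun τ _ h2 => (hn τ h2).le
  have h3 := h1.trans (ho.avg_le hv0 h0)
  have hrp := Real.rpow_pos_of_pos hr0 β
  have e : (2 * r) ^ β * (b * (maxR d β v θ / r ^ β)) = (2 ^ β * b) * maxR d β v θ := by
    rw [Real.mul_rpow (by norm_num) hr0.le]; field_simp
  rw [e] at h3
  nlinarith

theorem NonnegProfile.maxR_pos (H : NonnegProfile d v h k) (hβ : 0 < β)
    (hpos : 0 < ∫ ξ : Sph d, v (colat ξ) ∂(surf d)) (hθ : θ ∈ Ioo 0 Real.pi) :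
    0 < maxR d β v θ := by
  obtain ⟨r, ho⟩ := H.exists_isOpt hβ hpos hθ
  refine lt_of_lt_of_le ?_ (ho.avg_le H.nonneg ⟨Real.pi_pos, le_rfl⟩)
  rw [avg, ballInt_pi]
  exact mul_pos (coef_pos Real.pi_pos le_rfl) hpos

/-- On the set of centers for which a given point is a crossing point, the optimal radii are
comparable. -/
theorem IsOpt.radius_le_mul (hβ : 0 < β) (ho : IsOpt d β v θ r)
    (hvi : Integrable (fun ξ : Sph d => v (colat ξ)) (surf d)) (hv0 : ∀ τ, 0 ≤ v τ)
    {θ' r' τ b c : ℝ} (ho' : IsOpt d β v θ' r') (hr' : 5 * r' ≤ Real.pi) (hb : 0 < b) (hbc : b ≤ c)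
    (hu' : 0 < maxR d β v θ')
    (h1 : |τ - θ| < 2 * r) (h1' : |τ - θ'| < 2 * r')
    (h2 : b * (maxR d β v θ / r ^ β) ≤ v τ) (h2' : v τ ≤ c * (maxR d β v θ' / r' ^ β)) :
    r' ≤ (5 ^ d * (c / b)) ^ β⁻¹ * r := by
  have hr0 := ho.1.1
  have hr0' := ho'.1.1
  have hM : 1 ≤ 5 ^ d * (c / b) :=
    one_le_mul_of_one_le_of_one_le (one_le_pow₀ (by norm_num)) ((one_le_div hb).2 hbc)
  rcases le_total r' r with hle | hle
  · exact hle.trans (le_mul_of_one_le_left hr0.le (Real.one_le_rpow hM (by positivity)))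
  have hd : |θ' - θ| ≤ |τ - θ| + |τ - θ'| := by
    have := abs_sub_le θ' τ θ
    rw [abs_sub_comm θ' τ] at this
    linarith
  -- If r ≤ r', the centers are at distance at most 2r + 2r' ≤ 4r', so dilating the second ball by 5
  -- covers the shift.
  have h3 := ho'.maxR_le_mul (t := 5) hβ.le hvi hv0 ho (by norm_num) hr' (by linarith)
  have hrp := Real.rpow_pos_of_pos hr0 β
  have hrp' := Real.rpow_pos_of_pos hr0' β
  have h4 : b * (maxR d β v θ / r ^ β) ≤ c * (maxR d β v θ' / r' ^ β) := h2.trans h2'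
  -- The levels at τ compare the two means, the dilation compares the two maximal values, and the
  -- quotient of these comparisons is r'^β against r^β.
  have h5 : r' ^ β ≤ 5 ^ d * (c / b) * r ^ β := by
    rw [← mul_div_assoc, ← mul_div_assoc, div_le_div_iff₀ hrp hrp'] at h4
    have h6 : b * maxR d β v θ' * r' ^ β ≤ (5 ^ d * c * r ^ β) * maxR d β v θ' := by
      calc b * maxR d β v θ' * r' ^ β ≤ b * (5 ^ d * maxR d β v θ) * r' ^ β := by gcongr
        _ = 5 ^ d * (b * maxR d β v θ * r' ^ β) := by ring
        _ ≤ 5 ^ d * (c * maxR d β v θ' * r ^ β) := by gcongr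
        _ = _ := by ring
    have h7 : b * r' ^ β ≤ 5 ^ d * c * r ^ β := le_of_mul_le_mul_right (by linarith) hu'
    calc r' ^ β = (b * r' ^ β) / b := by field_simp
      _ ≤ (5 ^ d * c * r ^ β) / b := by gcongr
      _ = _ := by ring
  have h8 := Real.rpow_le_rpow hrp'.le h5 (inv_nonneg.2 hβ.le)
  rwa [Real.mul_rpow (by positivity) hrp.le, Real.rpow_rpow_inv hr0'.le hβ.ne',
    Real.rpow_rpow_inv hr0.le hβ.ne'] at h8

section LargestRadius

/-- The largest optimal radius. -/
def maxRadius (d : ℕ) [NeZero d] (β : ℝ) (v : ℝ → ℝ) (θ : ℝ) : ℝ :=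
  sSup {ρ | ρ ∈ Icc 0 Real.pi ∧ maxFrom d β v ρ θ = maxFn d β v θ}

theorem maxFrom_le_maxFn (ρ θ : ℝ) : maxFrom d β v ρ θ ≤ maxFn d β v θ :=
  biSup_mono fun _ hr => hr.1

theorem maxFrom_anti {ρ ρ' : ℝ} (h : ρ ≤ ρ') (θ : ℝ) :
    maxFrom d β v ρ' θ ≤ maxFrom d β v ρ θ :=
  biSup_mono fun _ hr => ⟨hr.1, h.trans hr.2⟩

theorem bddAbove_maxRadius_set (θ : ℝ) :
    BddAbove {ρ | ρ ∈ Icc 0 Real.pi ∧ maxFrom d β v ρ θ = maxFn d β v θ} :=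
  ⟨Real.pi, fun _ hρ => hρ.1.2⟩

theorem zero_mem_maxRadius_set (θ : ℝ) :
    (0 : ℝ) ∈ {ρ | ρ ∈ Icc 0 Real.pi ∧ maxFrom d β v ρ θ = maxFn d β v θ} :=
  ⟨⟨le_rfl, Real.pi_pos.le⟩, le_antisymm (maxFrom_le_maxFn _ _) (biSup_mono fun _ hr => ⟨hr, hr.1.le⟩)⟩

theorem lt_maxRadius_iff {θ c : ℝ} : c < maxRadius d β v θ ↔
    ∃ ρ ∈ Icc 0 Real.pi, c < ρ ∧ maxFrom d β v ρ θ = maxFn d β v θ := by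
  rw [maxRadius, lt_csSup_iff (bddAbove_maxRadius_set θ) ⟨0, zero_mem_maxRadius_set θ⟩]
  exact ⟨fun ⟨ρ, h1, h2⟩ => ⟨ρ, h1.1, h2, h1.2⟩, fun ⟨ρ, h1, h2, h3⟩ => ⟨ρ, ⟨h1, h3⟩, h2⟩⟩

/-- Describing the radius through `maxFrom` makes each superlevel set a countable union, over
rational ρ, of sets on which two measurable functions agree. -/
theorem Profile.measurable_maxRadius (hv : Profile d v h) : Measurable (maxRadius d β v) := by
  refine measurable_of_Ioi fun c => ?_
  rcases lt_or_ge c 0 with hc | hc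
  · convert MeasurableSet.univ
    exact eq_univ_of_forall fun θ => hc.trans_le (le_csSup (bddAbove_maxRadius_set θ)
      (zero_mem_maxRadius_set θ))
  have e : maxRadius d β v ⁻¹' Ioi c = ⋃ ρ : ℚ, {θ | (c < ρ ∧ (ρ : ℝ) ≤ Real.pi) ∧
      maxFrom d β v ρ θ = maxFn d β v θ} := by
    ext θ
    simp only [mem_preimage, mem_Ioi, lt_maxRadius_iff, mem_iUnion]
    constructor
    · rintro ⟨ρ, h1, h2, h3⟩
      obtain ⟨s, hs1, hs2⟩ := exists_rat_btwn h2
      exact ⟨s, ⟨hs1, hs2.le.trans h1.2⟩,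
        le_antisymm (maxFrom_le_maxFn _ _) (h3 ▸ maxFrom_anti hs2.le θ)⟩
    · rintro ⟨ρ, ⟨h1, h2⟩, h3⟩
      exact ⟨ρ, ⟨hc.trans h1.le, h2⟩, h1, h3⟩
  rw [e]
  exact MeasurableSet.iUnion fun ρ => (MeasurableSet.const _).inter
    (measurableSet_eq_fun (hv.measurable_maxFrom _) hv.measurable_maxFn)

theorem IsOpt.le_maxRadius (ho : IsOpt d β v θ r) : r ≤ maxRadius d β v θ := by
  refine le_csSup (bddAbove_maxRadius_set θ) ⟨⟨ho.1.1.le, ho.1.2⟩, le_antisymm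
    (maxFrom_le_maxFn _ _) ?_⟩
  rw [ho.maxFn_eq]
  exact le_iSup₂ (f := fun r _ => ENNReal.ofReal (avg d β v θ r)) r ⟨ho.1, le_refl r⟩

/-- If the supremum over large radii is the maximal function, then a large radius is optimal. -/
theorem IsOpt.exists_of_maxFrom_eq (hβ : 0 ≤ β)
    (hvi : Integrable (fun ξ : Sph d => v (colat ξ)) (surf d)) (hv0 : ∀ τ, 0 ≤ v τ)
    (ho : IsOpt d β v θ r) {ρ : ℝ} (h0 : 0 < ρ) (hρ : ρ ≤ Real.pi)
    (he : maxFrom d β v ρ θ = maxFn d β v θ) : ∃ r' ≥ ρ, IsOpt d β v θ r' := by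
  obtain ⟨r', hr', hm⟩ := isCompact_Icc.exists_isMaxOn ⟨Real.pi, hρ, le_rfl⟩
    ((continuousOn_avg_radius hβ hvi θ).mono fun r hr => ⟨h0.trans_le hr.1, hr.2⟩)
  have hr0 : r' ∈ Ioc 0 Real.pi := ⟨h0.trans_le hr'.1, hr'.2⟩
  refine ⟨r', hr'.1, hr0, fun s hs => (ho.2 s hs).trans ?_⟩
  have h1 : maxFrom d β v ρ θ ≤ ENNReal.ofReal (avg d β v θ r') :=
    iSup₂_le fun s hs => ENNReal.ofReal_le_ofReal (hm ⟨hs.2, hs.1.2⟩)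
  rw [he, ho.maxFn_eq] at h1
  exact (ENNReal.ofReal_le_ofReal_iff (avg_nonneg hv0 θ hr0)).1 h1

/-- Optimal radii exist arbitrarily close to the supremum, and the average is continuous in the
radius. -/
theorem IsOpt.isOpt_maxRadius (hβ : 0 ≤ β)
    (hvi : Integrable (fun ξ : Sph d => v (colat ξ)) (surf d)) (hv0 : ∀ τ, 0 ≤ v τ)
    (ho : IsOpt d β v θ r) : IsOpt d β v θ (maxRadius d β v θ) := by
  have h0 : 0 < maxRadius d β v θ := ho.1.1.trans_le ho.le_maxRadius
  have hp : maxRadius d β v θ ≤ Real.pi :=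
    csSup_le ⟨0, zero_mem_maxRadius_set θ⟩ fun _ hρ => hρ.1.2
  refine ⟨⟨h0, hp⟩, fun s hs => (ho.2 s hs).trans ?_⟩
  by_contra! hlt
  have hc := continuousOn_avg_radius hβ hvi θ _ ⟨h0, hp⟩
  have h1 := hc.eventually (gt_mem_nhds hlt)
  rw [eventually_nhdsWithin_iff, Metric.eventually_nhds_iff] at h1
  obtain ⟨ε, hε, h2⟩ := h1
  -- The half keeps ρ positive, and ε puts the resulting optimal radius into the neighborhood where
  -- the average is too small.
  obtain ⟨ρ, hρ1, hρ2, hρ3⟩ := lt_maxRadius_iff.1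
    (show max (maxRadius d β v θ / 2) (maxRadius d β v θ - ε) < maxRadius d β v θ from
      max_lt (by linarith) (by linarith))
  have h3 : maxRadius d β v θ / 2 < ρ := (le_max_left _ _).trans_lt hρ2
  have h4 : maxRadius d β v θ - ε < ρ := (le_max_right _ _).trans_lt hρ2
  obtain ⟨r', hr', ho'⟩ := ho.exists_of_maxFrom_eq hβ hvi hv0 (by linarith) hρ1.2 hρ3
  have h5 := ho'.le_maxRadius
  have h6 := h2 (y := r') (by rw [Real.dist_eq, abs_lt]; constructor <;> linarith) ho'.1
  exact absurd (ho'.2 r ho.1) (not_le.2 h6)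

end LargestRadius

end PolarSphere

end

/-! ### Counting the centers that share a crossing point. -/

noncomputable section

namespace PolarSphere

variable {d : ℕ} [NeZero d] {β : ℝ} {v h k : ℝ → ℝ} {θ r δ : ℝ}

/-- Lower crossing level. -/
def levelLow (β : ℝ) : ℝ := (1 + 2 * 2 ^ (-β)) / 3

/-- Upper crossing level. -/
def levelHigh (β : ℝ) : ℝ := (2 + 2 ^ (-β)) / 3

/-- The two levels cut [2^(-β), 1] into thirds: the upper one is below 1, as `IsOpt.exists_high`
requires, and the lower one is above 2^(-β), as `IsOpt.exists_low` requires. -/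
theorem level_bounds (hβ : 0 < β) : 0 < levelLow β ∧ levelLow β < levelHigh β ∧ levelHigh β < 1 ∧
    1 < 2 ^ β * levelLow β := by
  have h0 : (0 : ℝ) < 2 ^ (-β) := by positivity
  have h1 : (2 : ℝ) ^ (-β) < 1 := Real.rpow_lt_one_of_one_lt_of_neg (by norm_num) (by linarith)
  have h2 : (1 : ℝ) < 2 ^ β := Real.one_lt_rpow (by norm_num) hβ
  have h3 : (2 : ℝ) ^ β * 2 ^ (-β) = 1 := by
    rw [← Real.rpow_add (by norm_num)]; simp
  unfold levelLow levelHigh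
  refine ⟨by positivity, by linarith, by linarith, ?_⟩
  have : (2 : ℝ) ^ β * ((1 + 2 * 2 ^ (-β)) / 3) = (2 ^ β + 2 * (2 ^ β * 2 ^ (-β))) / 3 := by ring
  rw [this, h3]
  linarith

/-- A high point within r and a low point within 2r of the center force v to cross between the
levels on the segment joining them. The condition r < δ/8 keeps this segment inside the larger band.
-/
theorem NonnegProfile.ofReal_le_crossing (H : NonnegProfile d v h k) (hβ : 0 < β)
    (hδ : 0 < δ) (hθ : θ ∈ Icc δ (Real.pi - δ)) (ho : IsOpt d β v θ r)
    (hu : 0 < maxR d β v θ) (hr : r < δ / 8) :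
    ENNReal.ofReal ((levelHigh β - levelLow β) * (maxR d β v θ / r ^ β)) ≤
      ∫⁻ τ in Icc (δ / 2) (Real.pi - δ / 2), {τ | |τ - θ| < 2 * r ∧
        levelLow β * (maxR d β v θ / r ^ β) ≤ v τ ∧
        v τ ≤ levelHigh β * (maxR d β v θ / r ^ β)}.indicator (fun τ => ENNReal.ofReal (k τ)) τ := by
  obtain ⟨b0, bc, c1, b2⟩ := level_bounds hβ
  have hr0 := ho.1.1
  have hθ' : θ ∈ Icc 0 Real.pi := ⟨hδ.le.trans hθ.1, by linarith [hθ.2]⟩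
  obtain ⟨z, hz1, hz2⟩ := ho.exists_high H.integrable H.nonneg hθ' hu c1
  obtain ⟨y, hy1, hy2⟩ := ho.exists_low H.integrable H.nonneg hθ' hu
    (by linarith [hθ.1, hθ.2]) b2
  set l := maxR d β v θ / r ^ β with hl
  have hl0 : 0 < l := div_pos hu (Real.rpow_pos_of_pos hr0 _)
  have hsub : Icc (min y z) (max y z) ⊆ {τ | |τ - θ| < 2 * r} := by
    intro τ hτ
    rw [abs_lt] at hy1 hz1
    change |τ - θ| < 2 * r
    rw [abs_lt]
    constructor
    · rcases min_choice y z with h1 | h1 <;> linarith [hτ.1]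
    · rcases max_choice y z with h1 | h1 <;> linarith [hτ.2]
  have hsub2 : ∀ τ, |τ - θ| < 2 * r → τ ∈ Icc (δ / 2) (Real.pi - δ / 2) := by
    intro τ hτ
    rw [abs_lt] at hτ
    exact ⟨by linarith [hθ.1], by linarith [hθ.2]⟩
  have hsub3 : ∀ τ ∈ Icc (min y z) (max y z), τ ∈ Ioo 0 Real.pi := fun τ hτ => by
    have := hsub2 τ (hsub hτ)
    exact ⟨by linarith [this.1], by linarith [this.2]⟩
  have hmm : min y z ≤ max y z := min_le_max
  have key := ofReal_sub_le_lintegral_crossing (v := v) (k := k) hmm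
    (H.intervalIntegrable_bound (hsub3 _ ⟨le_rfl, hmm⟩) (hsub3 _ ⟨hmm, le_rfl⟩))
    (H.profile.continuousOn.mono hsub3)
    (fun x hx y hy hxy => H.abs_sub_le (hsub3 x hx) (hsub3 y hy) hxy)
    (p := levelLow β * l) (q := levelHigh β * l) (by gcongr)
    ⟨min_le_left _ _, le_max_left _ _⟩ ⟨min_le_right _ _, le_max_right _ _⟩ hy2 hz2
  rw [sub_mul]
  refine key.trans ?_
  calc _ ≤ ∫⁻ τ in Icc (min y z) (max y z), {τ | |τ - θ| < 2 * r ∧ levelLow β * l ≤ v τ ∧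
        v τ ≤ levelHigh β * l}.indicator (fun τ => ENNReal.ofReal (k τ)) τ := by
        refine setLIntegral_mono' measurableSet_Icc fun τ hτ => ?_
        by_cases hm : levelLow β * l ≤ v τ ∧ v τ ≤ levelHigh β * l
        · rw [indicator_of_mem (by exact hm), indicator_of_mem (by exact ⟨hsub hτ, hm⟩)]
        · rw [indicator_of_notMem (by exact hm)]; exact zero_le
    _ ≤ _ := lintegral_mono_set fun τ hτ => hsub2 τ (hsub hτ)

theorem NonnegProfile.lintegral_bound_le (H : NonnegProfile d v h k) (hδ : 0 < δ)
    (hδ' : δ ≤ Real.pi) :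
    ∫⁻ τ in Icc (δ / 2) (Real.pi - δ / 2), ENNReal.ofReal (k τ) ≤
      ENNReal.ofReal ((latConst d * Real.sin (δ / 2) ^ (d - 1))⁻¹ *
        ∫ ξ : Sph d, k (colat ξ) ∂(surf d)) := by
  set c := latConst d * Real.sin (δ / 2) ^ (d - 1) with hc
  have hs : 0 < Real.sin (δ / 2) := Real.sin_pos_of_mem_Ioo ⟨by positivity, by linarith⟩
  have hL := latConst_pos (d := d)
  have hc0 : 0 < c := by positivity
  rw [ENNReal.ofReal_mul (by positivity), ofReal_integral_eq_lintegral_ofReal H.integrable_bound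
    (Eventually.of_forall fun ξ => H.bound_nonneg _),
    lintegral_colat (g := fun τ => ENNReal.ofReal (k τ)) H.meas_bound.measurable.ennreal_ofReal,
    ← lintegral_const_mul' _ _ ENNReal.ofReal_ne_top]
  calc _ ≤ ∫⁻ τ in Icc (δ / 2) (Real.pi - δ / 2), ENNReal.ofReal c⁻¹ *
        (ENNReal.ofReal (latConst d * Real.sin τ ^ (d - 1)) * ENNReal.ofReal (k τ)) := by
        refine setLIntegral_mono' measurableSet_Icc fun τ hτ => ?_
        have hsin : Real.sin (δ / 2) ≤ Real.sin τ := by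
          have := sin_ge_of_mem_uIcc (a := δ / 2) (b := Real.pi - δ / 2) (x := τ)
            ⟨by positivity, by linarith⟩ ⟨by linarith, by linarith⟩
            (by rw [uIcc_of_le (hτ.1.trans hτ.2)]; exact hτ)
          rwa [Real.sin_pi_sub, min_self] at this
        have h1 : c ≤ latConst d * Real.sin τ ^ (d - 1) := by rw [hc]; gcongr
        rw [← mul_assoc, ← ENNReal.ofReal_mul (by positivity)]
        refine le_mul_of_one_le_left zero_le ?_
        rw [ENNReal.one_le_ofReal, ← div_eq_inv_mul, one_le_div hc0]
        exact h1
    _ ≤ ∫⁻ τ in Ioo 0 Real.pi, ENNReal.ofReal c⁻¹ *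
        (ENNReal.ofReal (latConst d * Real.sin τ ^ (d - 1)) * ENNReal.ofReal (k τ)) :=
        lintegral_mono_set fun τ hτ => ⟨by linarith [hτ.1], by linarith [hτ.2]⟩

/-- The second quantity equals β(d - 1)/(d - β). It is the power of r left over in the gradient
bound, and its sign allows r to be replaced by π there. -/
theorem endpointExponent_facts (hβ : 0 < β) (hβd : β < d) :
    1 < endpointExponent d β ∧ 0 ≤ (β - 1) * endpointExponent d β + 1 := by
  have hd : (1 : ℝ) ≤ d := by exact_mod_cast NeZero.one_le
  have h0 : 0 < (d : ℝ) - β := by linarith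
  unfold endpointExponent
  refine ⟨by rw [lt_div_iff₀ h0]; linarith, ?_⟩
  have : (β - 1) * (d / (d - β)) + 1 = β * (d - 1) / (d - β) := by field_simp; ring
  rw [this]
  have : 0 ≤ (d : ℝ) - 1 := by linarith
  positivity

/-- The set of pairs of a center and a crossing point. -/
def crossSet (d : ℕ) [NeZero d] (β : ℝ) (v : ℝ → ℝ) : Set (ℝ × ℝ) :=
  {p | |p.2 - p.1| < 2 * maxRadius d β v p.1 ∧
    levelLow β * (maxR d β v p.1 / maxRadius d β v p.1 ^ β) ≤ (Ioo 0 Real.pi).indicator v p.2 ∧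
    (Ioo 0 Real.pi).indicator v p.2 ≤ levelHigh β * (maxR d β v p.1 / maxRadius d β v p.1 ^ β)}

theorem NonnegProfile.measurableSet_crossSet (H : NonnegProfile d v h k) :
    MeasurableSet (crossSet d β v) := by
  have h1 : Measurable ((Ioo 0 Real.pi).indicator v) := by
    rw [← piecewise_eq_indicator]
    exact H.profile.continuousOn.measurable_piecewise continuousOn_const measurableSet_Ioo
  have h2 : Measurable (maxRadius d β v) := H.profile.measurable_maxRadius
  have h3 : Measurable (maxR d β v) := H.profile.measurable_maxFn.ennreal_toReal
  have h4 : Measurable fun p : ℝ × ℝ => (Ioo 0 Real.pi).indicator v p.2 := h1.comp measurable_snd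
  have h5 : Measurable fun p : ℝ × ℝ => maxRadius d β v p.1 := h2.comp measurable_fst
  have h6 : Measurable fun p : ℝ × ℝ => maxR d β v p.1 := h3.comp measurable_fst
  have h7 : Measurable fun p : ℝ × ℝ => maxR d β v p.1 / maxRadius d β v p.1 ^ β :=
    h6.div (h5.pow_const β)
  refine (measurableSet_lt ?_ (h5.const_mul 2)).inter
    ((measurableSet_le (h7.const_mul _) h4).inter (measurableSet_le h4 (h7.const_mul _)))
  exact (by fun_prop : Continuous fun p : ℝ × ℝ => |p.2 - p.1|).measurable

/-- Each point is a crossing point for few centers only. -/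
theorem NonnegProfile.lintegral_crossSet_le (H : NonnegProfile d v h k) (hβ : 0 < β)
    (hpos : 0 < ∫ ξ : Sph d, v (colat ξ) ∂(surf d)) (hδ : 0 < δ) {τ : ℝ}
    (hτ : τ ∈ Ioo 0 Real.pi) {E : Set ℝ} (hE : MeasurableSet E)
    (hE' : ∀ θ ∈ E, θ ∈ Ioo δ (Real.pi - δ) ∧ maxRadius d β v θ < δ / 8) :
    ∫⁻ θ in E, ENNReal.ofReal (maxRadius d β v θ)⁻¹ *
      (crossSet d β v).indicator 1 (θ, τ) ≤
      ENNReal.ofReal (4 * ((5 ^ d * (levelHigh β / levelLow β)) ^ β⁻¹) ^ 2) := by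
  obtain ⟨b0, bc, c1, b2⟩ := level_bounds hβ
  set N := (5 ^ d * (levelHigh β / levelLow β)) ^ β⁻¹ with hN
  have hN0 : 0 < N := by have := b0.trans bc; positivity
  by_cases hemp : ∃ θ₀ ∈ E, (θ₀, τ) ∈ crossSet d β v
  swap
  · push Not at hemp
    rw [setLIntegral_congr_fun hE (g := fun _ => 0) fun θ hθ => by
      simp only [indicator_of_notMem (hemp θ hθ), mul_zero]]
    simp
  obtain ⟨θ₀, hθ₀, hm₀⟩ := hemp
  have hmem : ∀ θ ∈ E, θ ∈ Ioo 0 Real.pi := fun θ hθ =>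
    ⟨hδ.trans (hE' θ hθ).1.1, by linarith [(hE' θ hθ).1.2]⟩
  have hopt : ∀ θ ∈ E, IsOpt d β v θ (maxRadius d β v θ) := fun θ hθ => by
    obtain ⟨r, ho⟩ := H.exists_isOpt hβ hpos (hmem θ hθ)
    exact ho.isOpt_maxRadius hβ.le H.integrable H.nonneg
  -- Two centers sharing the crossing point τ have radii comparable up to N. The dilation by 5 is
  -- admissible since the radii are below δ/8 and E is contained in (δ, π - δ).
  have hcmp : ∀ θ ∈ E, ∀ θ' ∈ E, (θ, τ) ∈ crossSet d β v → (θ', τ) ∈ crossSet d β v →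
      maxRadius d β v θ' ≤ N * maxRadius d β v θ := by
    intro θ hθ θ' hθ' h1 h2
    have e : (Ioo 0 Real.pi).indicator v τ = v τ := indicator_of_mem hτ v
    simp only [crossSet, mem_ofPred_eq, e] at h1 h2
    have h3 := hE' θ' hθ'
    exact (hopt θ hθ).radius_le_mul hβ H.integrable H.nonneg (hopt θ' hθ')
      (by linarith [h3.1.1, h3.1.2]) b0 bc.le (H.maxR_pos hβ hpos (hmem θ' hθ'))
      h1.1 h2.1 h1.2.1 h2.2.2
  -- Fix one such center. All others have radius between R₀/N and N R₀, so they lie within 2 N R₀ of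
  -- τ and carry weight at most N/R₀; the product of length and weight no longer contains R₀.
  set R₀ := maxRadius d β v θ₀ with hR₀
  have hR0 : 0 < R₀ := (hopt θ₀ hθ₀).1.1
  calc _ ≤ ∫⁻ θ in E, (Ioo (τ - 2 * (N * R₀)) (τ + 2 * (N * R₀))).indicator
        (fun _ => ENNReal.ofReal (N / R₀)) θ := by
        refine setLIntegral_mono' hE fun θ hθ => ?_
        by_cases hm : (θ, τ) ∈ crossSet d β v
        · have h1 := hcmp θ hθ θ₀ hθ₀ hm hm₀
          have h2 := hcmp θ₀ hθ₀ θ hθ hm₀ hm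
          have h3 : 0 < maxRadius d β v θ := (hopt θ hθ).1.1
          have h4 := abs_lt.1 hm.1
          simp only at h4
          rw [indicator_of_mem hm, indicator_of_mem (by constructor <;> linarith [h4.1, h4.2]),
            Pi.one_apply, mul_one]
          refine ENNReal.ofReal_le_ofReal ?_
          rw [inv_eq_one_div, div_le_div_iff₀ h3 hR0]
          linarith
        · rw [indicator_of_notMem hm, mul_zero]; exact zero_le
    _ ≤ ∫⁻ θ, (Ioo (τ - 2 * (N * R₀)) (τ + 2 * (N * R₀))).indicator
        (fun _ => ENNReal.ofReal (N / R₀)) θ := setLIntegral_le_lintegral _ _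
    _ = ENNReal.ofReal (N / R₀) * ENNReal.ofReal (4 * (N * R₀)) := by
        rw [lintegral_indicator measurableSet_Ioo, setLIntegral_const, Real.volume_Ioo]
        congr 2; ring
    _ = _ := by
        rw [← ENNReal.ofReal_mul (by positivity)]
        congr 1; field_simp

end PolarSphere

end

/-! ### The gradient bound away from the poles. -/

noncomputable section

namespace PolarSphere

variable {d : ℕ} [NeZero d] {β : ℝ} {v h k : ℝ → ℝ} {θ r δ : ℝ}

/-- Gradient bound at centers with a large optimal radius. -/
theorem NonnegProfile.abs_deriv_maxR_le_of_le (H : NonnegProfile d v h k) (hβ : 0 < β)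
    (hpos : 0 < ∫ ξ : Sph d, v (colat ξ) ∂(surf d)) (hθ : θ ∈ Ioo 0 Real.pi)
    (ho : IsOpt d β v θ r) {ρ : ℝ} (hρ : 0 < ρ) (hr : ρ ≤ r) :
    |deriv (maxR d β v) θ| ≤
      Real.pi ^ β / ballVol d ρ * ∫ ξ : Sph d, k (colat ξ) ∂(surf d) := by
  have hK := H.integral_bound_nonneg
  have hS := ballVol_pos (d := d) hρ (hr.trans ho.1.2)
  by_cases hd : DifferentiableAt ℝ (maxR d β v) θ
  swap
  · rw [deriv_zero_of_not_differentiableAt hd, abs_zero]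
    have := Real.pi_pos
    positivity
  rw [H.profile.deriv_maxR H.nonneg ho (H.eventually_exists_isOpt hβ hpos hθ) hd, abs_mul,
    abs_of_pos (coef_pos ho.1.1 ho.1.2)]
  have := abs_ballSlope_le_total H.integrable_bound H.bound θ r
  have h2 := coef_le (d := d) hβ.le hρ hr ho.1.2
  have := Real.pi_pos
  gcongr

/-- Gradient bound at centers with a small optimal radius. -/
theorem NonnegProfile.abs_deriv_maxR_rpow_le (H : NonnegProfile d v h k) (hβ : 0 < β)
    (hβd : β < d) (hpos : 0 < ∫ ξ : Sph d, v (colat ξ) ∂(surf d)) (hθ : θ ∈ Ioo 0 Real.pi)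
    (ho : IsOpt d β v θ r) (hr : r < Real.pi) {B : ℝ} (hB : maxR d β v θ / r ^ β ≤ B) :
    |deriv (maxR d β v) θ| ^ endpointExponent d β ≤
      (d ^ endpointExponent d β * Real.pi ^ ((β - 1) * endpointExponent d β + 1) *
        B ^ (endpointExponent d β - 1)) * (r⁻¹ * (maxR d β v θ / r ^ β)) := by
  obtain ⟨hq, he⟩ := endpointExponent_facts (d := d) hβ hβd
  set q := endpointExponent d β
  have hr0 := ho.1.1
  have hu : 0 < maxR d β v θ := H.maxR_pos hβ hpos hθ
  have hrp := Real.rpow_pos_of_pos hr0 β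
  set l := maxR d β v θ / r ^ β with hl
  have hl0 : 0 < l := by positivity
  have h1 : |deriv (maxR d β v) θ| ≤ d * (r ^ (β - 1) * l) := by
    have e : r ^ (β - 1) * l = maxR d β v θ / r := by
      rw [Real.rpow_sub_one hr0.ne', hl]; field_simp
    rw [e]
    by_cases hd : DifferentiableAt ℝ (maxR d β v) θ
    · exact ho.abs_deriv_maxR_le hβ.le H.integrable H.nonneg hr
        (H.eventually_exists_isOpt hβ hpos hθ) hd
    · rw [deriv_zero_of_not_differentiableAt hd, abs_zero]; positivity
  -- One factor 1/r is split off, to be integrated over the centers; the remaining power of r is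
  -- nonnegative.
  have e1 : (r ^ (β - 1)) ^ q = r ^ ((β - 1) * q + 1) * r⁻¹ := by
    rw [← Real.rpow_mul hr0.le, ← Real.rpow_neg_one r, ← Real.rpow_add hr0]; ring_nf
  have e2 : l ^ q = l ^ (q - 1) * l := by
    rw [Real.rpow_sub_one hl0.ne']; field_simp
  calc |deriv (maxR d β v) θ| ^ q ≤ (d * (r ^ (β - 1) * l)) ^ q := by gcongr
    _ = d ^ q * r ^ ((β - 1) * q + 1) * l ^ (q - 1) * (r⁻¹ * l) := by
        rw [Real.mul_rpow (by positivity) (by positivity),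
          Real.mul_rpow (by positivity) hl0.le, e1, e2]
        ring
    _ ≤ _ := by
        have h3 : r ^ ((β - 1) * q + 1) ≤ Real.pi ^ ((β - 1) * q + 1) :=
          Real.rpow_le_rpow hr0.le hr.le he
        have h4 : l ^ (q - 1) ≤ B ^ (q - 1) := Real.rpow_le_rpow hl0.le hB (by linarith)
        have := Real.pi_pos
        gcongr

theorem NonnegProfile.deriv_maxR_eq_zero (H : NonnegProfile d v h k)
    (h0 : ∫ ξ : Sph d, v (colat ξ) ∂(surf d) = 0) (θ : ℝ) : deriv (maxR d β v) θ = 0 := by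
  have : maxR d β v = fun _ => 0 := funext fun θ => by rw [maxR, H.maxFn_eq_zero h0]; rfl
  rw [this, deriv_const]

/-- Boundedness of the maximal operator away from the poles. -/
theorem exists_annulus_bound (hβ : 0 < β) (hβd : β < d) (hδ : 0 < δ) (hδ' : δ ≤ Real.pi) :
    ∃ C : ℝ, 0 ≤ C ∧ ∀ v h k : ℝ → ℝ, NonnegProfile d v h k →
      ∫⁻ θ in Ioo δ (Real.pi - δ), ‖deriv (maxR d β v) θ‖ₑ ^ endpointExponent d β ≤
        ENNReal.ofReal (C * (∫ ξ : Sph d, k (colat ξ) ∂(surf d)) ^ endpointExponent d β) := by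
  obtain ⟨hq, he⟩ := endpointExponent_facts (d := d) hβ hβd
  obtain ⟨b0, bc, c1, b2⟩ := level_bounds hβ
  set q := endpointExponent d β with hqdef
  have hpi := Real.pi_pos
  have hq0 : 0 < q := by linarith
  have hs : 0 < Real.sin (δ / 2) := Real.sin_pos_of_mem_Ioo ⟨by positivity, by linarith⟩
  have hL := latConst_pos (d := d)
  have hS := ballVol_pos (d := d) (r := δ / 8) (by positivity) (by linarith)
  set C₁ := Real.pi ^ β / ballVol d (δ / 8) with hC₁
  set c₅ := (latConst d * Real.sin (δ / 2) ^ (d - 1))⁻¹ with hc₅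
  set g := levelHigh β - levelLow β with hg
  have hg0 : 0 < g := sub_pos.2 bc
  set N := (4 * ((5 ^ d * (levelHigh β / levelLow β)) ^ β⁻¹) ^ 2 : ℝ) with hN
  have hc50 : 0 < c₅ := by positivity
  have hc10 : 0 < C₁ := by positivity
  have hN0 : 0 < N := by have := b0.trans bc; positivity
  -- The power (c₅/g)^(q-1) comes from the uniform bound for the means, and the last 1/g from
  -- trading one mean for its crossing integral.
  set D := d ^ q * Real.pi ^ ((β - 1) * q + 1) * (c₅ / g) ^ (q - 1) / g with hD
  have hD0 : 0 ≤ D := by positivity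
  refine ⟨C₁ ^ q * Real.pi + D * N * c₅, by positivity, fun v h k H => ?_⟩
  set K := ∫ ξ : Sph d, k (colat ξ) ∂(surf d) with hK
  have hK0 : 0 ≤ K := H.integral_bound_nonneg
  rcases H.integral_nonneg.eq_or_lt with h0 | hpos
  · simp only [H.deriv_maxR_eq_zero h0.symm, enorm_zero, ENNReal.zero_rpow_of_pos hq0,
      lintegral_zero]
    exact zero_le
  have hmem : ∀ θ ∈ Ioo δ (Real.pi - δ), θ ∈ Ioo 0 Real.pi := fun θ hθ =>
    ⟨hδ.trans hθ.1, by linarith [hθ.2]⟩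
  have hopt : ∀ θ ∈ Ioo δ (Real.pi - δ), IsOpt d β v θ (maxRadius d β v θ) := fun θ hθ => by
    obtain ⟨r, ho⟩ := H.exists_isOpt hβ hpos (hmem θ hθ)
    exact ho.isOpt_maxRadius hβ.le H.integrable H.nonneg
  have hRm : Measurable (maxRadius d β v) := H.profile.measurable_maxRadius
  -- Centers with radius at least δ/8 have a bounded gradient; only those with a smaller radius need
  -- the crossing argument.
  set E := Ioo δ (Real.pi - δ) ∩ {θ | maxRadius d β v θ < δ / 8} with hE
  set E' := Ioo δ (Real.pi - δ) ∩ {θ | δ / 8 ≤ maxRadius d β v θ} with hE'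
  have hEm : MeasurableSet E := measurableSet_Ioo.inter (measurableSet_lt hRm measurable_const)
  have hEm' : MeasurableSet E' := measurableSet_Ioo.inter (measurableSet_le measurable_const hRm)
  have henorm : ∀ θ, ‖deriv (maxR d β v) θ‖ₑ ^ q =
      ENNReal.ofReal (|deriv (maxR d β v) θ| ^ q) := fun θ => by
    rw [Real.enorm_eq_ofReal_abs, ENNReal.ofReal_rpow_of_nonneg (abs_nonneg _) hq0.le]
  have hlarge : ∫⁻ θ in E', ‖deriv (maxR d β v) θ‖ₑ ^ q ≤
      ENNReal.ofReal (C₁ ^ q * Real.pi * K ^ q) := by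
    calc _ ≤ ∫⁻ θ in E', ENNReal.ofReal ((C₁ * K) ^ q) := by
          refine setLIntegral_mono' hEm' fun θ hθ => ?_
          rw [henorm]
          refine ENNReal.ofReal_le_ofReal (Real.rpow_le_rpow (abs_nonneg _) ?_ hq0.le)
          exact H.abs_deriv_maxR_le_of_le hβ hpos (hmem θ hθ.1) (hopt θ hθ.1) (by positivity) hθ.2
      _ ≤ ENNReal.ofReal ((C₁ * K) ^ q) * ENNReal.ofReal Real.pi := by
          rw [setLIntegral_const]
          gcongr
          refine (measure_mono inter_subset_left).trans ?_
          rw [Real.volume_Ioo]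
          exact ENNReal.ofReal_le_ofReal (by linarith)
      _ = _ := by
          rw [← ENNReal.ofReal_mul (by positivity), Real.mul_rpow hc10.le hK0]
          congr 1; ring
  have hI := H.lintegral_bound_le hδ hδ'
  have hcross : ∀ θ ∈ E, ENNReal.ofReal (g * (maxR d β v θ / maxRadius d β v θ ^ β)) ≤
      ∫⁻ τ in Icc (δ / 2) (Real.pi - δ / 2),
        (crossSet d β v).indicator 1 (θ, τ) * ENNReal.ofReal (k τ) := by
    intro θ hθ
    refine (H.ofReal_le_crossing hβ hδ (Ioo_subset_Icc_self hθ.1) (hopt θ hθ.1)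
      (H.maxR_pos hβ hpos (hmem θ hθ.1)) hθ.2).trans ?_
    refine setLIntegral_mono' measurableSet_Icc fun τ hτ => ?_
    have e : (Ioo 0 Real.pi).indicator v τ = v τ :=
      indicator_of_mem (show τ ∈ Ioo 0 Real.pi from
        ⟨by linarith [hτ.1], by linarith [hτ.2]⟩) v
    by_cases hm : (θ, τ) ∈ crossSet d β v
    · rw [indicator_of_mem hm, Pi.one_apply, one_mul]
      exact indicator_le_self _ _ _
    · rw [indicator_of_notMem hm, zero_mul, indicator_of_notMem]
      intro hm'
      refine hm ?_
      simp only [crossSet, mem_ofPred_eq, e]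
      exact hm'
  -- Dropping the crossing condition, the variation of v in the whole band bounds the mean over each
  -- optimal ball.
  have hlam : ∀ θ ∈ E, maxR d β v θ / maxRadius d β v θ ^ β ≤ c₅ / g * K := by
    intro θ hθ
    have h1 : ENNReal.ofReal (g * (maxR d β v θ / maxRadius d β v θ ^ β)) ≤
        ENNReal.ofReal (c₅ * K) := by
      refine (hcross θ hθ).trans (le_trans (lintegral_mono fun τ => ?_) hI)
      by_cases hm : (θ, τ) ∈ crossSet d β v
      · rw [indicator_of_mem hm, Pi.one_apply, one_mul]
      · rw [indicator_of_notMem hm, zero_mul]; exact zero_le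
    have h2 := (ENNReal.ofReal_le_ofReal_iff (by positivity)).1 h1
    rw [div_mul_eq_mul_div, le_div_iff₀ hg0]
    linarith
  have hsmall : ∫⁻ θ in E, ‖deriv (maxR d β v) θ‖ₑ ^ q ≤
      ENNReal.ofReal (D * N * c₅ * K ^ q) := by
    calc _ ≤ ∫⁻ θ in E, ENNReal.ofReal (D * K ^ (q - 1)) *
          ∫⁻ τ in Icc (δ / 2) (Real.pi - δ / 2), ENNReal.ofReal (maxRadius d β v θ)⁻¹ *
            (crossSet d β v).indicator 1 (θ, τ) * ENNReal.ofReal (k τ) := by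
          refine setLIntegral_mono' hEm fun θ hθ => ?_
          have hR : 0 < maxRadius d β v θ := (hopt θ hθ.1).1.1
          have h1 := H.abs_deriv_maxR_rpow_le hβ hβd hpos (hmem θ hθ.1) (hopt θ hθ.1)
            (lt_of_lt_of_le (show _ < δ / 8 from hθ.2) (by linarith)) (hlam θ hθ)
          simp only [mul_assoc (ENNReal.ofReal (maxRadius d β v θ)⁻¹)]
          rw [henorm, lintegral_const_mul' _ _ ENNReal.ofReal_ne_top]
          refine le_trans ?_ (mul_le_mul_right (mul_le_mul_right (hcross θ hθ) _) _)
          rw [← ENNReal.ofReal_mul (by positivity), ← ENNReal.ofReal_mul (by positivity)]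
          refine ENNReal.ofReal_le_ofReal (h1.trans_eq ?_)
          simp only [← hqdef]
          rw [Real.mul_rpow (by positivity) hK0, hD]
          field_simp
      -- Fubini: for fixed τ the integral over the centers is bounded by
      -- `NonnegProfile.lintegral_crossSet_le`, leaving the total variation.
      _ = ENNReal.ofReal (D * K ^ (q - 1)) * ∫⁻ τ in Icc (δ / 2) (Real.pi - δ / 2),
          ∫⁻ θ in E, ENNReal.ofReal (maxRadius d β v θ)⁻¹ *
            (crossSet d β v).indicator 1 (θ, τ) * ENNReal.ofReal (k τ) := by
          rw [lintegral_const_mul' _ _ ENNReal.ofReal_ne_top, lintegral_lintegral_swap]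
          refine Measurable.aemeasurable ?_
          refine ((hRm.comp measurable_fst).inv.ennreal_ofReal.mul ?_).mul
            (H.meas_bound.measurable.comp measurable_snd).ennreal_ofReal
          exact measurable_one.indicator H.measurableSet_crossSet
      _ ≤ ENNReal.ofReal (D * K ^ (q - 1)) * ∫⁻ τ in Icc (δ / 2) (Real.pi - δ / 2),
          ENNReal.ofReal N * ENNReal.ofReal (k τ) := by
          refine mul_le_mul_right ?_ _
          refine setLIntegral_mono' measurableSet_Icc fun τ hτ => ?_
          rw [lintegral_mul_const' _ _ ENNReal.ofReal_ne_top]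
          gcongr
          exact H.lintegral_crossSet_le hβ hpos hδ ⟨by linarith [hτ.1], by linarith [hτ.2]⟩ hEm
            fun θ hθ => hθ
      _ ≤ ENNReal.ofReal (D * K ^ (q - 1)) * (ENNReal.ofReal N * ENNReal.ofReal (c₅ * K)) := by
          rw [lintegral_const_mul' _ _ ENNReal.ofReal_ne_top]
          gcongr
      _ = _ := by
          have e : K ^ q = K ^ (q - 1) * K := by
            have := Real.rpow_add_one' hK0 (y := q - 1) (by simpa using hq0.ne')
            rwa [sub_add_cancel] at this
          rw [← ENNReal.ofReal_mul hN0.le, ← ENNReal.ofReal_mul (by positivity), e]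
          congr 1; ring
  have hsplit : Ioo δ (Real.pi - δ) ⊆ E' ∪ E := fun θ hθ => by
    rcases lt_or_ge (maxRadius d β v θ) (δ / 8) with h1 | h1
    · exact Or.inr ⟨hθ, h1⟩
    · exact Or.inl ⟨hθ, h1⟩
  calc _ ≤ ∫⁻ θ in E' ∪ E, ‖deriv (maxR d β v) θ‖ₑ ^ q := lintegral_mono_set hsplit
    _ ≤ _ := lintegral_union_le _ _ _
    _ ≤ _ := add_le_add hlarge hsmall
    _ = _ := by
        rw [← ENNReal.ofReal_add (by positivity) (by positivity)]
        congr 1; ring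

end PolarSphere

end

/-! ### Antipodal symmetry and the gradient bound near the poles. -/

noncomputable section

namespace PolarSphere

variable {d : ℕ}

theorem IsWeakGradientOn.congr_ae {𝕜 : Type*} [RCLike 𝕜] {g g' : Sph d → 𝕜}
    {G G' : Sph d → EuclideanSpace 𝕜 (Fin (d + 1))} (h : IsWeakGradientOn univ g G)
    (hg : g =ᵐ[surf d] g') (hG : G =ᵐ[surf d] G') : IsWeakGradientOn univ g' G' where
  locallyIntegrable_fun :=
    (locallyIntegrableOn_univ.2 ((locallyIntegrableOn_univ.1 h.locallyIntegrable_fun).congr hg))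
  locallyIntegrable_grad :=
    (locallyIntegrableOn_univ.2 ((locallyIntegrableOn_univ.1 h.locallyIntegrable_grad).congr hG))
  tangential := by
    filter_upwards [h.tangential, hG] with ξ h1 h2 using h2 ▸ h1
  integral_eq φ hφ hs i j := by
    have h1 : ∫ ξ, angularDeriv i j φ ξ • g' ξ ∂(surf d) = ∫ ξ, angularDeriv i j φ ξ • g ξ ∂(surf d) :=
      integral_congr_ae (hg.mono fun ξ hξ => by simp only [hξ])
    rw [h1, h.integral_eq φ hφ hs i j]
    exact congrArg Neg.neg (integral_congr_ae (hG.mono fun ξ hξ => by simp only [hξ]))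

/-- The assumed local boundedness speaks of elements of the Sobolev space, so profiles, including
reflected ones, have to be realized there. -/
theorem Profile.exists_W11pol [NeZero d] {F w : ℝ → ℂ} (h : Profile d F w) :
    ∃ f : W11pol d, f.toFun =ᵐ[surf d] (fun ξ => F (colat ξ)) ∧ f.grad =ᵐ[surf d] radGrad w := by
  have h1 := memLp_one_iff_integrable.2 h.integrable_comp
  have h2 := memLp_one_iff_integrable.2 h.integrable_radGrad
  refine ⟨⟨⟨h1.toLp, h2.toLp⟩, h.isWeakGradientOn.congr_ae h1.coeFn_toLp.symm h2.coeFn_toLp.symm,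
    fun ξ => F (colat ξ), isPolar_iff_colat.2 fun ξ η e => congrArg F e, h1.coeFn_toLp⟩,
    h1.coeFn_toLp, h2.coeFn_toLp⟩

/-- The antipodal map preserves the surface measure. -/
theorem measurePreserving_neg : MeasurePreserving (fun ξ : Sph d => -ξ) (surf d) (surf d) :=
  measurePreserving_sphMap (LinearIsometryEquiv.neg ℝ)

theorem measurableEmbedding_neg : MeasurableEmbedding (fun ξ : Sph d => -ξ) :=
  (sphEquiv (d := d) (LinearIsometryEquiv.neg ℝ)).measurableEmbedding

theorem colat_neg (ξ : Sph d) : colat (-ξ) = Real.pi - colat ξ := by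
  rw [colat, geoDist_comm, geoDist_neg, geoDist_comm]; rfl

theorem fracMaximal_neg {β : ℝ} (f : Sph d → ℂ) (ξ : Sph d) :
    fracMaximal β (fun η => f (-η)) ξ = fracMaximal β f (-ξ) := by
  have h1 : ∀ r, (fun η : Sph d => -η) ⁻¹' geoBall (-ξ) r = geoBall ξ r := fun r =>
    sphMap_preimage_geoBall (LinearIsometryEquiv.neg ℝ) ξ r
  refine iSup_congr fun r => iSup_congr fun _ => ?_
  rw [fracAverage, fracAverage, ← h1 r, measurePreserving_neg.measure_preimage
    (measurableSet_geoBall _ _).nullMeasurableSet, ← measurePreserving_neg.setLIntegral_comp_preimage_emb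
    measurableEmbedding_neg (fun η => ‖f η‖ₑ) (geoBall (-ξ) r)]

theorem Profile.reflect {E : Type*} [NormedAddCommGroup E] [NormedSpace ℝ E] {F w : ℝ → E}
    (h : Profile d F w) : Profile d (fun τ => F (Real.pi - τ)) fun τ => -w (Real.pi - τ) where
  meas := (h.meas.comp_measurable (by fun_prop)).neg
  integrable := by
    simpa [Function.comp_def, colat_neg] using
      ((measurePreserving_neg (d := d)).integrable_comp_emb measurableEmbedding_neg).2 h.integrable
        |>.neg
  sub_eq a ha b hb := by
    rw [h.sub_eq _ ⟨sub_pos.2 ha.2, by linarith [ha.1]⟩ _ ⟨sub_pos.2 hb.2, by linarith [hb.1]⟩,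
      intervalIntegral.integral_neg, intervalIntegral.integral_comp_sub_left,
      intervalIntegral.integral_symm]

/-- The union of the closed polar caps of radius `δ`. -/
def caps (d : ℕ) (δ : ℝ) : Set (Sph d) := {ξ | colat ξ ∉ Ioo δ (Real.pi - δ)}

theorem measurableSet_caps (δ : ℝ) : MeasurableSet (caps d δ) :=
  (measurable_colat measurableSet_Ioo).compl

theorem neg_preimage_caps (δ : ℝ) : (fun ξ : Sph d => -ξ) ⁻¹' caps d δ = caps d δ := by
  ext ξ
  simp only [caps, mem_preimage, mem_ofPred_eq, colat_neg, mem_Ioo, not_and, not_lt]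
  constructor <;> intro h1 h2 <;> by_contra h3 <;> linarith [h1 (by linarith)]

variable [NeZero d] {β : ℝ} {F w : ℝ → ℂ}

theorem Profile.maxFn_reflect (h : Profile d F w) {θ : ℝ} (hθ : θ ∈ Icc 0 Real.pi) :
    maxFn d β (fun τ => ‖F (Real.pi - τ)‖) θ = maxFn d β (fun τ => ‖F τ‖) (Real.pi - θ) := by
  have h1 := fracMaximal_eq (β := β) (f := fun ξ : Sph d => F (Real.pi - colat ξ))
    (F := fun τ => F (Real.pi - τ)) EventuallyEq.rfl h.reflect.integrable_comp (mer θ)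
  have h2 := fracMaximal_eq (β := β) (f := fun ξ : Sph d => F (colat ξ)) EventuallyEq.rfl
    h.integrable_comp (-mer θ)
  rw [← fracMaximal_neg] at h2
  simp only [colat_neg] at h2
  rw [colat_mer hθ] at h1 h2
  rw [← h1, h2]

theorem Profile.enorm_deriv_maxR_reflect (h : Profile d F w) {θ : ℝ} (hθ : θ ∈ Ioo 0 Real.pi) :
    ‖deriv (maxR d β fun τ => ‖F (Real.pi - τ)‖) θ‖ₑ =
      ‖deriv (maxR d β fun τ => ‖F τ‖) (Real.pi - θ)‖ₑ := by
  have h1 : (maxR d β fun τ => ‖F (Real.pi - τ)‖) =ᶠ[𝓝 θ]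
      fun t => maxR d β (fun τ => ‖F τ‖) (Real.pi - t) := by
    filter_upwards [Ioo_mem_nhds hθ.1 hθ.2] with t ht
    rw [maxR, maxR, h.maxFn_reflect (Ioo_subset_Icc_self ht)]
  rw [h1.deriv_eq, deriv_comp_const_sub, enorm_neg]

/-- The cap is split by the size of the largest optimal radius. If it is below γ/2, then δ ≤ γ/2
places the closed optimal ball in B(e, γ) and the local boundedness applies; otherwise the gradient
is bounded by a constant times the total variation. -/
theorem Profile.setLIntegral_north_le {C : ℝ≥0}
    (hC : ∀ (f : W11pol d) (H : Sph d → EuclideanSpace ℝ (Fin (d + 1))),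
      IsWeakGradientOn (offPoles d) (fun ξ => (fracMaximal β f.toFun ξ).toReal) H →
      ∀ (A : Set (Sph d)) (γ : ℝ), MeasurableSet A → 0 < γ → γ ≤ Real.pi / 4 →
        (∀ ξ ∈ A, ∃ r ∈ Ioc (0 : ℝ) Real.pi,
          fracMaximal β f.toFun ξ = fracAverage β f.toFun ξ r ∧
            geoClosedBall ξ r ⊆ geoBall (northPole d) γ) →
        ∫⁻ ξ in A, ‖H ξ‖ₑ ^ endpointExponent d β ∂(surf d) ≤
          C * (∫⁻ ξ in geoBall (northPole d) (2 * γ), ‖f.grad ξ‖ₑ ∂(surf d)) ^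
            endpointExponent d β)
    (hβ : 0 < β) (hβd : β < d) (h : Profile d F w) {γ δ : ℝ} (hγ : 0 < γ) (hγ' : γ ≤ Real.pi / 4)
    (hδ : δ ≤ γ / 2) :
    ∫⁻ ξ in {ξ : Sph d | colat ξ ≤ δ}, ‖deriv (maxR d β fun τ => ‖F τ‖) (colat ξ)‖ₑ ^
        endpointExponent d β ∂(surf d) ≤
      C * (∫⁻ ξ in caps d (2 * γ), ‖w (colat ξ)‖ₑ ∂(surf d)) ^ endpointExponent d β +
      ENNReal.ofReal ((Real.pi ^ β / ballVol d (γ / 2) * ∫ ξ : Sph d, ‖w (colat ξ)‖ ∂(surf d)) ^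
        endpointExponent d β) * surf d (caps d δ) := by
  have hq0 : 0 < endpointExponent d β := by
    linarith [(endpointExponent_facts (d := d) hβ hβd).1]
  set q := endpointExponent d β
  have H := h.nonnegProfile
  set v : ℝ → ℝ := fun τ => ‖F τ‖ with hv
  rcases H.integral_nonneg.eq_or_lt with h0 | hpos
  · simp only [H.deriv_maxR_eq_zero h0.symm, enorm_zero, ENNReal.zero_rpow_of_pos hq0,
      lintegral_zero]
    exact zero_le
  have hRm : Measurable (maxRadius d β v) := H.profile.measurable_maxRadius
  have hopt : ∀ θ ∈ Ioo 0 Real.pi, IsOpt d β v θ (maxRadius d β v θ) := fun θ hθ => by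
    obtain ⟨r, ho⟩ := H.exists_isOpt hβ hpos hθ
    exact ho.isOpt_maxRadius hβ.le H.integrable H.nonneg
  obtain ⟨f, hf, hfg⟩ := h.exists_W11pol
  have hM : (fun ξ => (fracMaximal β f.toFun ξ).toReal) = fun ξ : Sph d => maxR d β v (colat ξ) :=
    funext fun ξ => by rw [fracMaximal_eq hf h.integrable_comp, maxR]
  set A : Set (Sph d) := colat ⁻¹' (Ioc 0 δ ∩ Iio Real.pi ∩ {θ | maxRadius d β v θ < γ / 2}) with hA
  set B : Set (Sph d) := colat ⁻¹' (Ioc 0 δ ∩ Iio Real.pi ∩ {θ | γ / 2 ≤ maxRadius d β v θ}) with hB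
  have hAm : MeasurableSet A := measurable_colat
    ((measurableSet_Ioc.inter measurableSet_Iio).inter (measurableSet_lt hRm measurable_const))
  have hBm : MeasurableSet B := measurable_colat
    ((measurableSet_Ioc.inter measurableSet_Iio).inter (measurableSet_le measurable_const hRm))
  have hsub : {ξ : Sph d | colat ξ ≤ δ} ≤ᵐ[surf d] (A ∪ B : Set (Sph d)) := by
    filter_upwards [ae_colat_mem] with ξ hξ (h1 : colat ξ ≤ δ)
    rcases lt_or_ge (maxRadius d β v (colat ξ)) (γ / 2) with h2 | h2
    · exact Or.inl ⟨⟨⟨hξ.1, h1⟩, hξ.2⟩, h2⟩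
    · exact Or.inr ⟨⟨⟨hξ.1, h1⟩, hξ.2⟩, h2⟩
  have hpart₁ : ∫⁻ ξ in A, ‖deriv (maxR d β v) (colat ξ)‖ₑ ^ q ∂(surf d) ≤
      C * (∫⁻ ξ in caps d (2 * γ), ‖w (colat ξ)‖ₑ ∂(surf d)) ^ q := by
    have h1 := hC f (radGrad (deriv (maxR d β v)))
      (by rw [hM]; exact (H.locLip_maxR hβ).isWeakGradientOn) A γ hAm hγ hγ' ?_
    · refine le_trans (le_of_eq ?_) (h1.trans ?_)
      · refine setLIntegral_congr_fun hAm fun ξ hξ => ?_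
        rw [← ofReal_norm (radGrad (deriv (maxR d β v)) ξ), norm_radGrad _ ⟨hξ.1.1.1, hξ.1.2⟩, ofReal_norm]
      · refine mul_le_mul_right (ENNReal.rpow_le_rpow ?_ hq0.le) _
        refine le_trans (lintegral_mono_ae (g := fun ξ : Sph d => ‖w (colat ξ)‖ₑ)
          (ae_restrict_of_ae ?_)) (lintegral_mono_set fun ξ hξ hm => ?_)
        · filter_upwards [hfg, ae_colat_mem] with ξ h2 h3
          rw [h2, ← ofReal_norm, norm_radGrad _ h3, ofReal_norm]
        · exact lt_asymm hm.1 hξ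
    · intro ξ hξ
      have hm : colat ξ ∈ Ioo 0 Real.pi := ⟨hξ.1.1.1, hξ.1.2⟩
      have ho := hopt _ hm
      refine ⟨_, ho.1, ?_, fun η (hη : geoDist ξ η ≤ _) => ?_⟩
      · rw [fracMaximal_eq hf h.integrable_comp, fracAverage_eq hf h.integrable_comp _ ho.1,
          ho.maxFn_eq]
      · have h2 := geoDist_triangle (northPole d) ξ η
        have h3 : geoDist (northPole d) ξ ≤ δ := hξ.1.1.2
        have h4 : maxRadius d β v (colat ξ) < γ / 2 := hξ.2
        change geoDist (northPole d) η < γ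
        linarith
  have hpart₂ : ∫⁻ ξ in B, ‖deriv (maxR d β v) (colat ξ)‖ₑ ^ q ∂(surf d) ≤
      ENNReal.ofReal ((Real.pi ^ β / ballVol d (γ / 2) *
        ∫ ξ : Sph d, ‖w (colat ξ)‖ ∂(surf d)) ^ q) * surf d (caps d δ) := by
    calc _ ≤ ∫⁻ ξ in B, ENNReal.ofReal ((Real.pi ^ β / ballVol d (γ / 2) *
        ∫ ξ : Sph d, ‖w (colat ξ)‖ ∂(surf d)) ^ q) ∂(surf d) := by
          refine setLIntegral_mono' hBm fun ξ hξ => ?_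
          have hm : colat ξ ∈ Ioo 0 Real.pi := ⟨hξ.1.1.1, hξ.1.2⟩
          rw [Real.enorm_eq_ofReal_abs, ENNReal.ofReal_rpow_of_nonneg (abs_nonneg _) hq0.le]
          refine ENNReal.ofReal_le_ofReal (Real.rpow_le_rpow (abs_nonneg _) ?_ hq0.le)
          exact H.abs_deriv_maxR_le_of_le hβ hpos hm (hopt _ hm) (by positivity) hξ.2
      _ ≤ _ := by
          rw [setLIntegral_const]
          gcongr
          exact fun ξ hξ hm => not_lt.2 (show colat ξ ≤ δ from hξ.1.1.2) hm.1
  calc _ ≤ ∫⁻ ξ in A ∪ B, ‖deriv (maxR d β v) (colat ξ)‖ₑ ^ q ∂(surf d) :=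
        lintegral_mono_set' hsub
    _ ≤ _ := lintegral_union_le _ _ _
    _ ≤ _ := add_le_add hpart₁ hpart₂

theorem setLIntegral_caps_reflect (g : ℝ → ℝ≥0∞) (δ : ℝ) :
    ∫⁻ ξ in caps d δ, g (Real.pi - colat ξ) ∂(surf d) = ∫⁻ ξ in caps d δ, g (colat ξ) ∂(surf d) := by
  have h := measurePreserving_neg.setLIntegral_comp_preimage_emb measurableEmbedding_neg
    (fun η : Sph d => g (colat η)) (caps d δ)
  rw [neg_preimage_caps] at h
  simpa only [colat_neg] using h

/-- Boundedness of the maximal operator near the poles. -/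
theorem exists_caps_bound (hloc : CenteredLocalBoundedness d β) (hβ : 0 < β) (hβd : β < d) :
    ∃ C : ℝ≥0, ∀ F w : ℝ → ℂ, Profile d F w → ∀ γ δ : ℝ, 0 < γ → γ ≤ Real.pi / 4 → δ ≤ γ / 2 →
      ∫⁻ ξ in caps d δ, ‖deriv (maxR d β fun τ => ‖F τ‖) (colat ξ)‖ₑ ^
          endpointExponent d β ∂(surf d) ≤
        C * (∫⁻ ξ in caps d (2 * γ), ‖w (colat ξ)‖ₑ ∂(surf d)) ^ endpointExponent d β +
        2 * (ENNReal.ofReal ((Real.pi ^ β / ballVol d (γ / 2) *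
          ∫ ξ : Sph d, ‖w (colat ξ)‖ ∂(surf d)) ^ endpointExponent d β) * surf d (caps d δ)) := by
  obtain ⟨C, hC⟩ := hloc
  refine ⟨2 * C, fun F w h γ δ hγ hγ' hδ => ?_⟩
  have h1 := h.setLIntegral_north_le hC hβ hβd hγ hγ' hδ
  -- The south cap is the north cap of the reflected profile, whose derivative has the same mass on
  -- the symmetric set `caps`.
  have h2 := h.reflect.setLIntegral_north_le hC hβ hβd hγ hγ' hδ
  simp only [enorm_neg, norm_neg] at h2
  rw [setLIntegral_caps_reflect fun τ => ‖w τ‖ₑ] at h2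
  have e1 : ∫ ξ : Sph d, ‖w (Real.pi - colat ξ)‖ ∂(surf d) = ∫ ξ : Sph d, ‖w (colat ξ)‖ ∂(surf d) := by
    have := measurePreserving_neg.integral_comp measurableEmbedding_neg
      (fun η : Sph d => ‖w (colat η)‖)
    simpa only [colat_neg] using this
  rw [e1] at h2
  have hSm : MeasurableSet {ξ : Sph d | Real.pi - δ ≤ colat ξ} :=
    measurableSet_le measurable_const measurable_colat
  have e2 : ∫⁻ ξ in {ξ : Sph d | colat ξ ≤ δ},
      ‖deriv (maxR d β fun τ => ‖F (Real.pi - τ)‖) (colat ξ)‖ₑ ^ endpointExponent d β ∂(surf d) =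
      ∫⁻ ξ in {ξ : Sph d | Real.pi - δ ≤ colat ξ},
      ‖deriv (maxR d β fun τ => ‖F τ‖) (colat ξ)‖ₑ ^ endpointExponent d β ∂(surf d) := by
    rw [← measurePreserving_neg.setLIntegral_comp_preimage_emb measurableEmbedding_neg
      (fun ξ : Sph d => ‖deriv (maxR d β fun τ => ‖F τ‖) (colat ξ)‖ₑ ^ endpointExponent d β)]
    have e3 : (fun ξ : Sph d => -ξ) ⁻¹' {ξ : Sph d | Real.pi - δ ≤ colat ξ} = {ξ | colat ξ ≤ δ} := by
      ext ξ
      simp only [mem_preimage, mem_ofPred_eq, colat_neg]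
      constructor <;> intro h3 <;> linarith
    rw [e3]
    refine lintegral_congr_ae (ae_restrict_of_ae ?_)
    filter_upwards [ae_colat_mem] with ξ hξ
    rw [colat_neg, h.enorm_deriv_maxR_reflect hξ]
  rw [e2] at h2
  have hcaps : caps d δ ⊆ {ξ | colat ξ ≤ δ} ∪ {ξ | Real.pi - δ ≤ colat ξ} := by
    intro ξ hξ
    rcases le_or_gt (colat ξ) δ with h3 | h3
    · exact Or.inl h3
    · refine Or.inr ?_
      by_contra h4
      exact hξ ⟨h3, not_le.1 h4⟩
  calc _ ≤ _ := lintegral_mono_set hcaps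
    _ ≤ _ := lintegral_union_le _ _ _
    _ ≤ _ := add_le_add h1 h2
    _ = _ := by push_cast; ring

end PolarSphere

end

/-! ### The global bound and stability of the maximal function. -/

noncomputable section

namespace PolarSphere

variable {d : ℕ} {β : ℝ} {F w : ℝ → ℂ}

theorem Profile.lintegral_enorm (h : Profile d F w) :
    ∫⁻ ξ : Sph d, ‖w (colat ξ)‖ₑ ∂(surf d) =
      ENNReal.ofReal (∫ ξ : Sph d, ‖w (colat ξ)‖ ∂(surf d)) :=
  (ofReal_integral_norm_eq_lintegral_enorm h.integrable).symm

theorem measurable_deriv_comp_colat (u : ℝ → ℝ) : Measurable fun ξ : Sph d => deriv u (colat ξ) :=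
  (measurable_deriv u).comp measurable_colat

variable [NeZero d]

theorem setLIntegral_compl_caps_le {g : ℝ → ℝ≥0∞} (hg : Measurable g) {δ : ℝ} (hδ : 0 ≤ δ) :
    ∫⁻ ξ in (caps d δ)ᶜ, g (colat ξ) ∂(surf d) ≤
      ENNReal.ofReal (latConst d) * ∫⁻ τ in Ioo δ (Real.pi - δ), g τ := by
  have hs : Ioo δ (Real.pi - δ) ⊆ Ioo 0 Real.pi := Ioo_subset_Ioo hδ (by linarith)
  have hc : (caps d δ)ᶜ = colat ⁻¹' Ioo δ (Real.pi - δ) := compl_compl _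
  have e : ∀ ξ : Sph d, (colat ⁻¹' Ioo δ (Real.pi - δ)).indicator (fun ξ => g (colat ξ)) ξ =
      (Ioo δ (Real.pi - δ)).indicator g (colat ξ) := fun ξ => rfl
  rw [hc, ← lintegral_indicator (measurable_colat measurableSet_Ioo), lintegral_congr e,
    lintegral_colat (hg.indicator measurableSet_Ioo), ← lintegral_const_mul' _ _ ENNReal.ofReal_ne_top,
    ← lintegral_indicator measurableSet_Ioo, ← lintegral_indicator measurableSet_Ioo]
  refine lintegral_mono fun τ => ?_
  by_cases h1 : τ ∈ Ioo δ (Real.pi - δ)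
  · rw [indicator_of_mem (hs h1), indicator_of_mem h1, indicator_of_mem h1]
    gcongr
    refine mul_le_of_le_one_right latConst_pos.le ?_
    exact pow_le_one₀ (Real.sin_pos_of_mem_Ioo (hs h1)).le (Real.sin_le_one _)
  · rw [indicator_of_notMem h1]
    by_cases h2 : τ ∈ Ioo 0 Real.pi
    · rw [indicator_of_mem h2, indicator_of_notMem h1, mul_zero]
    · rw [indicator_of_notMem h2]

/-- Boundedness of the gradient of the maximal function of polar Sobolev functions. -/
theorem exists_global_bound (hloc : CenteredLocalBoundedness d β) (hβ : 0 < β) (hβd : β < d) :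
    ∃ C : ℝ, 0 ≤ C ∧ ∀ F w : ℝ → ℂ, Profile d F w →
      ∫⁻ ξ : Sph d, ‖deriv (maxR d β fun τ => ‖F τ‖) (colat ξ)‖ₑ ^ endpointExponent d β ∂(surf d) ≤
        ENNReal.ofReal (C * (∫ ξ : Sph d, ‖w (colat ξ)‖ ∂(surf d)) ^ endpointExponent d β) := by
  have hpi := Real.pi_pos
  obtain ⟨C₁, hC₁⟩ := exists_caps_bound hloc hβ hβd
  obtain ⟨C₂, h0, hC₂⟩ := exists_annulus_bound (d := d) (δ := Real.pi / 8) hβ hβd (by positivity)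
    (by linarith)
  have hq0 : 0 < endpointExponent d β := by
    linarith [(endpointExponent_facts (d := d) hβ hβd).1]
  set q := endpointExponent d β
  have hS := ballVol_pos (d := d) (r := Real.pi / 4 / 2) (by positivity) (by linarith)
  have hL := latConst_pos (d := d)
  set A := Real.pi ^ β / ballVol d (Real.pi / 4 / 2)
  have hA : 0 ≤ A := by positivity
  set s := (surf d).real (caps d (Real.pi / 8))
  have hs : 0 ≤ s := measureReal_nonneg
  refine ⟨C₁ + 2 * (A ^ q * s) + latConst d * C₂, by positivity, fun F w h => ?_⟩
  set K := ∫ ξ : Sph d, ‖w (colat ξ)‖ ∂(surf d) with hK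
  have hK0 : 0 ≤ K := h.nonnegProfile.integral_bound_nonneg
  have h1 := hC₁ F w h (Real.pi / 4) (Real.pi / 8) (by positivity) le_rfl (by linarith)
  have h2 := hC₂ _ _ _ h.nonnegProfile
  have h3 := setLIntegral_compl_caps_le (d := d)
    (g := fun τ => ‖deriv (maxR d β fun τ => ‖F τ‖) τ‖ₑ ^ q)
    ((measurable_deriv _).enorm.pow_const q) (δ := Real.pi / 8) (by positivity)
  have h4 : ∫⁻ ξ in caps d (2 * (Real.pi / 4)), ‖w (colat ξ)‖ₑ ∂(surf d) ≤ ENNReal.ofReal K := by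
    rw [← h.lintegral_enorm]; exact setLIntegral_le_lintegral _ _
  rw [← lintegral_add_compl _ (measurableSet_caps (Real.pi / 8))]
  calc _ ≤ (C₁ * ENNReal.ofReal K ^ q + 2 * (ENNReal.ofReal ((A * K) ^ q) * ENNReal.ofReal s)) +
        ENNReal.ofReal (latConst d) * ENNReal.ofReal (C₂ * K ^ q) := by
        refine add_le_add (h1.trans ?_) (h3.trans (mul_le_mul_right h2 _))
        rw [ofReal_measureReal]
        gcongr
    _ = _ := by
        rw [ENNReal.ofReal_rpow_of_nonneg hK0 hq0.le, Real.mul_rpow hA hK0,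
          ← ENNReal.ofReal_coe_nnreal (p := C₁), show (2 : ℝ≥0∞) = ENNReal.ofReal 2 by simp,
          ← ENNReal.ofReal_mul (by positivity), ← ENNReal.ofReal_mul (by positivity),
          ← ENNReal.ofReal_mul (by positivity), ← ENNReal.ofReal_mul (by positivity),
          ← ENNReal.ofReal_add (by positivity) (by positivity),
          ← ENNReal.ofReal_add (by positivity) (by positivity)]
        congr 1; ring

theorem Profile.memLp_deriv_maxR (hloc : CenteredLocalBoundedness d β) (hβ : 0 < β) (hβd : β < d)
    (h : Profile d F w) : MemLp (fun ξ : Sph d => deriv (maxR d β fun τ => ‖F τ‖) (colat ξ))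
      (ENNReal.ofReal (endpointExponent d β)) (surf d) := by
  obtain ⟨C, -, hC⟩ := exists_global_bound hloc hβ hβd
  have hq0 : 0 < endpointExponent d β := by
    linarith [(endpointExponent_facts (d := d) hβ hβd).1]
  refine ⟨(measurable_deriv_comp_colat _).aestronglyMeasurable, ?_⟩
  rw [eLpNorm_lt_top_iff_lintegral_rpow_enorm_lt_top (by simpa using hq0) ENNReal.ofReal_ne_top,
    ENNReal.toReal_ofReal hq0.le]
  exact (hC F w h).trans_lt ENNReal.ofReal_lt_top

/-- As q ≥ 1 and the sphere has finite measure, the derivative is integrable, so `maxR` is itself a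
profile and its gradient extends over the poles. -/
theorem Profile.isWeakGradientOn_maxR (hloc : CenteredLocalBoundedness d β) (hβ : 0 < β)
    (hβd : β < d) (h : Profile d F w) :
    IsWeakGradientOn univ (fun ξ : Sph d => maxR d β (fun τ => ‖F τ‖) (colat ξ))
      (radGrad (deriv (maxR d β fun τ => ‖F τ‖))) :=
  ((h.nonnegProfile.locLip_maxR hβ).profile ((h.memLp_deriv_maxR hloc hβ hβd).integrable
    (one_le_endpointExponent hβ hβd))).isWeakGradientOn

variable {v h k v' h' k' : ℝ → ℝ} {θ r r₀ s η : ℝ}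

/-- The radius optimal for v competes for v', and the two averages with this radius differ by at
most a constant times the L^1 distance. -/
theorem maxR_sub_maxR_le (hβ : 0 ≤ β) (H : NonnegProfile d v h k) (H' : NonnegProfile d v' h' k')
    (h0 : 0 < r₀) (hr : r₀ ≤ r) (ho : IsOpt d β v θ r) (ho' : ∃ r', IsOpt d β v' θ r') :
    maxR d β v θ - maxR d β v' θ ≤ Real.pi ^ β / ballVol d r₀ *
      ∫ ξ : Sph d, |v (colat ξ) - v' (colat ξ)| ∂(surf d) := by
  obtain ⟨r', ho'⟩ := ho'
  have hc := coef_pos (d := d) (β := β) ho.1.1 ho.1.2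
  have hi : Integrable (fun ξ : Sph d => v (colat ξ) - v' (colat ξ)) (surf d) :=
    H.integrable.sub H'.integrable
  have h1 : ballInt d v θ r - ballInt d v' θ r ≤
      ∫ ξ : Sph d, |v (colat ξ) - v' (colat ξ)| ∂(surf d) := by
    rw [ballInt, ballInt, ← integral_sub H.integrable.integrableOn H'.integrable.integrableOn]
    calc _ ≤ ∫ ξ in geoBall (mer θ) r, |v (colat ξ) - v' (colat ξ)| ∂(surf d) :=
          integral_mono hi.integrableOn hi.abs.integrableOn fun ξ => le_abs_self _
      _ ≤ _ := setIntegral_le_integral hi.abs (Eventually.of_forall fun ξ => abs_nonneg _)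
  have h2 : 0 ≤ ∫ ξ : Sph d, |v (colat ξ) - v' (colat ξ)| ∂(surf d) :=
    integral_nonneg (f := fun ξ : Sph d => |v (colat ξ) - v' (colat ξ)|) fun ξ => abs_nonneg _
  calc maxR d β v θ - maxR d β v' θ ≤ avg d β v θ r - avg d β v' θ r := by
        rw [ho.maxR_eq H.nonneg]; linarith [ho'.avg_le H'.nonneg ho.1]
    _ = coef d β r * (ballInt d v θ r - ballInt d v' θ r) := by rw [avg, avg, mul_sub]
    _ ≤ coef d β r * ∫ ξ : Sph d, |v (colat ξ) - v' (colat ξ)| ∂(surf d) := by gcongr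
    _ ≤ _ := by
        gcongr
        exact coef_le hβ h0 hr ho.1.2

/-- The slopes of a ball integral at nearby centers differ at most by the integral over a
spherical shell. -/
theorem NonnegProfile.abs_ballSlope_sub_le (H : NonnegProfile d v h k) {θ' : ℝ}
    (hs : |θ' - θ| ≤ s) (hp : s ≤ Real.pi) :
    |ballSlope d h θ' r - ballSlope d h θ r| ≤
      ∫ ξ in {ξ : Sph d | geoDist (mer θ) ξ ∈ Icc (r - s) (r + s)}, k (colat ξ) ∂(surf d) := by
  have hi := H.profile.integrable_angColat_smul
  have hD : MeasurableSet {ξ : Sph d | geoDist (mer θ) ξ ∈ Icc (r - s) (r + s)} :=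
    (continuous_geoDist_right _).measurable measurableSet_Icc
  have hb1 := measurableSet_geoBall (mer θ' : Sph d) r
  have hb2 := measurableSet_geoBall (mer θ : Sph d) r
  rw [ballSlope, ballSlope, ← integral_indicator hb1, ← integral_indicator hb2,
    ← integral_sub (hi.indicator hb1) (hi.indicator hb2), ← integral_indicator hD]
  refine norm_integral_le_of_norm_le (f := fun ξ : Sph d =>
    (geoBall (mer θ' : Sph d) r).indicator (fun ξ => angColat 0 1 ξ • h (colat ξ)) ξ -
    (geoBall (mer θ : Sph d) r).indicator (fun ξ => angColat 0 1 ξ • h (colat ξ)) ξ)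
    (H.integrable_bound.indicator hD) ?_
  filter_upwards [H.ae_bound] with ξ hξ
  have hk : |angColat 0 1 ξ • h (colat ξ)| ≤ k (colat ξ) := by
    rw [smul_eq_mul, abs_mul]
    exact (mul_le_of_le_one_left (abs_nonneg _) (abs_angColat_le zero_ne_one_fin ξ)).trans hξ
  have h0 : 0 ≤ {ξ : Sph d | geoDist (mer θ) ξ ∈ Icc (r - s) (r + s)}.indicator
      (fun ξ => k (colat ξ)) ξ := indicator_nonneg (fun ξ _ => H.bound_nonneg _) ξ
  have hd := geoDist_mer (d := d) (s := θ) (t := θ') (by rw [abs_sub_comm]; linarith)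
  rw [abs_sub_comm] at hd
  have t1 := geoDist_triangle (mer θ : Sph d) (mer θ') ξ
  have t2 := geoDist_triangle (mer θ' : Sph d) (mer θ) ξ
  rw [geoDist_comm (mer θ') (mer θ)] at t2
  rw [hd] at t1 t2
  by_cases h1 : ξ ∈ geoBall (mer θ' : Sph d) r <;> by_cases h2 : ξ ∈ geoBall (mer θ : Sph d) r
  · simpa [h1, h2] using h0
  · have h1' : geoDist (mer θ') ξ < r := h1
    have h2' : r ≤ geoDist (mer θ) ξ := not_lt.1 h2
    rw [indicator_of_mem h1, indicator_of_notMem h2, sub_zero,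
      indicator_of_mem (show ξ ∈ {ξ : Sph d | geoDist (mer θ) ξ ∈ Icc (r - s) (r + s)} from
        ⟨by linarith [abs_nonneg (θ' - θ)], by linarith⟩)]
    exact hk
  · have h1' : r ≤ geoDist (mer θ') ξ := not_lt.1 h1
    have h2' : geoDist (mer θ) ξ < r := h2
    rw [indicator_of_notMem h1, indicator_of_mem h2, zero_sub, norm_neg,
      indicator_of_mem (show ξ ∈ {ξ : Sph d | geoDist (mer θ) ξ ∈ Icc (r - s) (r + s)} from
        ⟨by linarith, by linarith [abs_nonneg (θ' - θ)]⟩)]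
    exact hk
  · simpa [h1, h2] using h0

/-- A quantitative first order expansion from below of the maximal function. -/
theorem NonnegProfile.maxR_add_deriv_mul_le (H : NonnegProfile d v h k) (hβ : 0 < β)
    (hpos : 0 < ∫ ξ : Sph d, v (colat ξ) ∂(surf d)) (hθ : θ ∈ Ioo 0 Real.pi)
    (hθs : θ + s ∈ Ioo 0 Real.pi) (hd : DifferentiableAt ℝ (maxR d β v) θ) (h0 : 0 < r₀)
    (ho : IsOpt d β v θ r) (hr : r₀ ≤ r)
    (hη : ∫ ξ in {ξ : Sph d | geoDist (mer θ) ξ ∈ Icc (r - |s|) (r + |s|)}, k (colat ξ) ∂(surf d) ≤ η) :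
    maxR d β v θ + deriv (maxR d β v) θ * s - Real.pi ^ β / ballVol d r₀ * η * |s| ≤
      maxR d β v (θ + s) := by
  obtain ⟨r', ho'⟩ := H.exists_isOpt hβ hpos hθs
  have hc := coef_pos (d := d) (β := β) ho.1.1 ho.1.2
  have hcle := coef_le (d := d) hβ.le h0 hr ho.1.2
  have hs : |s| ≤ Real.pi := by rw [abs_le]; constructor <;> linarith [hθ.1, hθ.2, hθs.1, hθs.2]
  have hcont := H.profile.continuous_ballSlope r
  -- Along the segment the slope of the ball integral stays within η of its value at θ, because the
  -- balls differ only inside one shell.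
  have h1 : |∫ τ in θ..θ + s, (ballSlope d h τ r - ballSlope d h θ r)| ≤ η * |s| := by
    have := intervalIntegral.norm_integral_le_of_norm_le_const (a := θ) (b := θ + s) (C := η)
      (f := fun τ => ballSlope d h τ r - ballSlope d h θ r) fun τ hτ =>
        (H.abs_ballSlope_sub_le (s := |s|) ?_ hs).trans hη
    · simpa using this
    · have := abs_sub_left_of_mem_uIcc (uIoc_subset_uIcc hτ)
      simpa using this
  rw [intervalIntegral.integral_sub (hcont.intervalIntegrable _ _) intervalIntegrable_const,
    ← H.profile.ballInt_sub, intervalIntegral.integral_const, add_sub_cancel_left, smul_eq_mul] at h1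
  have h2 := (abs_le.1 h1).1
  have h3 := (abs_nonneg _).trans h1
  calc _ ≤ maxR d β v θ + deriv (maxR d β v) θ * s - coef d β r * (η * |s|) := by
        have := mul_le_mul_of_nonneg_right hcle h3
        rw [mul_assoc]; linarith
    _ = coef d β r * (ballInt d v θ r + ballSlope d h θ r * s - η * |s|) := by
        rw [H.profile.deriv_maxR H.nonneg ho (H.eventually_exists_isOpt hβ hpos hθ) hd,
          ho.maxR_eq H.nonneg, avg]
        ring
    _ ≤ coef d β r * ballInt d v (θ + s) r := by
        gcongr
        linarith
    _ ≤ _ := ho'.avg_le H.nonneg ho.1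

end PolarSphere

end

/-! ### Convergence away from the poles. -/

noncomputable section

namespace PolarSphere

variable {d : ℕ} {β : ℝ} {F w : ℝ → ℂ} {Fs ws : ℕ → ℝ → ℂ} {δ θ : ℝ}

/-- Convergence of profiles in the Sobolev norm. -/
structure TendstoProfile (d : ℕ) (Fs ws : ℕ → ℝ → ℂ) (F w : ℝ → ℂ) : Prop where
  profile_seq : ∀ j, Profile d (Fs j) (ws j)
  profile : Profile d F w
  fun_tendsto : Tendsto (fun j => ∫ ξ : Sph d, ‖Fs j (colat ξ) - F (colat ξ)‖ ∂(surf d)) atTop (𝓝 0)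
  grad_tendsto : Tendsto (fun j => ∫ ξ : Sph d, ‖ws j (colat ξ) - w (colat ξ)‖ ∂(surf d)) atTop (𝓝 0)

theorem tendsto_integral_norm {fs : ℕ → Sph d → ℂ} {f : Sph d → ℂ}
    (hfs : ∀ j, Integrable (fs j) (surf d)) (hf : Integrable f (surf d))
    (h : Tendsto (fun j => ∫ ξ, ‖fs j ξ - f ξ‖ ∂(surf d)) atTop (𝓝 0)) :
    Tendsto (fun j => ∫ ξ, ‖fs j ξ‖ ∂(surf d)) atTop (𝓝 (∫ ξ, ‖f ξ‖ ∂(surf d))) := by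
  rw [tendsto_iff_norm_sub_tendsto_zero]
  refine squeeze_zero (fun _ => norm_nonneg _) (fun j => ?_) h
  rw [← integral_sub (hfs j).norm hf.norm]
  exact norm_integral_le_of_norm_le (f := fun ξ : Sph d => ‖fs j ξ‖ - ‖f ξ‖) ((hfs j).sub hf).norm
    (Eventually.of_forall fun ξ => abs_norm_sub_norm_le _ _)

variable [NeZero d]

/-- Uniform lower bounds for the optimal radii along a convergent sequence. -/
theorem TendstoProfile.exists_uniform_radius (T : TendstoProfile d Fs ws F w) (hβ : 0 < β)
    (hpos : 0 < ∫ ξ : Sph d, ‖F (colat ξ)‖ ∂(surf d)) (hδ : 0 < δ) (hδ' : δ < Real.pi) :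
    ∃ r₀ K, 0 < r₀ ∧ r₀ ≤ Real.pi ∧
      (∀ θ ∈ Icc δ (Real.pi - δ), ∃ r, IsOpt d β (fun τ => ‖F τ‖) θ r ∧ r₀ ≤ r) ∧
      (∫ ξ : Sph d, ‖w (colat ξ)‖ ∂(surf d)) ≤ K ∧
      ∀ᶠ j in atTop, 0 < (∫ ξ : Sph d, ‖Fs j (colat ξ)‖ ∂(surf d)) ∧
        (∫ ξ : Sph d, ‖ws j (colat ξ)‖ ∂(surf d)) ≤ K ∧
        ∀ θ ∈ Icc δ (Real.pi - δ), ∃ r, IsOpt d β (fun τ => ‖Fs j τ‖) θ r ∧ r₀ ≤ r := by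
  have h1 := tendsto_integral_norm (fun j => (T.profile_seq j).integrable_comp)
    T.profile.integrable_comp T.fun_tendsto
  have h2 := tendsto_integral_norm (fun j => (T.profile_seq j).integrable) T.profile.integrable
    T.grad_tendsto
  set m := ∫ ξ : Sph d, ‖F (colat ξ)‖ ∂(surf d) with hm
  set k := ∫ ξ : Sph d, ‖w (colat ξ)‖ ∂(surf d) with hk
  have hk0 : 0 ≤ k := T.profile.nonnegProfile.integral_bound_nonneg
  -- The bounds 2m + k + 1 and m/2 hold strictly for the limit, hence for all late members of the
  -- sequence, so one radius serves all of them.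
  obtain ⟨r₀, hr₀, hr₁, h3⟩ := PolarSphere.exists_uniform_radius d hβ (2 * m + (k + 1)) hδ hδ'.le
    (half_pos hpos)
  have key : ∀ F w : ℝ → ℂ, Profile d F w →
      (∫ ξ : Sph d, ‖F (colat ξ)‖ ∂(surf d)) + (∫ ξ : Sph d, ‖w (colat ξ)‖ ∂(surf d)) ≤
        2 * m + (k + 1) → m / 2 ≤ (∫ ξ : Sph d, ‖F (colat ξ)‖ ∂(surf d)) →
      ∀ θ ∈ Icc δ (Real.pi - δ), ∃ r, IsOpt d β (fun τ => ‖F τ‖) θ r ∧ r₀ ≤ r :=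
    fun F w h e1 e2 θ hθ => by
      obtain ⟨⟨r, hr⟩, h5⟩ := h3 _ _ _ h.nonnegProfile e1 e2 θ hθ
      exact ⟨r, hr, (h5 r hr).le⟩
  refine ⟨r₀, k + 1, hr₀, (hr₁.trans hδ').le, key F w T.profile (by linarith) (by linarith),
    by linarith, ?_⟩
  filter_upwards [h1.eventually_const_lt (half_lt_self hpos), h1.eventually_lt_const
    (by linarith : m < 2 * m), h2.eventually_lt_const (by linarith : k < k + 1)] with j e1 e2 e3
  exact ⟨(half_pos hpos).trans e1, e3.le, key _ _ (T.profile_seq j) (by linarith) e1.le⟩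

/-- Pointwise convergence of the derivatives of the maximal functions. -/
theorem TendstoProfile.tendsto_deriv_maxR (T : TendstoProfile d Fs ws F w) (hβ : 0 < β)
    (hpos : 0 < ∫ ξ : Sph d, ‖F (colat ξ)‖ ∂(surf d)) (hθ : θ ∈ Ioo 0 Real.pi)
    (hd : DifferentiableAt ℝ (maxR d β fun τ => ‖F τ‖) θ)
    (hds : ∀ j, DifferentiableAt ℝ (maxR d β fun τ => ‖Fs j τ‖) θ) :
    Tendsto (fun j => deriv (maxR d β fun τ => ‖Fs j τ‖) θ) atTop
      (𝓝 (deriv (maxR d β fun τ => ‖F τ‖) θ)) := by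
  have hL := latConst_pos (d := d)
  set δ := min θ (Real.pi - θ) / 2 with hδdef
  have hm : 0 < min θ (Real.pi - θ) := lt_min hθ.1 (sub_pos.2 hθ.2)
  have hδ : 0 < δ := half_pos hm
  have hδ1 : 2 * δ ≤ θ := by rw [hδdef]; linarith [min_le_left θ (Real.pi - θ)]
  have hδ2 : 2 * δ ≤ Real.pi - θ := by rw [hδdef]; linarith [min_le_right θ (Real.pi - θ)]
  obtain ⟨r₀, K, hr₀, hr₁, hopt, -, hev⟩ := T.exists_uniform_radius hβ hpos hδ (by linarith)
  set c := Real.pi ^ β / ballVol d r₀ with hc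
  have hS := ballVol_pos (d := d) hr₀ hr₁
  have hc0 : 0 < c := by have := Real.pi_pos; positivity
  set u := maxR d β fun τ => ‖F τ‖ with hu
  rw [Metric.tendsto_nhds]
  intro ε hε
  set η := ε / 4 / c with hη
  have hη0 : 0 < η := by positivity
  have hcη : c * η = ε / 4 := by rw [hη]; field_simp
  -- Absolute continuity of the integral of |w|: any set of measure below μ, in particular any
  -- sufficiently thin shell, carries mass below η/2.
  obtain ⟨μ, hμ, hμD⟩ := exists_pos_setLIntegral_lt_of_measure_lt
    (μ := surf d) (f := fun ξ : Sph d => ‖w (colat ξ)‖ₑ) T.profile.integrable.2.ne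
    (ENNReal.ofReal_pos.2 (half_pos hη0)).ne'
  have e1 : ∀ᶠ s in 𝓝 (0 : ℝ), |u (θ + s) - u θ - s * deriv u θ| ≤ ε / 4 * |s| := by
    have := (hasDerivAt_iff_isLittleO_nhds_zero.1 hd.hasDerivAt).bound (c := ε / 4) (by positivity)
    simpa using this
  have e2 : ∀ᶠ s in 𝓝 (0 : ℝ), ENNReal.ofReal (latConst d * (2 * s)) < μ := by
    have : Tendsto (fun s : ℝ => ENNReal.ofReal (latConst d * (2 * s))) (𝓝 0) (𝓝 0) := by
      have hcont : Continuous fun s : ℝ => ENNReal.ofReal (latConst d * (2 * s)) :=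
        ENNReal.continuous_ofReal.comp (by fun_prop)
      simpa using hcont.tendsto 0
    exact this.eventually (gt_mem_nhds hμ)
  have e1' : ∀ᶠ s in 𝓝 (0 : ℝ), |u (θ + -s) - u θ - -s * deriv u θ| ≤ ε / 4 * |(-s)| := by
    have : Tendsto (fun s : ℝ => -s) (𝓝 0) (𝓝 0) := by simpa using continuous_neg.tendsto (0 : ℝ)
    exact this.eventually e1
  -- The step s₀ is fixed before j: it is small enough for the limit to be nearly linear at ±s₀ and
  -- for shells of width 2s₀ to have measure below μ.
  obtain ⟨s₀, hs₀, hsδ, d1, d1', d2⟩ : ∃ s₀ : ℝ, 0 < s₀ ∧ s₀ < δ ∧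
      |u (θ + s₀) - u θ - s₀ * deriv u θ| ≤ ε / 4 * |s₀| ∧
      |u (θ + -s₀) - u θ - -s₀ * deriv u θ| ≤ ε / 4 * |(-s₀)| ∧
      ENNReal.ofReal (latConst d * (2 * s₀)) < μ := by
    have h1 : ∀ᶠ s in 𝓝[>] (0 : ℝ), 0 < s := self_mem_nhdsWithin
    exact (h1.and (nhdsWithin_le_nhds ((gt_mem_nhds hδ).and (e1.and (e1'.and e2))))).exists
  filter_upwards [hev, T.fun_tendsto.eventually_lt_const
    (show 0 < ε / 8 * s₀ / c by positivity), T.grad_tendsto.eventually_lt_const (half_pos hη0)]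
    with j ⟨j1, j2, j3⟩ j4 j5
  have H := T.profile.nonnegProfile
  have Hj := (T.profile_seq j).nonnegProfile
  set uj := maxR d β fun τ => ‖Fs j τ‖ with huj
  set D := ∫ ξ : Sph d, |‖Fs j (colat ξ)‖ - ‖F (colat ξ)‖| ∂(surf d) with hD
  have hDle : c * D ≤ ε / 8 * s₀ := by
    have h1 : D ≤ ∫ ξ : Sph d, ‖Fs j (colat ξ) - F (colat ξ)‖ ∂(surf d) :=
      integral_mono (Hj.integrable.sub H.integrable).abs
        ((T.profile_seq j).integrable_comp.sub T.profile.integrable_comp).norm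
        fun ξ => abs_norm_sub_norm_le _ _
    have h2 := h1.trans j4.le
    rw [le_div_iff₀ hc0] at h2
    linarith
  have hmem : ∀ s, |s| = s₀ → θ + s ∈ Icc δ (Real.pi - δ) := fun s hs => by
    have := abs_le.1 hs.le
    constructor <;> linarith
  have hθm : θ ∈ Icc δ (Real.pi - δ) := ⟨by linarith, by linarith⟩
  obtain ⟨r, hr, hr2⟩ := j3 θ hθm
  obtain ⟨r', hr', hr2'⟩ := hopt θ hθm
  -- The radius r depends on j, but the measure of the shell does not. L^1 convergence of the
  -- derivatives then passes the smallness from w to `ws j`.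
  have hshell : ∀ s, |s| = s₀ → ∫ ξ in {ξ : Sph d | geoDist (mer θ) ξ ∈ Icc (r - |s|) (r + |s|)},
      ‖ws j (colat ξ)‖ ∂(surf d) ≤ η := by
    intro s hs
    set S := {ξ : Sph d | geoDist (mer θ) ξ ∈ Icc (r - |s|) (r + |s|)} with hSdef
    have hSm : surf d S < μ := by
      refine (surf_annulus_le (mer θ) _ _).trans_lt ?_
      rw [hs, show r + s₀ - (r - s₀) = 2 * s₀ by ring]
      exact d2
    have h1 : ∫ ξ in S, ‖w (colat ξ)‖ ∂(surf d) ≤ η / 2 := by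
      have := hμD S hSm
      rw [← ofReal_integral_norm_eq_lintegral_enorm T.profile.integrable.integrableOn] at this
      exact ((ENNReal.ofReal_lt_ofReal_iff (half_pos hη0)).1 this).le
    have i1 := T.profile.integrable.norm
    have i2 := ((T.profile_seq j).integrable.sub T.profile.integrable).norm
    calc ∫ ξ in S, ‖ws j (colat ξ)‖ ∂(surf d) ≤
          ∫ ξ in S, (‖w (colat ξ)‖ + ‖ws j (colat ξ) - w (colat ξ)‖) ∂(surf d) := by
          refine integral_mono (T.profile_seq j).integrable.norm.integrableOn
            (i1.add i2).integrableOn fun ξ => ?_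
          have := norm_add_le (w (colat ξ)) (ws j (colat ξ) - w (colat ξ))
          simpa using this
      _ = (∫ ξ in S, ‖w (colat ξ)‖ ∂(surf d)) +
          ∫ ξ in S, ‖ws j (colat ξ) - w (colat ξ)‖ ∂(surf d) :=
          integral_add i1.integrableOn i2.integrableOn
      _ ≤ η / 2 + η / 2 := by
          refine add_le_add h1 (le_trans ?_ j5.le)
          exact setIntegral_le_integral i2 (Eventually.of_forall fun ξ => norm_nonneg _)
      _ = η := add_halves η
  have hDsymm : ∫ ξ : Sph d, |‖F (colat ξ)‖ - ‖Fs j (colat ξ)‖| ∂(surf d) = D := by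
    simp only [hD, abs_sub_comm]
  -- The expansion from below at index j and the linear expansion of the limit cost ε/4 each, and
  -- the two comparisons of maximal functions at θ and θ + s cost ε/8 each. Using both signs of s
  -- bounds the difference of the derivatives from both sides.
  have main : ∀ s, |s| = s₀ → |u (θ + s) - u θ - s * deriv u θ| ≤ ε / 4 * |s| →
      (deriv uj θ - deriv u θ) * s ≤ 3 * ε / 4 * s₀ := by
    intro s hs h1
    have hms := hmem s hs
    have h2 := Hj.maxR_add_deriv_mul_le hβ j1 hθ ⟨hδ.trans_le hms.1, by linarith [hms.2]⟩ (hds j)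
      hr₀ hr hr2 (hshell s hs)
    have h3 := maxR_sub_maxR_le hβ.le H Hj hr₀ hr2' hr' ⟨r, hr⟩
    obtain ⟨r₁, hr₁, hr₁'⟩ := j3 _ hms
    obtain ⟨r₂, hr₂, -⟩ := hopt _ hms
    have h4 := maxR_sub_maxR_le hβ.le Hj H hr₀ hr₁' hr₁ ⟨r₂, hr₂⟩
    rw [hDsymm] at h3
    simp only [← hc, ← hu, ← huj, ← hD] at h2 h3 h4
    rw [hcη] at h2
    rw [hs] at h1 h2
    have h5 := (abs_le.1 h1).2
    linarith
  have m1 := main s₀ (abs_of_pos hs₀) d1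
  have m2 := main (-s₀) (by rw [abs_neg, abs_of_pos hs₀]) d1'
  rw [Real.dist_eq]
  refine lt_of_le_of_lt (abs_le.2 ⟨?_, ?_⟩) (show 3 * ε / 4 < ε by linarith)
  · refine le_of_mul_le_mul_right ?_ hs₀
    linarith
  · exact le_of_mul_le_mul_right m1 hs₀

/-- Convergence of the gradients of the maximal functions away from the poles. -/
theorem TendstoProfile.tendsto_setLIntegral (T : TendstoProfile d Fs ws F w) (hβ : 0 < β)
    (hβd : β < d) (hpos : 0 < ∫ ξ : Sph d, ‖F (colat ξ)‖ ∂(surf d)) (hδ : 0 < δ)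
    (hδ' : δ < Real.pi) :
    Tendsto (fun j => ∫⁻ τ in Ioo δ (Real.pi - δ), ‖deriv (maxR d β fun τ => ‖Fs j τ‖) τ -
      deriv (maxR d β fun τ => ‖F τ‖) τ‖ₑ ^ endpointExponent d β) atTop (𝓝 0) := by
  have hq0 : 0 < endpointExponent d β := by
    linarith [(endpointExponent_facts (d := d) hβ hβd).1]
  set q := endpointExponent d β
  obtain ⟨r₀, K, hr₀, hr₁, hopt, hK, hev⟩ := T.exists_uniform_radius hβ hpos hδ hδ'
  set c := Real.pi ^ β / ballVol d r₀ with hc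
  have hS := ballVol_pos (d := d) hr₀ hr₁
  have hc0 : 0 < c := by have := Real.pi_pos; positivity
  have hmem : ∀ τ ∈ Ioo δ (Real.pi - δ), τ ∈ Ioo 0 Real.pi := fun τ hτ =>
    ⟨hδ.trans hτ.1, by linarith [hτ.2]⟩
  have h0 : ∫⁻ _ in Ioo δ (Real.pi - δ), (0 : ℝ≥0∞) = 0 := lintegral_zero
  rw [← h0]
  -- The common lower bound for the radii bounds all late derivatives by one constant on the band.
  refine tendsto_lintegral_filter_of_dominated_convergence
    (fun _ => ENNReal.ofReal ((c * K + c * K) ^ q)) (Eventually.of_forall fun j =>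
      ((measurable_deriv _).sub (measurable_deriv _)).enorm.pow_const q) ?_ ?_ ?_
  · filter_upwards [hev] with j ⟨j1, j2, j3⟩
    filter_upwards [ae_restrict_mem measurableSet_Ioo] with τ hτ
    obtain ⟨r, hr, hr2⟩ := hopt τ (Ioo_subset_Icc_self hτ)
    obtain ⟨r', hr', hr2'⟩ := j3 τ (Ioo_subset_Icc_self hτ)
    have b1 := T.profile.nonnegProfile.abs_deriv_maxR_le_of_le hβ hpos (hmem τ hτ) hr hr₀ hr2
    have b2 := (T.profile_seq j).nonnegProfile.abs_deriv_maxR_le_of_le hβ j1 (hmem τ hτ) hr' hr₀ hr2'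
    rw [Real.enorm_eq_ofReal_abs, ENNReal.ofReal_rpow_of_nonneg (abs_nonneg _) hq0.le]
    refine ENNReal.ofReal_le_ofReal (Real.rpow_le_rpow (abs_nonneg _) ?_ hq0.le)
    refine (abs_sub _ _).trans (add_le_add (b2.trans ?_) (b1.trans ?_)) <;>
    · rw [← hc]; gcongr
  · rw [setLIntegral_const]
    exact ENNReal.mul_ne_top ENNReal.ofReal_ne_top (by simp)
  · have a1 := (T.profile.nonnegProfile.locLip_maxR hβ).ae_differentiableAt
    have a2 := ae_all_iff.2 fun j =>
      ((T.profile_seq j).nonnegProfile.locLip_maxR hβ).ae_differentiableAt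
    filter_upwards [ae_restrict_of_ae a1, ae_restrict_of_ae a2, ae_restrict_mem measurableSet_Ioo]
      with τ t1 t2 hτ
    have h1 := T.tendsto_deriv_maxR hβ hpos (hmem τ hτ) (t1 (hmem τ hτ))
      fun j => t2 j (hmem τ hτ)
    have h2 := (h1.sub_const (deriv (maxR d β fun τ => ‖F τ‖) τ)).enorm
    rw [sub_self, enorm_zero] at h2
    have h3 := (ENNReal.continuous_rpow_const (y := q)).tendsto 0 |>.comp h2
    rwa [ENNReal.zero_rpow_of_pos hq0] at h3

end PolarSphere

end

/-! ### Convergence on the whole sphere. -/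

noncomputable section

namespace PolarSphere

variable {d : ℕ} [NeZero d] {β : ℝ} {F w : ℝ → ℂ} {Fs ws : ℕ → ℝ → ℂ}

theorem tendsto_surf_caps : Tendsto (fun δ => surf d (caps d δ)) (𝓝[>] 0) (𝓝 0) := by
  have h1 : Tendsto (fun δ : ℝ => ENNReal.ofReal (latConst d * δ) + ENNReal.ofReal (latConst d * δ))
      (𝓝[>] 0) (𝓝 0) := by
    have h2 : Continuous fun δ : ℝ =>
        ENNReal.ofReal (latConst d * δ) + ENNReal.ofReal (latConst d * δ) :=
      (ENNReal.continuous_ofReal.comp (by fun_prop)).add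
        (ENNReal.continuous_ofReal.comp (by fun_prop))
    have h3 := h2.tendsto 0
    simp only [mul_zero, ENNReal.ofReal_zero, add_zero] at h3
    exact h3.mono_left nhdsWithin_le_nhds
  refine tendsto_of_tendsto_of_tendsto_of_le_of_le' tendsto_const_nhds h1
    (Eventually.of_forall fun _ => zero_le) ?_
  filter_upwards [self_mem_nhdsWithin] with δ (hδ : 0 < δ)
  have h2 : caps d δ ⊆ {ξ | geoDist (northPole d) ξ ∈ Icc 0 δ} ∪
      {ξ | geoDist (northPole d) ξ ∈ Icc (Real.pi - δ) Real.pi} := by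
    intro ξ hξ
    rcases le_or_gt (colat ξ) δ with h3 | h3
    · exact Or.inl ⟨colat_nonneg ξ, h3⟩
    · refine Or.inr ⟨?_, colat_le_pi ξ⟩
      by_contra h4
      exact hξ ⟨h3, not_le.1 h4⟩
  refine (measure_mono h2).trans ((measure_union_le _ _).trans (add_le_add ?_ ?_))
  · simpa using surf_annulus_le (northPole d) 0 δ
  · simpa using surf_annulus_le (northPole d) (Real.pi - δ) Real.pi

theorem enorm_sub_rpow_le {q : ℝ} (hq : 1 ≤ q) (a b : ℝ) :
    ‖a - b‖ₑ ^ q ≤ 2 ^ (q - 1) * (‖a‖ₑ ^ q + ‖b‖ₑ ^ q) :=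
  (ENNReal.rpow_le_rpow (enorm_sub_le) (by linarith)).trans
    (ENNReal.rpow_add_le_mul_rpow_add_rpow _ _ hq)

/-- A profile vanishing almost everywhere has vanishing gradient. -/
theorem Profile.integral_norm_grad_eq_zero (h : Profile d F w)
    (h0 : ∫ ξ : Sph d, ‖F (colat ξ)‖ ∂(surf d) = 0) : ∫ ξ : Sph d, ‖w (colat ξ)‖ ∂(surf d) = 0 := by
  have h1 : (fun ξ : Sph d => F (colat ξ)) =ᵐ[surf d] fun _ => 0 := by
    have := (integral_eq_zero_iff_of_nonneg (fun ξ => norm_nonneg _) h.integrable_comp.norm).1 h0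
    filter_upwards [this] with ξ hξ using norm_eq_zero.1 hξ
  have h2 : Profile d (fun _ => (0 : ℂ)) fun _ => 0 :=
    ⟨stronglyMeasurable_const, integrable_zero _ _ _, by simp⟩
  have h3 := (h.isWeakGradientOn.congr_ae h1 EventuallyEq.rfl).unique h2.isWeakGradientOn
    h.integrable_radGrad h2.integrable_radGrad
  rw [← integral_zero (Sph d) ℝ (μ := surf d)]
  refine integral_congr_ae ?_
  filter_upwards [h3, ae_colat_mem] with ξ h4 h5
  rw [← norm_radGrad w h5, h4, norm_radGrad _ h5, norm_zero]

/-- If the limit vanishes, so does its gradient, and the global bound by the L^1 norm of `ws j`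
tends to 0. No control of the radii is needed. -/
theorem TendstoProfile.tendsto_lintegral_of_eq_zero (T : TendstoProfile d Fs ws F w)
    (hloc : CenteredLocalBoundedness d β) (hβ : 0 < β) (hβd : β < d)
    (h0 : ∫ ξ : Sph d, ‖F (colat ξ)‖ ∂(surf d) = 0) :
    Tendsto (fun j => ∫⁻ ξ : Sph d, ‖deriv (maxR d β fun τ => ‖Fs j τ‖) (colat ξ) -
      deriv (maxR d β fun τ => ‖F τ‖) (colat ξ)‖ₑ ^ endpointExponent d β ∂(surf d))
      atTop (𝓝 0) := by
  have hq0 : 0 < endpointExponent d β := by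
    linarith [(endpointExponent_facts (d := d) hβ hβd).1]
  obtain ⟨C, -, hC⟩ := exists_global_bound hloc hβ hβd
  have h1 := tendsto_integral_norm (fun j => (T.profile_seq j).integrable) T.profile.integrable
    T.grad_tendsto
  rw [T.profile.integral_norm_grad_eq_zero h0] at h1
  have h2 := ENNReal.tendsto_ofReal ((h1.rpow_const (p := endpointExponent d β)
    (Or.inr hq0.le)).const_mul C)
  rw [Real.zero_rpow hq0.ne', mul_zero, ENNReal.ofReal_zero] at h2
  refine tendsto_of_tendsto_of_tendsto_of_le_of_le tendsto_const_nhds h2 (fun _ => zero_le)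
    fun j => ?_
  simp only [T.profile.nonnegProfile.deriv_maxR_eq_zero h0, sub_zero]
  exact hC _ _ (T.profile_seq j)

/-- Convergence of the gradients of the maximal functions. -/
theorem TendstoProfile.tendsto_lintegral (T : TendstoProfile d Fs ws F w)
    (hloc : CenteredLocalBoundedness d β) (hβ : 0 < β) (hβd : β < d) :
    Tendsto (fun j => ∫⁻ ξ : Sph d, ‖deriv (maxR d β fun τ => ‖Fs j τ‖) (colat ξ) -
      deriv (maxR d β fun τ => ‖F τ‖) (colat ξ)‖ₑ ^ endpointExponent d β ∂(surf d))
      atTop (𝓝 0) := by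
  rcases T.profile.nonnegProfile.integral_nonneg.eq_or_lt with h0 | hpos
  · exact T.tendsto_lintegral_of_eq_zero hloc hβ hβd h0.symm
  have hq1 := (endpointExponent_facts (d := d) hβ hβd).1
  obtain ⟨C, hC⟩ := exists_caps_bound hloc hβ hβd
  set q := endpointExponent d β with hq
  have hq0 : 0 < q := by linarith
  have hpi := Real.pi_pos
  -- The factor 2^(q-1) comes from convexity, and the factor 2 from the two functions being
  -- compared.
  set P : ℝ≥0∞ := 2 ^ (q - 1) * 2 with hP
  have hPt : P ≠ ⊤ := ENNReal.mul_ne_top (ENNReal.rpow_ne_top_of_nonneg (by linarith) (by simp)) (by simp)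
  have hgrad := tendsto_integral_norm (fun j => (T.profile_seq j).integrable) T.profile.integrable
    T.grad_tendsto
  set K := (∫ ξ : Sph d, ‖w (colat ξ)‖ ∂(surf d)) + 1 with hK
  have hK0 : 0 ≤ K := add_nonneg T.profile.nonnegProfile.integral_bound_nonneg zero_le_one
  rw [ENNReal.tendsto_nhds_zero]
  intro ε hε
  have hε3 : 0 < ε / 3 := ENNReal.div_pos hε.ne' (by simp)
  -- The parameters are chosen in the order x, γ, δ: x is the admissible gradient mass near the
  -- poles, γ makes the mass of the limit at most x/2 there, and δ comes last because the constant A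
  -- depends on γ.
  obtain ⟨x, hx0, hx⟩ : ∃ x : ℝ≥0∞, 0 < x ∧ P * (C * x ^ q) ≤ ε / 3 := by
    have h1 : Tendsto (fun x : ℝ≥0∞ => P * (C * x ^ q)) (𝓝 0) (𝓝 0) := by
      have h2 := ENNReal.Tendsto.const_mul (ENNReal.Tendsto.const_mul
        ((ENNReal.continuous_rpow_const (y := q)).tendsto 0) (Or.inr (ENNReal.coe_ne_top (r := C))))
        (Or.inr hPt)
      rwa [ENNReal.zero_rpow_of_pos hq0, mul_zero, mul_zero] at h2
    have h3 : ∀ᶠ x in 𝓝[>] (0 : ℝ≥0∞), 0 < x := self_mem_nhdsWithin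
    exact (h3.and (nhdsWithin_le_nhds (h1.eventually (ge_mem_nhds hε3)))).exists
  obtain ⟨μ, hμ, hμD⟩ := exists_pos_setLIntegral_lt_of_measure_lt
    (μ := surf d) (f := fun ξ : Sph d => ‖w (colat ξ)‖ₑ) T.profile.integrable.2.ne
    (ENNReal.half_pos hx0.ne').ne'
  obtain ⟨γ, hγ0, hγ1, hγ⟩ : ∃ γ : ℝ, 0 < γ ∧ γ ≤ Real.pi / 4 ∧ surf d (caps d (2 * γ)) < μ := by
    have h1 : ∀ᶠ t in 𝓝[>] (0 : ℝ), 0 < t := self_mem_nhdsWithin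
    have h2 : ∀ᶠ t in 𝓝[>] (0 : ℝ), t < Real.pi / 4 :=
      nhdsWithin_le_nhds (gt_mem_nhds (by positivity))
    obtain ⟨t, ht, ht1, ht2⟩ := (h1.and (h2.and ((tendsto_surf_caps (d := d)).eventually (gt_mem_nhds hμ)))).exists
    exact ⟨t / 2, by linarith, by linarith, by rwa [mul_div_cancel₀ _ two_ne_zero]⟩
  set A := ENNReal.ofReal ((Real.pi ^ β / ballVol d (γ / 2) * K) ^ q) with hA
  have hS := ballVol_pos (d := d) (r := γ / 2) (by positivity) (by linarith)
  obtain ⟨δ, hδ0, hδ1, hδ⟩ : ∃ δ : ℝ, 0 < δ ∧ δ ≤ γ / 2 ∧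
      P * (2 * (A * surf d (caps d δ))) ≤ ε / 3 := by
    have h1 : ∀ᶠ t in 𝓝[>] (0 : ℝ), 0 < t := self_mem_nhdsWithin
    have h2 : Tendsto (fun t => P * (2 * (A * surf d (caps d t)))) (𝓝[>] 0) (𝓝 0) := by
      have h3 := ENNReal.Tendsto.const_mul (ENNReal.Tendsto.const_mul (ENNReal.Tendsto.const_mul
        (tendsto_surf_caps (d := d)) (Or.inr (ENNReal.ofReal_ne_top : A ≠ ⊤)))
        (Or.inr ENNReal.ofNat_ne_top : _ ∨ (2 : ℝ≥0∞) ≠ ⊤)) (Or.inr hPt)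
      rwa [mul_zero, mul_zero, mul_zero] at h3
    have h4 : ∀ᶠ t in 𝓝[>] (0 : ℝ), t ≤ γ / 2 :=
      nhdsWithin_le_nhds (ge_mem_nhds (by positivity))
    exact (h1.and (h4.and
      (h2.eventually (ge_mem_nhds hε3)))).exists
  have hcaps : ∀ G z : ℝ → ℂ, Profile d G z → ∫ ξ : Sph d, ‖z (colat ξ)‖ ∂(surf d) ≤ K →
      ∫⁻ ξ in caps d (2 * γ), ‖z (colat ξ)‖ₑ ∂(surf d) ≤ x →
      ∫⁻ ξ in caps d δ, ‖deriv (maxR d β fun τ => ‖G τ‖) (colat ξ)‖ₑ ^ q ∂(surf d) ≤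
        C * x ^ q + 2 * (A * surf d (caps d δ)) := by
    intro G z h h1 h2
    have h3 : 0 ≤ ∫ ξ : Sph d, ‖z (colat ξ)‖ ∂(surf d) := h.nonnegProfile.integral_bound_nonneg
    refine (hC G z h γ δ hγ0 hγ1 hδ1).trans ?_
    rw [hA]
    gcongr
  have hw := (hμD _ hγ).le
  have hannulus := ENNReal.Tendsto.const_mul
    (T.tendsto_setLIntegral hβ hβd hpos hδ0 (by linarith))
    (Or.inr (ENNReal.ofReal_ne_top (r := latConst d)))
  rw [mul_zero] at hannulus
  have hgrad' := ENNReal.tendsto_ofReal T.grad_tendsto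
  rw [ENNReal.ofReal_zero] at hgrad'
  filter_upwards [hgrad.eventually_lt_const (lt_add_one _),
    hgrad'.eventually (ge_mem_nhds (ENNReal.half_pos hx0.ne')),
    hannulus.eventually (ge_mem_nhds hε3)] with j j1 j2 j3
  have hwj : ∫⁻ ξ in caps d (2 * γ), ‖ws j (colat ξ)‖ₑ ∂(surf d) ≤ x := by
    have hm : Measurable fun ξ : Sph d => ‖w (colat ξ)‖ₑ :=
      (T.profile.meas.measurable.comp measurable_colat).enorm
    calc _ ≤ ∫⁻ ξ in caps d (2 * γ), (‖w (colat ξ)‖ₑ + ‖ws j (colat ξ) - w (colat ξ)‖ₑ) ∂(surf d) := by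
          refine lintegral_mono fun ξ => ?_
          have := enorm_add_le (w (colat ξ)) (ws j (colat ξ) - w (colat ξ))
          rwa [add_sub_cancel] at this
      _ ≤ x / 2 + x / 2 := by
          rw [lintegral_add_left hm]
          refine add_le_add hw ((setLIntegral_le_lintegral _ _).trans (le_trans (le_of_eq ?_) j2))
          exact (ofReal_integral_norm_eq_lintegral_enorm
            ((T.profile_seq j).integrable.sub T.profile.integrable)).symm
      _ = x := ENNReal.add_halves x
  have c1 := hcaps _ _ (T.profile_seq j) j1.le hwj
  have c2 := hcaps _ _ T.profile (lt_add_one _).le (hw.trans ENNReal.half_le_self)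
  have c3 : ∫⁻ ξ in caps d δ, ‖deriv (maxR d β fun τ => ‖Fs j τ‖) (colat ξ) -
      deriv (maxR d β fun τ => ‖F τ‖) (colat ξ)‖ₑ ^ q ∂(surf d) ≤ ε / 3 + ε / 3 := by
    calc _ ≤ ∫⁻ ξ in caps d δ, 2 ^ (q - 1) *
          (‖deriv (maxR d β fun τ => ‖Fs j τ‖) (colat ξ)‖ₑ ^ q +
            ‖deriv (maxR d β fun τ => ‖F τ‖) (colat ξ)‖ₑ ^ q) ∂(surf d) :=
          lintegral_mono fun ξ => enorm_sub_rpow_le hq1.le _ _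
      _ ≤ 2 ^ (q - 1) * ((C * x ^ q + 2 * (A * surf d (caps d δ))) +
          (C * x ^ q + 2 * (A * surf d (caps d δ)))) := by
          rw [lintegral_const_mul' _ _ (ENNReal.rpow_ne_top_of_nonneg (by linarith) (by simp)),
            lintegral_add_left ((measurable_deriv_comp_colat _).enorm.pow_const q)]
          gcongr
      _ = P * (C * x ^ q) + P * (2 * (A * surf d (caps d δ))) := by rw [hP]; ring
      _ ≤ _ := add_le_add hx hδ
  have c4 := setLIntegral_compl_caps_le (d := d) (g := fun τ =>
    ‖deriv (maxR d β fun τ => ‖Fs j τ‖) τ - deriv (maxR d β fun τ => ‖F τ‖) τ‖ₑ ^ q)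
    (((measurable_deriv _).sub (measurable_deriv _)).enorm.pow_const q) hδ0.le
  rw [← lintegral_add_compl _ (measurableSet_caps δ)]
  calc _ ≤ (ε / 3 + ε / 3) + ε / 3 := add_le_add c3 (c4.trans j3)
    _ = ε := ENNReal.add_thirds ε

end PolarSphere

end
-- The map on the Sobolev space and the theorem.
open MeasureTheory Set Filter Topology
open scoped ENNReal NNReal ContDiff

noncomputable section

namespace PolarSphere

variable {d : ℕ} [NeZero d] {β : ℝ}

theorem W11pol.exists_profile (f : W11pol d) : ∃ p : (ℝ → ℂ) × (ℝ → ℂ), Profile d p.1 p.2 ∧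
    f.toFun =ᵐ[surf d] (fun ξ => p.1 (colat ξ)) ∧ f.grad =ᵐ[surf d] radGrad p.2 := by
  obtain ⟨hW, f₀, hf₀, hff⟩ := f.2
  obtain ⟨F, w, h1, h2, h3⟩ := exists_profile_of_isWeakGradientOn hW (L1.integrable_coeFn _)
    (L1.integrable_coeFn _) hf₀ hff
  exact ⟨(F, w), h1, h2, h3⟩

/-- A profile of a polar Sobolev function. -/
def W11pol.prof (f : W11pol d) : (ℝ → ℂ) × (ℝ → ℂ) := f.exists_profile.choose

theorem W11pol.profile (f : W11pol d) : Profile d f.prof.1 f.prof.2 :=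
  f.exists_profile.choose_spec.1

theorem W11pol.toFun_ae_eq (f : W11pol d) : f.toFun =ᵐ[surf d] fun ξ => f.prof.1 (colat ξ) :=
  f.exists_profile.choose_spec.2.1

theorem W11pol.grad_ae_eq (f : W11pol d) : f.grad =ᵐ[surf d] radGrad f.prof.2 :=
  f.exists_profile.choose_spec.2.2

theorem W11pol.tendstoProfile {fs : ℕ → W11pol d} {f : W11pol d} (h : Tendsto fs atTop (𝓝 f)) :
    TendstoProfile d (fun j => (fs j).prof.1) (fun j => (fs j).prof.2) f.prof.1 f.prof.2 where
  profile_seq j := (fs j).profile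
  profile := f.profile
  fun_tendsto := by
    have hc : Continuous fun f : W11pol d => f.1.1 := continuous_fst.comp continuous_subtype_val
    have h1 := tendsto_iff_norm_sub_tendsto_zero.1 ((hc.tendsto f).comp h)
    refine h1.congr fun j => ?_
    rw [L1.norm_eq_integral_norm]
    refine integral_congr_ae ?_
    filter_upwards [Lp.coeFn_sub (fs j).1.1 f.1.1, (fs j).toFun_ae_eq, f.toFun_ae_eq] with ξ e1 e2 e3
    rw [← e2, ← e3]
    exact congrArg norm e1
  grad_tendsto := by
    have hc : Continuous fun f : W11pol d => f.1.2 := continuous_snd.comp continuous_subtype_val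
    have h1 := tendsto_iff_norm_sub_tendsto_zero.1 ((hc.tendsto f).comp h)
    refine h1.congr fun j => ?_
    rw [L1.norm_eq_integral_norm]
    refine integral_congr_ae ?_
    filter_upwards [Lp.coeFn_sub (fs j).1.2 f.1.2, (fs j).grad_ae_eq, f.grad_ae_eq, ae_colat_mem]
      with ξ e1 e2 e3 e4
    have e5 : radGrad (fun τ => (fs j).prof.2 τ - f.prof.2 τ) ξ = (fs j).grad ξ - f.grad ξ := by
      rw [e2, e3]
      ext i
      simp only [radGrad, PiLp.sub_apply, smul_sub]
    rw [← norm_radGrad (fun τ => (fs j).prof.2 τ - f.prof.2 τ) e4, e5]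
    exact congrArg norm e1

/-- The derivative of the profile of the maximal function of a polar Sobolev function. -/
def W11pol.maxDeriv (β : ℝ) (f : W11pol d) (ξ : Sph d) : ℝ :=
  deriv (maxR d β fun τ => ‖f.prof.1 τ‖) (colat ξ)

theorem W11pol.memLp_norm_maxDeriv (hloc : CenteredLocalBoundedness d β) (hβ : 0 < β)
    (hβd : β < d) (f : W11pol d) :
    MemLp (fun ξ => ‖f.maxDeriv β ξ‖) (ENNReal.ofReal (endpointExponent d β)) (surf d) :=
  (f.profile.memLp_deriv_maxR hloc hβ hβd).norm

/-- The space is first countable, so sequences suffice, and passing to absolute values does not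
increase distances in L^q. -/
theorem W11pol.continuous_toLp_norm_maxDeriv
    [Fact (1 ≤ ENNReal.ofReal (endpointExponent d β))] (hloc : CenteredLocalBoundedness d β)
    (hβ : 0 < β) (hβd : β < d) :
    Continuous fun f : W11pol d => (f.memLp_norm_maxDeriv hloc hβ hβd).toLp := by
  have hq0 : 0 < endpointExponent d β := by
    linarith [(endpointExponent_facts (d := d) hβ hβd).1]
  have : FirstCountableTopology (W11pol d) := Topology.IsInducing.subtypeVal.firstCountableTopology
  refine continuous_iff_seqContinuous.2 fun fs f h => ?_
  have h1 := (W11pol.tendstoProfile h).tendsto_lintegral hloc hβ hβd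
  refine (Lp.tendsto_Lp_iff_tendsto_eLpNorm'' (fun j ξ => ‖(fs j).maxDeriv β ξ‖)
    (fun j => (fs j).memLp_norm_maxDeriv hloc hβ hβd) _ _).2 ?_
  have h2 := ((ENNReal.continuous_rpow_const (y := 1 / endpointExponent d β)).tendsto 0).comp h1
  rw [ENNReal.zero_rpow_of_pos (by positivity)] at h2
  refine tendsto_of_tendsto_of_tendsto_of_le_of_le tendsto_const_nhds h2 (fun _ => zero_le)
    fun j => ?_
  rw [eLpNorm_eq_lintegral_rpow_enorm_toReal (by simpa using hq0) ENNReal.ofReal_ne_top,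
    ENNReal.toReal_ofReal hq0.le]
  refine ENNReal.rpow_le_rpow (lintegral_mono fun ξ => ENNReal.rpow_le_rpow ?_ hq0.le)
    (by positivity)
  exact enorm_le_iff_norm_le.2 (abs_norm_sub_norm_le _ _)

end PolarSphere

end

theorem mainTheorem5 (d : ℕ) (β : ℝ) (hβ : 0 < β) (hβd : β < d)
    (hloc : PolarSphere.CenteredLocalBoundedness d β) :
    haveI : Fact (1 ≤ ENNReal.ofReal (PolarSphere.endpointExponent d β)) :=
      ⟨PolarSphere.one_le_endpointExponent hβ hβd⟩
    ∃ T : PolarSphere.W11pol d →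
        Lp ℝ (ENNReal.ofReal (PolarSphere.endpointExponent d β)) (PolarSphere.surf d),
      Continuous T ∧
      ∀ f : PolarSphere.W11pol d,
        (∀ᵐ ξ ∂(PolarSphere.surf d), PolarSphere.fracMaximal β f.toFun ξ < ⊤) ∧
        ∃ H : PolarSphere.Sph d → EuclideanSpace ℝ (Fin (d + 1)),
          PolarSphere.IsWeakGradientOn univ
            (fun ξ => (PolarSphere.fracMaximal β f.toFun ξ).toReal) H ∧
          T f =ᵐ[PolarSphere.surf d] fun ξ => ‖H ξ‖ := by
  have : Fact (1 ≤ ENNReal.ofReal (PolarSphere.endpointExponent d β)) :=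
    ⟨PolarSphere.one_le_endpointExponent hβ hβd⟩
  -- The condition 0 < β < d excludes d = 0.
  have : NeZero d := ⟨by rintro rfl; rw [Nat.cast_zero] at hβd; exact lt_asymm hβ hβd⟩
  refine ⟨fun f => (f.memLp_norm_maxDeriv hloc hβ hβd).toLp,
    PolarSphere.W11pol.continuous_toLp_norm_maxDeriv hloc hβ hβd, fun f => ⟨?_, ?_⟩⟩
  · filter_upwards [PolarSphere.ae_colat_mem] with ξ hξ
    rw [PolarSphere.fracMaximal_eq f.toFun_ae_eq f.profile.integrable_comp]
    exact f.profile.nonnegProfile.maxFn_lt_top hβ hξ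
  · refine ⟨_, (f.profile.isWeakGradientOn_maxR hloc hβ hβd).congr_ae
      (Eventually.of_forall fun ξ => ?_) EventuallyEq.rfl, ?_⟩
    · simp only [PolarSphere.fracMaximal_eq f.toFun_ae_eq f.profile.integrable_comp,
        PolarSphere.maxR]
    · filter_upwards [(f.memLp_norm_maxDeriv hloc hβ hβd).coeFn_toLp, PolarSphere.ae_colat_mem]
        with ξ h1 h2
      rw [h1, PolarSphere.norm_radGrad _ h2]
      rfl
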